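/- **Conventions.** For $N\ge 1$ let $M=\mathrm{nint}(N^{2/3})$ be the nearest integer to $N^{2/3}$, and let $f:\{1,\dots,N\}\to S$ be a black-box function into a finite set $S$, identified with $\{0,\dots,m-1\}$. An $M$-subset of $\{1,\dots,N\}$ is *marked* if it contains two distinct indices with the same value of $f$. Let $G_f$ be the Johnson graph $J(N,M)$ (vertices: the $M$-subsets of $\{1,\dots,N\}$; edges: pairs of subsets that differ in exactly one element) with one extra pendant vertex attached to every marked subset. The Hamiltonian of the continuous-time quantum walk is $$H_f=\frac{1}{N^{2/3}}\bigl(A_{J(N,M)}-M(N-M)\bigr)+A_{\rm pendant},$$ where the first term acts on the vertices of $J(N,M)$ and $A_{\rm pendant}$ is the adjacency matrix of the pendant edges. The initial state $|\psi(0)\rangle$ is the uniform superposition of the vertices of $J(N,M)$, and $|\psi(t)\rangle=e^{-iH_ft}|\psi(0)\rangle$. If $\{x,y\}$ is the unique pair of distinct indices with $f(x)=f(y)$, let $|A_j\rangle$ ($j=0,1,2$) be the uniform superposition of the $M$-subsets containing exactly $j$ elements of $\{x,y\}$, and $|B_2\rangle$ that of the pendant vertices (a uniform superposition over the empty set is $0$).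 For a matrix $X$, $\mathrm{abs}(X)$ is the elementwise absolute value and $\|\cdot\|$ the spectral norm. A *quantum query algorithm* starts in a fixed basis state and alternates unitaries independent of $f$ with the black box $|i,b,w\rangle\mapsto|i,b+f(i)\bmod m,w\rangle$. **Theorem.** 1. If $f$ has a unique colliding pair $\{x,y\}$, the span of $|A_0\rangle,|A_1\rangle,|A_2\rangle,|B_2\rangle$ is invariant under $H_f$, which acts on these vectors as the matrix $$H=\frac{1}{N^{2/3}}\begin{pmatrix}-2M&\sqrt{2M(N-M-1)}&0&0\\ \sqrt{2M(N-M-1)}&2-N&\sqrt{2(N-M)(M-1)}&0\\ 0&\sqrt{2(N-M)(M-1)}&2(M-N)&0\\0&0&0&0\end{pmatrix}+\begin{pmatrix}0&0&0&0\\0&0&0&0\\0&0&0&1\\0&0&1&0\end{pmatrix}$$ (square roots of negative numbers, which occur only for very small $N$, are read as $0$). 2. $\|\mathrm{abs}(H)\|=2N^{1/3}+O(N^{-1/3})$ as $N\to\infty$, for this $4\times4$ matrix $H$. 3. There are constants $c,C>0$ and $N_0$ such that for every $N\ge N_0$ there is a time $t\in[0,CN^{1/3}]$ with $|\langle B_2|\psi(t)\rangle|\ge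 c$ for every $f$ with a unique colliding pair. 4. There is a constant $C$ such that for all $N\ge5$, $t\ge0$ and $\delta\in(0,1]$ the evolution $e^{-iHt}$ is simulated with fidelity at least $1-\delta$ on every input state by at most $C\,\|\mathrm{abs}(H)\|\,t/\sqrt\delta$ steps of a discrete-time quantum walk (so by $O(N^{2/3}/\sqrt\delta)$ steps if $t=O(N^{1/3})$). Here the walk is the one corresponding to $G=-H$, and it is used to simulate $e^{-iHt}=e^{-iG(-t)}$: its step is $U=iS(2TT^\dagger-1)$ with $S|j,k\rangle=|k,j\rangle$, $T=\sum_j|\psi_j\rangle\langle j|$, $|\psi_j\rangle=\|\mathrm{abs}(G)\|^{-1/2}\sum_k\sqrt{G_{jk}^*d_k/d_j}\,|j,k\rangle$, where $d$ is an entrywise positive principal eigenvector of $\mathrm{abs}(G)$ (which exists) and the branches of the square roots of $G_{jk}^*$ and $G_{kj}^*$, $j<k$, are complex conjugates of each other. The simulation is $T^\dagger P^\dagger FPT$, where $P$ is coherent phase estimation of $U$ modulo $K$ (for some $K\ge1$) with initial phase-register state $\sqrt{2/(K+1)}\sum_{x=0}^{K-1}\sin\frac{\pi(x+1)}{K+1}|x\rangle$,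 and $F|w,\varphi\rangle=e^{i\|\mathrm{abs}(H)\|t\sin\varphi}|w,\varphi\rangle$; it uses $2(K-1)$ steps of the walk. 5. For all $\tau,\delta>0$ there is a constant $C$ such that for all $N,m\ge1$ and $0\le t\le\tau N^{1/3}$ there are a quantum query algorithm with at most $CN^{2/3}$ queries and an injective encoding, independent of $f$, of the data (pendant or not; subset; values of $f$ on the subset) into its basis states, such that for every $f$ with at most one colliding pair the final state of the algorithm has fidelity at least $1-\delta$ with the encoding of $|\psi(t)\rangle$. 6. Element distinctness is solved with $O(N^{2/3})$ queries: there is a constant $C$ such that for all $N,m\ge1$ there is a quantum query algorithm with at most $CN^{2/3}$ queries that, for every $f$ (with any number of collisions), accepts with probability at least $2/3$ if $f(x)=f(y)$ for some $x\ne y$, and with probability at most $1/3$ otherwise. The fidelity of two vectors is the absolute value of their inner product. -/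

import Mathlib

open Filter Asymptotics Matrix

noncomputable section

namespace EDWalk

/-! ### General notions -/

/-- The unit vector `|A⟩ = ∑_{v ∈ A} |v⟩ / √|A|` (zero if `A` is empty). -/
def uniformOn {ι : Type*} [DecidableEq ι] (A : Finset ι) : ι → ℂ :=
  fun v => if v ∈ A then ((1 / √(A.card : ℝ) : ℝ) : ℂ) else 0

/-- The evolution `exp(-i H t)` generated by a Hamiltonian `H`. -/
def evolution {ι : Type*} [Fintype ι] [DecidableEq ι] (H : Matrix ι ι ℂ) (t : ℝ) :
    Matrix ι ι ℂ :=
  NormedSpace.exp ((-(Complex.I * (t : ℂ))) • H)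

/-- The elementwise absolute value `abs(H)`. -/
def elemAbs {ι : Type*} (H : Matrix ι ι ℂ) : Matrix ι ι ℝ := fun j k => ‖H j k‖

/-- `‖abs(H)‖`, the spectral norm (operator norm for the Euclidean norm) of `abs(H)`. -/
def absNorm {ι : Type*} [Fintype ι] [DecidableEq ι] (H : Matrix ι ι ℂ) : ℝ :=
  ‖Matrix.toEuclideanCLM (n := ι) (𝕜 := ℝ) (elemAbs H)‖

/-! ### The walk for element distinctness -/

/-- `M = nint(N^{2/3})`, the nearest integer to `N^{2/3}`. -/
def subsetSize (N : ℕ) : ℕ := (round ((N : ℝ) ^ (2 / 3 : ℝ))).toNat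

/-- The `M`-element subsets of an `N`-element set. -/
abbrev Subsets (N M : ℕ) : Type := {s : Finset (Fin N) // s.card = M}

/-- The Johnson graph `J(N, M)`: two `M`-subsets are adjacent if they differ in exactly one
element. -/
def johnsonGraph (N M : ℕ) : SimpleGraph (Subsets N M) where
  Adj s t := (s.1 \ t.1).card = 1
  symm := ⟨fun s t h => by
    rw [Finset.card_sdiff_comm (t.2.trans s.2.symm)]; exact h⟩
  loopless := ⟨fun s h => by simp at h⟩

instance (N M : ℕ) : DecidableRel (johnsonGraph N M).Adj :=
  fun s t => inferInstanceAs (Decidable ((s.1 \ t.1).card = 1))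

section walk

variable {N m : ℕ}

/-- A subset is marked if it contains two distinct indices with the same value of `f`. -/
def Marked (f : Fin N → Fin m) (s : Subsets N (subsetSize N)) : Prop :=
  ∃ x ∈ s.1, ∃ y ∈ s.1, x ≠ y ∧ f x = f y

instance (f : Fin N → Fin m) : DecidablePred (Marked f) :=
  fun s => inferInstanceAs (Decidable (∃ x ∈ s.1, ∃ y ∈ s.1, x ≠ y ∧ f x = f y))

/-- The vertices of the modified graph: `inl s` is the vertex `s` of `J(N, M)`, and `inr s` is the
extra pendant vertex attached to the marked subset `s`. -/
abbrev WalkVertex (f : Fin N → Fin m) : Type :=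
  Subsets N (subsetSize N) ⊕ {s : Subsets N (subsetSize N) // Marked f s}

/-- The Hamiltonian of the walk: `N^{-2/3} (A - M (N - M))` on the vertices of the Johnson graph
(`A` its adjacency matrix), plus the adjacency matrix of the pendant edges. -/
def walkHamiltonian (f : Fin N → Fin m) : Matrix (WalkVertex f) (WalkVertex f) ℂ :=
  Matrix.fromBlocks
    ((((1 / (N : ℝ) ^ (2 / 3 : ℝ) : ℝ)) : ℂ) •
      ((johnsonGraph N (subsetSize N)).adjMatrix ℂ
        - ((subsetSize N : ℂ) * ((N : ℂ) - (subsetSize N : ℂ))) • 1))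
    (Matrix.of fun s b => if s = b.1 then 1 else 0)
    (Matrix.of fun b s => if s = b.1 then 1 else 0)
    0

/-- The original vertices (those of the Johnson graph). -/
def originalVertices (f : Fin N → Fin m) : Finset (WalkVertex f) :=
  Finset.univ.filter fun v => v.isLeft = true

/-- `B₂`: the pendant vertices. -/
def pendantVertices (f : Fin N → Fin m) : Finset (WalkVertex f) :=
  Finset.univ.filter fun v => v.isRight = true

/-- `A_j`: the `M`-subsets containing exactly `j` elements of `{x, y}`. -/
def classA (f : Fin N → Fin m) (x y : Fin N) (j : ℕ) : Finset (WalkVertex f) :=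
  (Finset.univ.filter fun s : Subsets N (subsetSize N) => (s.1 ∩ {x, y}).card = j).map
    Function.Embedding.inl

/-- The matrix with columns `|A₀⟩, |A₁⟩, |A₂⟩, |B₂⟩`. -/
def reducedBasis (f : Fin N → Fin m) (x y : Fin N) : Matrix (WalkVertex f) (Fin 4) ℂ :=
  Matrix.of fun v j =>
    (![uniformOn (classA f x y 0), uniformOn (classA f x y 1), uniformOn (classA f x y 2),
      uniformOn (pendantVertices f)] : Fin 4 → WalkVertex f → ℂ) j v

/-- The state at time `t` of the continuous-time walk started in the uniform superposition over the
vertices of the Johnson graph. -/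
def walkState (f : Fin N → Fin m) (t : ℝ) : WalkVertex f → ℂ :=
  evolution (walkHamiltonian f) t *ᵥ uniformOn (originalVertices f)

/-- `{x, y}` is the unique pair of distinct indices with `f x = f y`. -/
def UniqueCollision (f : Fin N → Fin m) (x y : Fin N) : Prop :=
  x ≠ y ∧ f x = f y ∧
    ∀ x' y', x' ≠ y' → f x' = f y' → (x' = x ∧ y' = y) ∨ (x' = y ∧ y' = x)

/-- The classical data stored for a vertex: whether it is a pendant vertex, and the subset together
with the values of `f` on it (the partial function which is `f` on the subset and undefined
elsewhere). -/
def vertexLabel (f : Fin N → Fin m) : WalkVertex f → Bool × (Fin N → Option (Fin m))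
  | Sum.inl s => (false, fun x => if x ∈ s.1 then some (f x) else none)
  | Sum.inr b => (true, fun x => if x ∈ b.1.1 then some (f x) else none)

end walk

/-- `H_U` in the basis `|A₀⟩, |A₁⟩, |A₂⟩, |B₂⟩`. -/
def reducedHU (N : ℕ) : Matrix (Fin 4) (Fin 4) ℝ :=
  let n : ℝ := N
  let M : ℝ := subsetSize N
  (1 / n ^ (2 / 3 : ℝ)) •
    !![-2 * M, √(2 * M * (n - M - 1)), 0, 0;
       √(2 * M * (n - M - 1)), 2 - n, √(2 * (n - M) * (M - 1)), 0;
       0, √(2 * (n - M) * (M - 1)), 2 * (M - n), 0;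
       0, 0, 0, 0]

/-- `H_C` in the basis `|A₀⟩, |A₁⟩, |A₂⟩, |B₂⟩`. -/
def reducedHC : Matrix (Fin 4) (Fin 4) ℝ :=
  !![0, 0, 0, 0;
     0, 0, 0, 0;
     0, 0, 0, 1;
     0, 0, 1, 0]

/-- The `4 × 4` Hamiltonian `H = H_U + H_C`. -/
def reducedHamiltonian (N : ℕ) : Matrix (Fin 4) (Fin 4) ℂ :=
  (reducedHU N + reducedHC).map (fun r : ℝ => (r : ℂ))

/-! ### The discrete-time walk of a Hamiltonian, and simulation by phase estimation -/

section discrete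

variable {ι : Type*} [Fintype ι] [LinearOrder ι]

/-- `d` is a principal eigenvector of `abs(G)` with positive entries. -/
def IsPrincipal (G : Matrix ι ι ℂ) (d : ι → ℝ) : Prop :=
  (∀ j, 0 < d j) ∧ elemAbs G *ᵥ d = absNorm G • d

/-- The square root of `conj (G j k)`. The branches are chosen such that
`conj (rootEntry G j k) * rootEntry G k j = G j k` for Hermitian `G` with nonnegative diagonal. -/
def rootEntry (G : Matrix ι ι ℂ) (j k : ι) : ℂ :=
  if j ≤ k then (star (G j k)) ^ (1 / 2 : ℂ) else star ((star (G k j)) ^ (1 / 2 : ℂ))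

/-- The isometry `T = ∑_j |ψ_j⟩⟨j|`, where
`|ψ_j⟩ = ‖abs(G)‖^{-1/2} ∑_k √(conj(G_{jk}) d_k / d_j) |j, k⟩`. -/
def isometryT (G : Matrix ι ι ℂ) (d : ι → ℝ) : Matrix (ι × ι) ι ℂ :=
  Matrix.of fun p l =>
    if p.1 = l then rootEntry G p.1 p.2 * ((√(d p.2 / d p.1) / √(absNorm G) : ℝ) : ℂ) else 0

/-- The swap `|j, k⟩ ↦ |k, j⟩`. -/
def swapS (ι : Type*) [LinearOrder ι] : Matrix (ι × ι) (ι × ι) ℂ :=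
  Matrix.of fun p q => if p = q.swap then 1 else 0

/-- One step `U = i S (2 T T† - 1)` of the discrete-time quantum walk corresponding to `G`. -/
def discreteWalk (G : Matrix ι ι ℂ) (d : ι → ℝ) : Matrix (ι × ι) (ι × ι) ℂ :=
  Complex.I • (swapS ι * ((2 : ℂ) • (isometryT G d * (isometryT G d)ᴴ) - 1))

/-- Coherent phase estimation modulo `K` on `U`, with input state
`√(2/(K+1)) ∑_{x<K} sin(π(x+1)/(K+1)) |x⟩` in the phase register. The outcome `j` stands for the
phase `2πj/K`. It uses `K - 1` applications of `U`. -/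
def phaseEstimation {κ : Type*} [Fintype κ] [DecidableEq κ] (U : Matrix κ κ ℂ) (K : ℕ) :
    Matrix (κ × Fin K) κ ℂ :=
  Matrix.of fun p q =>
    ∑ x : Fin K,
      ((√(2 / ((K : ℝ) + 1)) * Real.sin (Real.pi * ((x : ℝ) + 1) / ((K : ℝ) + 1)) / √(K : ℝ) : ℝ) : ℂ)
        * Complex.exp (-(2 * Real.pi * (x : ℝ) * ((p.2 : ℕ) : ℝ) / (K : ℝ)) * Complex.I)
        * (U ^ (x : ℕ)) p.1 q

/-- The phase gate `|w, φ⟩ ↦ e^{-i s sin φ} |w, φ⟩`. -/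
def phaseGate (κ : Type*) [DecidableEq κ] (K : ℕ) (s : ℝ) : Matrix (κ × Fin K) (κ × Fin K) ℂ :=
  Matrix.diagonal fun p =>
    Complex.exp (-(s * Real.sin (2 * Real.pi * ((p.2 : ℕ) : ℝ) / (K : ℝ)) : ℝ) * Complex.I)

/-- The simulation `T† P† F P T` of `exp(-i G t)`. -/
def simulation (G : Matrix ι ι ℂ) (d : ι → ℝ) (K : ℕ) (t : ℝ) : Matrix ι ι ℂ :=
  let P := phaseEstimation (discreteWalk G d) K
  (isometryT G d)ᴴ * Pᴴ * phaseGate (ι × ι) K (absNorm G * t) * P * isometryT G d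

/-- The number of steps of the discrete-time walk used by `simulation`: `K - 1` for the phase
estimation and `K - 1` for its inverse. -/
def simulationSteps (K : ℕ) : ℕ := 2 * (K - 1)

end discrete

/-! ### Quantum query algorithms -/

/-- The black box `|i, b, w⟩ ↦ |i, b + f(i) mod m, w⟩`. -/
def oracle {N m : ℕ} {W : Type} [DecidableEq W] (f : Fin N → Fin m) :
    Matrix (Fin N × Fin m × W) (Fin N × Fin m × W) ℂ :=
  Matrix.of fun p q => if p = (q.1, q.2.1 + f q.1, q.2.2) then 1 else 0

/-- A quantum query algorithm for functions `f : {1, …, N} → {0, …, m - 1}`: a finite work register,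
a starting basis state, a number of queries, and the input-independent unitaries that precede,
separate and follow the queries. -/
structure QueryAlgorithm (N m : ℕ) where
  W : Type
  [fintypeW : Fintype W]
  [decEqW : DecidableEq W]
  queries : ℕ
  gate : ℕ → Matrix.unitaryGroup (Fin N × Fin m × W) ℂ
  start : Fin N × Fin m × W

attribute [instance] QueryAlgorithm.fintypeW QueryAlgorithm.decEqW

namespace QueryAlgorithm

variable {N m : ℕ}

/-- The computational basis states. -/
abbrev Idx (Q : QueryAlgorithm N m) : Type := Fin N × Fin m × Q.W

/-- The state after `k` queries and the gate that follows. -/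
def stateAfter (Q : QueryAlgorithm N m) (f : Fin N → Fin m) : ℕ → Q.Idx → ℂ
  | 0 => (Q.gate 0).1 *ᵥ Pi.single Q.start 1
  | k + 1 => (Q.gate (k + 1)).1 *ᵥ (oracle f *ᵥ stateAfter Q f k)

/-- The final state. -/
def final (Q : QueryAlgorithm N m) (f : Fin N → Fin m) : Q.Idx → ℂ := Q.stateAfter f Q.queries

/-- The probability that measuring the final state gives an outcome in `E`. -/
def prob (Q : QueryAlgorithm N m) (f : Fin N → Fin m) (E : Finset Q.Idx) : ℝ :=
  ∑ p ∈ E, ‖Q.final f p‖ ^ 2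

end QueryAlgorithm

end EDWalk

end

/-! Everything rests on the Laplacian of the Johnson graph restricted to functions of |s ∩ {x, y}|.
Exchange counting and double counting of edges turn it into a 3 × 3 matrix L. The pendant edges only
exchange |A₂⟩ and |B₂⟩, so H closes on four vectors. `reducedLaplacian_decomp` gives the spectrum of
L: 0 on the uniform vector s, then N and 2(N - 1). The gap N and the overlap α = ⟨A₂|s⟩ ≈ N^{-1/3}
are the only quantitative inputs.

Norm. Conjugation by the signs (1, -1, 1) makes |L| isospectral with L, so the 3 × 3 part of abs(H)
has norm 2(N - 1)/N^{2/3} with a positive eigenvector. The pendant edge perturbs this by at most the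
reciprocal.

Overlap. `exists_potential` supplies y with L y = e₂ - αs and |y| ≤ 1/N. Then w = |B₂⟩ + N^{2/3} y
is within O(N^{-1/3}) of |B₂⟩, and H w is αs plus a tiny multiple of |B₂⟩, while H s = α|B₂⟩. Thus s
and |B₂⟩ behave like a two-level system of frequency α, and small overlap with |B₂⟩ during the whole
time N^{1/3} is contradictory.

Discrete simulation. On the range of T, (U - U†)/2i acts as G/‖abs(G)‖. Phase estimation with the
sine window approximately intertwines this operator with sin φ in the phase register: the squared
error is 4π²/(K + 1)² on every state. The two operators commute, so the fidelity is the expectation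
of the exponential of their difference, and Re e^{-ix} ≥ 1 - x²/2 makes the loss quadratic in this
error.

Queries. The walk of the algorithm is a product of two reflections. `shift` moves between subsets
with four queries; `coin` acts only on the stored data. The compression of 1 - `shift` to the
embedded subsets is a multiple of the Johnson Laplacian, so y yields a vector ζ with ‖ζ‖² ≤ M + 1,
reversed by `shift` and, after subtraction of a - αs (with a the embedded |A₂⟩), by `coin` as well.
This vector serves two purposes. For the simulation, a coin of small angle φ rotates s towards the
pendant states by α sin φ per step, with ζ absorbing the first-order error. Since ‖Hψ(t)‖ is
conserved, the gap keeps ψ(t) near the span of s and |B₂⟩, with coefficients independent of f. It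
therefore suffices to prepare that superposition: O(N^{2/3}) small rotations and a final gate for
the phases. Boundedly many N are handled by reading all of f. For element distinctness, the coin
reverses every colliding subset. For any colliding pair, however many others there are, w = ζ/(2α) +
s/2 satisfies w - U w = s. The sums of the powers of U on s then telescope and stay O(N^{2/3}), so
their average is small; without collisions U fixes s. The average is the amplitude of |0⟩ in a
control register. -/

namespace EDWalk

/-! ### Exchanges in the Johnson graph and the classes of subsets relative to a pair. -/

section johnson

variable {N M : ℕ}

/-- The subset obtained from `s` by exchanging `k ∈ s` for `l ∉ s`. -/
def exchange (s : Subsets N M) (k l : Fin N) (hk : k ∈ s.1) (hl : l ∉ s.1) : Subsets N M :=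
  ⟨insert l (s.1.erase k), by
    have h : l ∉ s.1.erase k := fun h => hl (Finset.mem_of_mem_erase h)
    rw [Finset.card_insert_of_notMem h, Finset.card_erase_of_mem hk, s.2]
    have : 0 < s.1.card := Finset.card_pos.2 ⟨k, hk⟩
    rw [s.2] at this
    omega⟩

/-- Neighbours of `s` correspond bijectively to pairs (k, l) with k removed and l inserted; k and l
are recovered as the single elements of the two set differences. Letting `F` act on plain finsets
keeps cardinality proofs out of the double sum. -/
theorem sum_neighbors (s : Subsets N M) (F : Finset (Fin N) → ℂ) :
    ∑ t : Subsets N M, (johnsonGraph N M).adjMatrix ℂ s t * F t.1 =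
      ∑ k ∈ s.1, ∑ l ∈ s.1ᶜ, F (insert l (s.1.erase k)) := by
  have h1 : ∑ t : Subsets N M, (johnsonGraph N M).adjMatrix ℂ s t * F t.1 =
      ∑ t ∈ Finset.univ.filter (fun t : Subsets N M => (s.1 \ t.1).card = 1), F t.1 := by
    rw [Finset.sum_filter]
    refine Finset.sum_congr rfl fun t _ => ?_
    rw [SimpleGraph.adjMatrix_apply]
    change (if (s.1 \ t.1).card = 1 then (1 : ℂ) else 0) * _ = _
    split_ifs <;> simp
  rw [h1, ← Finset.sum_product' s.1 s.1ᶜ fun k l => F (insert l (s.1.erase k))]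
  symm
  refine Finset.sum_bij (fun p hp => exchange s p.1 p.2 (Finset.mem_product.1 hp).1
    (Finset.mem_compl.1 (Finset.mem_product.1 hp).2)) ?_ ?_ ?_ ?_
  · rintro ⟨k, l⟩ hp
    have hk : k ∈ s.1 := (Finset.mem_product.1 hp).1
    have hl : l ∉ s.1 := Finset.mem_compl.1 (Finset.mem_product.1 hp).2
    refine Finset.mem_filter.2 ⟨Finset.mem_univ _, ?_⟩
    have : s.1 \ (insert l (s.1.erase k)) = {k} := by
      ext a
      simp only [Finset.mem_sdiff, Finset.mem_insert, Finset.mem_erase, Finset.mem_singleton]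
      grind
    simp [exchange, this]
  · rintro ⟨k, l⟩ hp ⟨k', l'⟩ hp' h
    have hk : k ∈ s.1 := (Finset.mem_product.1 hp).1
    have hl : l ∉ s.1 := Finset.mem_compl.1 (Finset.mem_product.1 hp).2
    have hk' : k' ∈ s.1 := (Finset.mem_product.1 hp').1
    have hl' : l' ∉ s.1 := Finset.mem_compl.1 (Finset.mem_product.1 hp').2
    have h2 : insert l (s.1.erase k) = insert l' (s.1.erase k') := congrArg Subtype.val h
    have e1 : k ∉ insert l' (s.1.erase k') := by
      rw [← h2]; simp; rintro rfl; exact hl hk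
    have e2 : l ∈ insert l' (s.1.erase k') := by rw [← h2]; simp
    simp only [Finset.mem_insert, Finset.mem_erase] at e1 e2
    ext
    · grind
    · grind
  · intro t ht
    have ht1 : (s.1 \ t.1).card = 1 := (Finset.mem_filter.1 ht).2
    have ht2 : (t.1 \ s.1).card = 1 := by
      rw [Finset.card_sdiff_comm (t.2.trans s.2.symm)]; exact ht1
    obtain ⟨k, hk⟩ := Finset.card_eq_one.1 ht1
    obtain ⟨l, hl⟩ := Finset.card_eq_one.1 ht2
    have hk1 := fun a => Finset.ext_iff.1 hk a
    have hl1 := fun a => Finset.ext_iff.1 hl a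
    simp only [Finset.mem_sdiff, Finset.mem_singleton] at hk1 hl1
    refine ⟨(k, l), Finset.mem_product.2 ⟨((hk1 k).2 rfl).1, ?_⟩, ?_⟩
    · exact Finset.mem_compl.2 ((hl1 l).2 rfl).2
    · apply Subtype.ext
      ext a
      simp only [exchange, Finset.mem_insert, Finset.mem_erase]
      have := hk1 a
      have := hl1 a
      grind
  · rintro ⟨k, l⟩ hp
    rfl

/-- The number of elements of `{x, y}` in `s`. -/
def pairCount (x y : Fin N) (s : Finset (Fin N)) : ℕ := (s ∩ {x, y}).card

theorem pairCount_le_two (x y : Fin N) (s : Finset (Fin N)) : pairCount x y s ≤ 2 :=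
  (Finset.card_le_card Finset.inter_subset_right).trans Finset.card_le_two

theorem pairCount_compl {x y : Fin N} (hxy : x ≠ y) (s : Finset (Fin N)) :
    (sᶜ ∩ {x, y}).card = 2 - pairCount x y s := by
  have h := Finset.card_sdiff_add_card_inter ({x, y} : Finset (Fin N)) s
  rw [Finset.card_pair hxy] at h
  have h2 : sᶜ ∩ {x, y} = {x, y} \ s := by ext; simp; tauto
  rw [h2, pairCount, Finset.inter_comm s]
  omega

theorem pairCount_exchange {x y : Fin N} {s : Finset (Fin N)} {k l : Fin N}
    (hk : k ∈ s) (hl : l ∉ s) :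
    (pairCount x y (insert l (s.erase k)) : ℤ) =
      pairCount x y s - (if k ∈ ({x, y} : Finset (Fin N)) then 1 else 0)
        + (if l ∈ ({x, y} : Finset (Fin N)) then 1 else 0) := by
  have h1 : (pairCount x y (s.erase k) : ℤ) =
      pairCount x y s - (if k ∈ ({x, y} : Finset (Fin N)) then 1 else 0) := by
    unfold pairCount
    split_ifs with h
    · rw [Finset.erase_inter, Finset.card_erase_of_mem (Finset.mem_inter.2 ⟨hk, h⟩)]
      have : 0 < (s ∩ {x, y}).card := Finset.card_pos.2 ⟨k, Finset.mem_inter.2 ⟨hk, h⟩⟩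
      omega
    · rw [Finset.erase_inter, Finset.erase_eq_of_notMem (fun h' => h (Finset.mem_inter.1 h').2)]
      simp
  rw [← h1]
  unfold pairCount
  split_ifs with h
  · rw [Finset.insert_inter_of_mem h, Finset.card_insert_of_notMem]
    · push_cast; ring
    · simp [hl]
  · rw [Finset.insert_inter_of_notMem h]; simp

/-- The action of the adjacency matrix of the Johnson graph on a function of `pairCount`. -/
theorem adjMatrix_pairCount {x y : Fin N} (hxy : x ≠ y) (s : Subsets N M) (F : ℤ → ℂ) :
    ∑ t : Subsets N M, (johnsonGraph N M).adjMatrix ℂ s t * F (pairCount x y t.1) =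
      ((pairCount x y s.1 : ℂ) * (2 - pairCount x y s.1) +
        (M - pairCount x y s.1) * (N - M - 2 + pairCount x y s.1)) * F (pairCount x y s.1) +
      (pairCount x y s.1 : ℂ) * (N - M - 2 + pairCount x y s.1) * F (pairCount x y s.1 - 1) +
      (M - pairCount x y s.1 : ℂ) * (2 - pairCount x y s.1) * F (pairCount x y s.1 + 1) := by
  rw [sum_neighbors s fun t => F (pairCount x y t)]
  set c := pairCount x y s.1 with hc
  have key : ∀ (A : Finset (Fin N)) (u v : ℂ),
      ∑ l ∈ A, (if l ∈ ({x, y} : Finset (Fin N)) then u else v) =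
        ((A ∩ {x, y}).card : ℂ) * u + ((A.card : ℂ) - (A ∩ {x, y}).card) * v := by
    intro A u v
    rw [Finset.sum_ite, Finset.sum_const, Finset.sum_const, Finset.filter_mem_eq_inter,
      ← Finset.card_filter_add_card_filter_not (s := A) (fun l => l ∈ ({x, y} : Finset (Fin N))),
      Finset.filter_mem_eq_inter]
    push_cast
    simp only [nsmul_eq_mul]
    ring
  have h1 : ∀ k ∈ s.1, ∑ l ∈ s.1ᶜ, F (pairCount x y (insert l (s.1.erase k))) =
      if k ∈ ({x, y} : Finset (Fin N)) then
        (2 - c : ℂ) * F c + (N - M - 2 + c : ℂ) * F (c - 1)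
      else (2 - c : ℂ) * F (c + 1) + (N - M - 2 + c : ℂ) * F c := by
    intro k hk
    have h2 : ∀ l ∈ s.1ᶜ, F (pairCount x y (insert l (s.1.erase k))) =
        if l ∈ ({x, y} : Finset (Fin N)) then
          F (c - (if k ∈ ({x, y} : Finset (Fin N)) then 1 else 0) + 1)
        else F (c - (if k ∈ ({x, y} : Finset (Fin N)) then 1 else 0)) := by
      intro l hl
      rw [pairCount_exchange hk (Finset.mem_compl.1 hl)]
      by_cases h : l ∈ ({x, y} : Finset (Fin N))
      · rw [if_pos h, if_pos h]
      · rw [if_neg h, if_neg h, add_zero]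
    rw [Finset.sum_congr rfl h2, key, pairCount_compl hxy, Finset.card_compl, s.2, ← hc,
      Fintype.card_fin, Nat.cast_sub (pairCount_le_two x y s.1), Nat.cast_sub]
    · split_ifs
      · simp only [Nat.cast_ofNat, sub_add_cancel]; ring
      · simp only [Nat.cast_ofNat, sub_zero]; ring
    · have := Finset.card_le_univ s.1
      rwa [s.2, Fintype.card_fin] at this
  rw [Finset.sum_congr rfl h1, key, s.2]
  change (c : ℂ) * _ + ((M : ℂ) - c) * _ = _
  ring

/-- The `M`-subsets containing exactly `j` elements of `{x, y}`. -/
def pairClass (M : ℕ) (x y : Fin N) (j : ℕ) : Finset (Subsets N M) :=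
  Finset.univ.filter fun s => pairCount x y s.1 = j

theorem mem_pairClass {x y : Fin N} {j : ℕ} {s : Subsets N M} :
    s ∈ pairClass M x y j ↔ pairCount x y s.1 = j := by
  simp [pairClass]

/-- Double counting of the edges between two classes, by symmetry of adjacency. -/
theorem card_pairClass_mul (x y : Fin N) (i j : ℕ) (a b : ℂ)
    (ha : ∀ s ∈ pairClass M x y i, ∑ t : Subsets N M, (johnsonGraph N M).adjMatrix ℂ s t *
      (if t ∈ pairClass M x y j then 1 else 0) = a)
    (hb : ∀ s ∈ pairClass M x y j, ∑ t : Subsets N M, (johnsonGraph N M).adjMatrix ℂ s t *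
      (if t ∈ pairClass M x y i then 1 else 0) = b) :
    ((pairClass M x y i).card : ℂ) * a = (pairClass M x y j).card * b := by
  have h1 : ∑ s ∈ pairClass M x y i, ∑ t ∈ pairClass M x y j,
      (johnsonGraph N M).adjMatrix ℂ s t = (pairClass M x y i).card * a := by
    rw [← nsmul_eq_mul, ← Finset.sum_const]
    refine Finset.sum_congr rfl fun s hs => ?_
    rw [← ha s hs]
    simp
  have h2 : ∑ s ∈ pairClass M x y j, ∑ t ∈ pairClass M x y i,
      (johnsonGraph N M).adjMatrix ℂ s t = (pairClass M x y j).card * b := by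
    rw [← nsmul_eq_mul, ← Finset.sum_const]
    refine Finset.sum_congr rfl fun s hs => ?_
    rw [← hb s hs]
    simp
  rw [← h1, ← h2]
  refine Finset.sum_comm.trans ?_
  refine Finset.sum_congr rfl fun s _ => Finset.sum_congr rfl fun t _ => ?_
  rw [SimpleGraph.adjMatrix_apply, SimpleGraph.adjMatrix_apply]
  simp only [SimpleGraph.adj_comm]

theorem adjMatrix_pairClass {x y : Fin N} (hxy : x ≠ y) (s : Subsets N M) (j : ℕ) (w : ℂ) :
    ∑ t : Subsets N M, (johnsonGraph N M).adjMatrix ℂ s t *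
        (if t ∈ pairClass M x y j then w else 0) =
      ((pairCount x y s.1 : ℂ) * (2 - pairCount x y s.1) +
        (M - pairCount x y s.1) * (N - M - 2 + pairCount x y s.1)) *
          (if pairCount x y s.1 = j then w else 0) +
      (pairCount x y s.1 : ℂ) * (N - M - 2 + pairCount x y s.1) *
          (if pairCount x y s.1 = j + 1 then w else 0) +
      (M - pairCount x y s.1 : ℂ) * (2 - pairCount x y s.1) *
          (if pairCount x y s.1 + 1 = j then w else 0) := by
  have h := adjMatrix_pairCount hxy s fun c => if c = (j : ℤ) then w else 0
  have e1 : ((pairCount x y s.1 : ℤ) - 1 = j) ↔ pairCount x y s.1 = j + 1 := by omega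
  have e2 : ((pairCount x y s.1 : ℤ) + 1 = j) ↔ pairCount x y s.1 + 1 = j := by omega
  simp only [e1, e2, Nat.cast_inj] at h
  simpa only [mem_pairClass] using h

/-- A subset avoiding the pair has 2M neighbours with one element of it (M choices out, 2 in); a
subset with one element has N - M - 1 neighbours avoiding the pair. -/
theorem card_pairClass_zero {x y : Fin N} (hxy : x ≠ y) :
    ((pairClass M x y 0).card : ℝ) * (2 * M) = (pairClass M x y 1).card * (N - M - 1) := by
  have h := card_pairClass_mul (M := M) x y 0 1 (2 * M) (N - M - 1)
    (fun s hs => by rw [adjMatrix_pairClass hxy, mem_pairClass.1 hs]; norm_num; ring)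
    (fun s hs => by rw [adjMatrix_pairClass hxy, mem_pairClass.1 hs]; norm_num; ring)
  exact_mod_cast h

theorem card_pairClass_one {x y : Fin N} (hxy : x ≠ y) :
    ((pairClass M x y 1).card : ℝ) * (M - 1) = (pairClass M x y 2).card * (2 * (N - M)) := by
  have h := card_pairClass_mul (M := M) x y 1 2 (M - 1) (2 * (N - M))
    (fun s hs => by rw [adjMatrix_pairClass hxy, mem_pairClass.1 hs]; norm_num)
    (fun s hs => by rw [adjMatrix_pairClass hxy, mem_pairClass.1 hs]; norm_num)
  exact_mod_cast h

end johnson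

end EDWalk

/-! ### The Johnson Laplacian in class coordinates. -/

namespace EDWalk

/-- The Laplacian of the Johnson graph on the classes with `0`, `1`, `2` elements of a pair. -/
noncomputable def reducedLaplacian (n M : ℝ) : Matrix (Fin 3) (Fin 3) ℝ :=
  !![2 * M, -√(2 * M * (n - M - 1)), 0;
     -√(2 * M * (n - M - 1)), n - 2, -√(2 * (n - M) * (M - 1));
     0, -√(2 * (n - M) * (M - 1)), 2 * (n - M)]

section classes

variable {N M : ℕ}

/-- The uniform superposition of the `M`-subsets containing exactly `j` elements of `{x, y}`. -/
noncomputable def classVec (M : ℕ) (x y : Fin N) (j : ℕ) : Subsets N M → ℂ :=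
  uniformOn (pairClass M x y j)

/-- Here c and d are class sizes and a, b the numbers of edges per vertex in the two directions.
Normalizing the indicator vectors turns both into the symmetric weight √(ab). An empty class (d = 0)
forces a = 0, and one nonnegative factor suffices because `h` then settles the other sign or makes a
vanish; this covers the small N at which a square root has a negative argument. -/
theorem sqrt_weight {a b c d : ℝ} (h : c * a = d * b) (hc : 0 < c) (hd : 0 ≤ d)
    (hab : 0 ≤ a ∨ 0 ≤ b) : a * (1 / √d) = √(a * b) * (1 / √c) := by
  rcases hd.eq_or_lt with rfl | hd
  · have : a = 0 := by
      rcases mul_eq_zero.1 (h.trans (zero_mul b)) with h | h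
      · exact absurd h hc.ne'
      · exact h
    simp [this]
  · have hb : b = c * a / d := by field_simp; linarith
    have ha : 0 ≤ a := by
      rcases hab with h | h
      · exact h
      · have : 0 ≤ c * a := by rw [‹c * a = d * b›]; positivity
        exact (mul_nonneg_iff_of_pos_left hc).1 this
    have e : a * b = a ^ 2 * (c / d) := by rw [hb]; ring
    rw [e, Real.sqrt_mul (sq_nonneg a), Real.sqrt_sq ha, Real.sqrt_div hc.le]
    have := Real.sqrt_pos.2 hc
    have := Real.sqrt_pos.2 hd
    field_simp

theorem uniformOn_apply {ι : Type*} [DecidableEq ι] (A : Finset ι) (v : ι) :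
    uniformOn A v = if v ∈ A then ((1 / √(A.card : ℝ) : ℝ) : ℂ) else 0 := rfl

/-- The row at `s` depends only on the class of `s`, so there are nine scalar identities. The
off-diagonal ones are instances of `sqrt_weight`, whose positivity hypothesis holds since `s` itself
lies in the class. -/
theorem adjMatrix_classVec {x y : Fin N} (hxy : x ≠ y) (s : Subsets N M) (j : Fin 3) :
    ∑ t : Subsets N M, (johnsonGraph N M).adjMatrix ℂ s t * classVec M x y j t =
      (M : ℂ) * (N - M) * classVec M x y j s -
        ∑ i : Fin 3, classVec M x y i s * (reducedLaplacian N M i j : ℂ) := by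
  have hMN : (M : ℝ) ≤ N := by
    have := Finset.card_le_univ s.1
    rw [s.2, Fintype.card_fin] at this
    exact_mod_cast this
  have hpos : ∀ i, pairCount x y s.1 = i → 0 < ((pairClass M x y i).card : ℝ) := fun i h =>
    Nat.cast_pos.2 (Finset.card_pos.2 ⟨s, mem_pairClass.2 h⟩)
  have r01 := card_pairClass_zero (M := M) hxy
  have r12 := card_pairClass_one (M := M) hxy
  have hM0 : (0 : ℝ) ≤ 2 * M := by positivity
  have hNM : (0 : ℝ) ≤ 2 * (N - M) := by linarith
  have hc : pairCount x y s.1 = 0 ∨ pairCount x y s.1 = 1 ∨ pairCount x y s.1 = 2 := by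
    have := pairCount_le_two x y s.1
    omega
  have key := adjMatrix_pairClass hxy s j ((1 / √((pairClass M x y j).card : ℝ) : ℝ) : ℂ)
  simp only [classVec, uniformOn_apply, Fin.sum_univ_three]
  rw [key]
  simp only [mem_pairClass]
  obtain ⟨u, hu⟩ : ∃ u : ℕ → ℝ, ∀ i, 1 / √((pairClass M x y i).card : ℝ) = u i := ⟨_, fun _ => rfl⟩
  simp only [hu]
  have w01 : pairCount x y s.1 = 0 → 2 * M * u 1 = √(2 * M * (N - M - 1)) * u 0 := fun h =>
    by
    simpa only [hu] using sqrt_weight r01 (hpos 0 h) (Nat.cast_nonneg _) (Or.inl hM0)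
  have w10 : pairCount x y s.1 = 1 → (N - M - 1) * u 0 = √(2 * M * (N - M - 1)) * u 1 := fun h => by
    rw [mul_comm (2 * (M : ℝ))]
    simpa only [hu] using sqrt_weight r01.symm (hpos 1 h) (Nat.cast_nonneg _) (Or.inr hM0)
  have w12 : pairCount x y s.1 = 1 → (M - 1) * u 2 = √(2 * (N - M) * (M - 1)) * u 1 := fun h => by
    rw [mul_comm (2 * ((N : ℝ) - M))]
    simpa only [hu] using sqrt_weight r12 (hpos 1 h) (Nat.cast_nonneg _) (Or.inr hNM)
  have w21 : pairCount x y s.1 = 2 → 2 * (N - M) * u 1 = √(2 * (N - M) * (M - 1)) * u 2 :=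
    fun h => by
    simpa only [hu] using sqrt_weight r12.symm (hpos 2 h) (Nat.cast_nonneg _) (Or.inl hNM)
  have v01 := fun h => congrArg (fun r : ℝ => (r : ℂ)) (w01 h)
  have v10 := fun h => congrArg (fun r : ℝ => (r : ℂ)) (w10 h)
  have v12 := fun h => congrArg (fun r : ℝ => (r : ℂ)) (w12 h)
  have v21 := fun h => congrArg (fun r : ℝ => (r : ℂ)) (w21 h)
  push_cast at v01 v10 v12 v21
  rcases hc with h | h | h <;> simp only [h] at v01 v10 v12 v21 ⊢ <;> fin_cases j <;>
    simp [reducedLaplacian] at v01 v10 v12 v21 ⊢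
  · ring
  · linear_combination v01
  · linear_combination v10
  · ring
  · linear_combination v12
  · linear_combination v21
  · ring

end classes

/-! ### Pendant vertices, and the invariance of the four-dimensional space. -/

section walk

variable {N m : ℕ}

theorem marked_iff {f : Fin N → Fin m} {x y : Fin N} (h : UniqueCollision f x y)
    (s : Subsets N (subsetSize N)) : Marked f s ↔ pairCount x y s.1 = 2 := by
  obtain ⟨hxy, hf, hu⟩ := h
  have h2 : pairCount x y s.1 = 2 ↔ x ∈ s.1 ∧ y ∈ s.1 := by
    unfold pairCount
    by_cases hx : x ∈ s.1 <;> by_cases hy : y ∈ s.1 <;>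
      simp [Finset.inter_insert_of_mem, Finset.inter_insert_of_notMem,
        Finset.inter_singleton_of_mem, Finset.inter_singleton_of_notMem, hx, hy,
        Finset.card_pair hxy]
  rw [h2]
  constructor
  · rintro ⟨a, ha, b, hb, hab, hfab⟩
    rcases hu a b hab hfab with ⟨rfl, rfl⟩ | ⟨rfl, rfl⟩
    · exact ⟨ha, hb⟩
    · exact ⟨hb, ha⟩
  · rintro ⟨hx, hy⟩
    exact ⟨x, hx, y, hy, hxy, hf⟩

theorem card_pendantVertices {f : Fin N → Fin m} {x y : Fin N} (h : UniqueCollision f x y) :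
    (pendantVertices f).card = (pairClass (subsetSize N) x y 2).card := by
  have e : pendantVertices f = (Finset.univ : Finset {s : Subsets N (subsetSize N) // Marked f s}).map
      Function.Embedding.inr := by
    ext v
    rcases v with s | b <;> simp [pendantVertices]
  rw [e, Finset.card_map, Finset.card_univ, Fintype.card_subtype]
  congr 1
  ext s
  simp [mem_pairClass, marked_iff h]

theorem classA_eq (f : Fin N → Fin m) (x y : Fin N) (j : ℕ) :
    classA f x y j = (pairClass (subsetSize N) x y j).map Function.Embedding.inl := rfl

theorem mem_classA_inl (f : Fin N → Fin m) (x y : Fin N) (j : ℕ) (s : Subsets N (subsetSize N)) :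
    (Sum.inl s : WalkVertex f) ∈ classA f x y j ↔ s ∈ pairClass (subsetSize N) x y j := by
  rw [classA_eq]
  exact Finset.mem_map' Function.Embedding.inl

theorem reducedBasis_inl_castSucc (f : Fin N → Fin m) (x y : Fin N) (s : Subsets N (subsetSize N))
    (j : Fin 3) : reducedBasis f x y (Sum.inl s) j.castSucc = classVec _ x y j s := by
  have e : ∀ i, uniformOn (classA f x y i) (Sum.inl s) = classVec _ x y i s := fun i => by
    have h : (classA f x y i).card = (pairClass (subsetSize N) x y i).card := Finset.card_map _
    simp only [classVec, uniformOn_apply, mem_classA_inl, h]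
  fin_cases j
  exacts [e 0, e 1, e 2]

theorem reducedBasis_inl_last (f : Fin N → Fin m) (x y : Fin N) (s : Subsets N (subsetSize N)) :
    reducedBasis f x y (Sum.inl s) (Fin.last 3) = 0 := by
  change uniformOn (pendantVertices f) (Sum.inl s) = 0
  rw [uniformOn_apply, if_neg]
  simp [pendantVertices]

theorem reducedBasis_inr_castSucc (f : Fin N → Fin m) (x y : Fin N)
    (b : {s : Subsets N (subsetSize N) // Marked f s}) (j : Fin 3) :
    reducedBasis f x y (Sum.inr b) j.castSucc = 0 := by
  have e : ∀ i, uniformOn (classA f x y i) (Sum.inr b) = 0 := fun i => by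
    rw [uniformOn_apply, if_neg]
    rw [classA_eq, Finset.mem_map]
    rintro ⟨_, _, h⟩
    cases h
  fin_cases j
  exacts [e 0, e 1, e 2]

theorem reducedBasis_inr_last {f : Fin N → Fin m} {x y : Fin N} (h : UniqueCollision f x y)
    (b : {s : Subsets N (subsetSize N) // Marked f s}) :
    reducedBasis f x y (Sum.inr b) (Fin.last 3) = classVec _ x y 2 b.1 := by
  have hb : b.1 ∈ pairClass (subsetSize N) x y 2 := mem_pairClass.2 ((marked_iff h b.1).1 b.2)
  change uniformOn (pendantVertices f) (Sum.inr b) = _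
  rw [classVec, uniformOn_apply, uniformOn_apply, card_pendantVertices h, if_pos, if_pos hb]
  simp [pendantVertices]

theorem reducedHU_eq (N : ℕ) (i j : Fin 3) :
    reducedHU N i.castSucc j.castSucc =
      -(1 / (N : ℝ) ^ (2 / 3 : ℝ)) * reducedLaplacian N (subsetSize N) i j := by
  fin_cases i <;> fin_cases j <;> simp [reducedHU, reducedLaplacian, -Real.sqrt_mul'] <;> ring

theorem sum_johnson_block (s : Subsets N (subsetSize N)) (r : ℂ) (F : Subsets N (subsetSize N) → ℂ) :
    ∑ t, (r • ((johnsonGraph N (subsetSize N)).adjMatrix ℂ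
        - ((subsetSize N : ℂ) * ((N : ℂ) - (subsetSize N : ℂ))) •
          (1 : Matrix (Subsets N (subsetSize N)) (Subsets N (subsetSize N)) ℂ))) s t * F t =
      r * (∑ t, (johnsonGraph N (subsetSize N)).adjMatrix ℂ s t * F t -
        (subsetSize N : ℂ) * ((N : ℂ) - (subsetSize N : ℂ)) * F s) := by
  simp only [Matrix.smul_apply, Matrix.sub_apply, smul_eq_mul, mul_assoc, sub_mul,
    Matrix.one_apply, ← Finset.mul_sum, Finset.sum_sub_distrib, ite_mul, one_mul, zero_mul,
    Finset.sum_ite_eq, Finset.mem_univ, if_true]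

theorem reducedHamiltonian_castSucc (N : ℕ) (i j : Fin 3) :
    reducedHamiltonian N i.castSucc j.castSucc =
      -(((1 / (N : ℝ) ^ (2 / 3 : ℝ) : ℝ)) : ℂ) * (reducedLaplacian N (subsetSize N) i j : ℂ) := by
  have h0 : reducedHC i.castSucc j.castSucc = 0 := by
    fin_cases i <;> fin_cases j <;> rfl
  rw [reducedHamiltonian, Matrix.map_apply, Matrix.add_apply, h0, reducedHU_eq]
  push_cast
  ring

theorem reducedHamiltonian_castSucc_last (N : ℕ) (i : Fin 3) :
    reducedHamiltonian N i.castSucc (Fin.last 3) = if i = 2 then 1 else 0 := by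
  fin_cases i <;> simp [reducedHamiltonian, reducedHU, reducedHC, Fin.last]

theorem reducedHamiltonian_last_castSucc (N : ℕ) (i : Fin 3) :
    reducedHamiltonian N (Fin.last 3) i.castSucc = if i = 2 then 1 else 0 := by
  fin_cases i <;> simp [reducedHamiltonian, reducedHU, reducedHC, Fin.last]

theorem reducedHamiltonian_last_last (N : ℕ) :
    reducedHamiltonian N (Fin.last 3) (Fin.last 3) = 0 := by
  simp [reducedHamiltonian, reducedHU, reducedHC, Fin.last]

/-- At most one pendant vertex sits over `s`, and it exists exactly when `s` contains the colliding
pair; hence the pendant edges carry |B₂⟩ to |A₂⟩ without a change of normalization. -/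
theorem sum_marked {f : Fin N → Fin m} {x y : Fin N}
    (h : UniqueCollision f x y) (s : Subsets N (subsetSize N)) :
    ∑ b : {s : Subsets N (subsetSize N) // Marked f s},
      (if s = b.1 then (1 : ℂ) else 0) * classVec _ x y 2 b.1 = classVec _ x y 2 s := by
  by_cases hs : Marked f s
  · rw [Finset.sum_eq_single ⟨s, hs⟩]
    · simp
    · intro b _ hb
      rw [if_neg, zero_mul]
      rintro rfl
      exact hb rfl
    · simp
  · rw [Finset.sum_eq_zero]
    · rw [classVec, uniformOn_apply, if_neg]
      rwa [mem_pairClass, ← marked_iff h]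
    · intro b _
      rw [if_neg, zero_mul]
      rintro rfl
      exact hs b.2

/-- On Johnson vertices the degree M(N - M) cancels against the diagonal of the adjacency action and
leaves the scaled Laplacian, plus |A₂⟩ in the last column. On pendant vertices only the amplitude of
the subset below is read off. -/
theorem walkHamiltonian_mul_reducedBasis (f : Fin N → Fin m) (x y : Fin N)
    (h : UniqueCollision f x y) :
    walkHamiltonian f * reducedBasis f x y = reducedBasis f x y * reducedHamiltonian N := by
  ext v j
  rw [Matrix.mul_apply, Matrix.mul_apply, Fintype.sum_sum_type, Fin.sum_univ_castSucc]
  rcases v with s | b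
  · simp only [walkHamiltonian, Matrix.fromBlocks_apply₁₁, Matrix.fromBlocks_apply₁₂,
      reducedBasis_inl_castSucc, reducedBasis_inl_last, Matrix.of_apply, sum_johnson_block]
    refine Fin.lastCases ?_ (fun j => ?_) j
    · simp only [reducedBasis_inl_last, reducedBasis_inr_last h, sum_marked h,
        reducedHamiltonian_castSucc_last]
      simp
    · simp only [reducedBasis_inl_castSucc, reducedBasis_inr_castSucc, adjMatrix_classVec h.1,
        reducedHamiltonian_castSucc, mul_zero, Finset.sum_const_zero, add_zero, zero_mul]
      rw [sub_sub_cancel_left, mul_neg, Finset.mul_sum, ← Finset.sum_neg_distrib]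
      refine Finset.sum_congr rfl fun i _ => ?_
      ring
  · simp only [walkHamiltonian, Matrix.fromBlocks_apply₂₁, Matrix.fromBlocks_apply₂₂,
      reducedBasis_inr_castSucc, reducedBasis_inr_last h, Matrix.of_apply, Matrix.zero_apply,
      zero_mul, Finset.sum_const_zero, add_zero, zero_add, ite_mul, one_mul, Finset.sum_ite_eq',
      Finset.mem_univ, if_true]
    refine Fin.lastCases ?_ (fun j => ?_) j
    · rw [reducedBasis_inl_last, reducedHamiltonian_last_last, mul_zero]
    · rw [reducedBasis_inl_castSucc, reducedHamiltonian_last_castSucc]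
      have hb := (marked_iff h b.1).1 b.2
      by_cases hj : j = 2
      · subst hj; simp
      · rw [if_neg hj, mul_zero, classVec, uniformOn_apply, if_neg]
        rw [mem_pairClass, hb]
        intro h2
        exact hj (Fin.ext h2.symm)

end walk

end EDWalk

namespace EDWalk

/-! ### Spectral decomposition of the reduced Laplacian -/

/-- The kernel vector of the reduced Laplacian. -/
noncomputable def flatVec (n M : ℝ) : Fin 3 → ℝ :=
  ![√(n - M) * √(n - M - 1) / √(n * (n - 1)), √2 * √M * √(n - M) / √(n * (n - 1)),
    √M * √(M - 1) / √(n * (n - 1))]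

/-- The eigenvector of the reduced Laplacian for the eigenvalue `2 (n - 1)`. -/
noncomputable def topVec (n M : ℝ) : Fin 3 → ℝ :=
  ![√M * √(M - 1) / √((n - 1) * (n - 2)), -(√2 * √(n - M - 1) * √(M - 1) / √((n - 1) * (n - 2))),
    √(n - M) * √(n - M - 1) / √((n - 1) * (n - 2))]

section spectral

variable {n M : ℝ}

/-- The eigenvalues are 0, n and 2(n - 1). Writing L as n times the projection off the kernel plus n
- 2 times the top projection avoids naming the middle eigenvector. -/
theorem reducedLaplacian_decomp (hM : 1 ≤ M) (hn : M + 1 ≤ n) (h2 : 2 < n) (i j : Fin 3) :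
    reducedLaplacian n M i j =
      n * ((if i = j then 1 else 0) - flatVec n M i * flatVec n M j) +
        (n - 2) * (topVec n M i * topVec n M j) := by
  have hA := Real.sq_sqrt (show 0 ≤ M by linarith)
  have hB := Real.sq_sqrt (show 0 ≤ M - 1 by linarith)
  have hC := Real.sq_sqrt (show 0 ≤ n - M by linarith)
  have hD := Real.sq_sqrt (show 0 ≤ n - M - 1 by linarith)
  have hE := Real.mul_self_sqrt (show 0 ≤ n * (n - 1) by nlinarith)
  have hF := Real.mul_self_sqrt (show 0 ≤ (n - 1) * (n - 2) by nlinarith)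
  have h22 := Real.sq_sqrt (show (0 : ℝ) ≤ 2 by norm_num)
  have hp : √(2 * M * (n - M - 1)) = √2 * √M * √(n - M - 1) := by
    rw [Real.sqrt_mul (by linarith), Real.sqrt_mul (by norm_num)]
  have hq : √(2 * (n - M) * (M - 1)) = √2 * √(n - M) * √(M - 1) := by
    rw [Real.sqrt_mul (by linarith), Real.sqrt_mul (by norm_num)]
  simp only [reducedLaplacian, flatVec, topVec, hp, hq]
  set A := √M
  set B := √(M - 1)
  set C := √(n - M)
  set D := √(n - M - 1)
  set E := √(n * (n - 1))
  set F := √((n - 1) * (n - 2))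
  set r := √2
  -- The squared normalizations n(n - 1) and (n - 1)(n - 2) each cancel one prefactor, so both
  -- rank-one terms share the denominator n - 1.
  have key1 : ∀ a b : ℝ, n * (a / E * (b / E)) = a * b / (n - 1) := fun a b => by
    rw [div_mul_div_comm, hE]
    have : n ≠ 0 := by linarith
    have : n - 1 ≠ 0 := by linarith
    field_simp
  have key2 : ∀ a b : ℝ, (n - 2) * (a / F * (b / F)) = a * b / (n - 1) := fun a b => by
    rw [div_mul_div_comm, hF]
    have : n - 2 ≠ 0 := by linarith
    have : n - 1 ≠ 0 := by linarith
    field_simp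
  have h1 : n - 1 ≠ 0 := by linarith
  fin_cases i <;> fin_cases j <;>
    simp only [mul_sub, mul_neg, neg_mul, ← neg_div, key1, key2, Fin.mk_one, Fin.isValue,
      Matrix.of_apply, Matrix.cons_val', Matrix.cons_val_zero, Matrix.cons_val_one,
      Matrix.cons_val, Fin.zero_eta, Fin.reduceFinMk, if_true, if_false, Fin.reduceEq, mul_one,
      zero_sub, neg_neg] <;> field_simp
  all_goals try simp only [hA, hB, hC, hD, h22]
  all_goals ring

theorem flatVec_dot_self (hM : 1 ≤ M) (hn : M + 1 ≤ n) (h2 : 2 < n) :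
    flatVec n M ⬝ᵥ flatVec n M = 1 := by
  have hE := Real.mul_self_sqrt (show 0 ≤ n * (n - 1) by nlinarith)
  simp only [dotProduct, flatVec, Fin.sum_univ_three, Matrix.cons_val_zero, Matrix.cons_val_one,
    Matrix.cons_val, div_mul_div_comm, hE, ← add_div]
  have : n * (n - 1) ≠ 0 := by nlinarith
  rw [div_eq_one_iff_eq this]
  have hA := Real.sq_sqrt (show 0 ≤ M by linarith)
  have hB := Real.sq_sqrt (show 0 ≤ M - 1 by linarith)
  have hC := Real.sq_sqrt (show 0 ≤ n - M by linarith)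
  have hD := Real.sq_sqrt (show 0 ≤ n - M - 1 by linarith)
  have h22 := Real.sq_sqrt (show (0 : ℝ) ≤ 2 by norm_num)
  generalize √M = A, √(M - 1) = B, √(n - M) = C, √(n - M - 1) = D, √2 = r at *
  calc _ = C ^ 2 * D ^ 2 + r ^ 2 * A ^ 2 * C ^ 2 + A ^ 2 * B ^ 2 := by ring
    _ = _ := by rw [hA, hB, hC, hD, h22]; ring

theorem topVec_dot_self (hM : 1 ≤ M) (hn : M + 1 ≤ n) (h2 : 2 < n) :
    topVec n M ⬝ᵥ topVec n M = 1 := by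
  have hE := Real.mul_self_sqrt (show 0 ≤ (n - 1) * (n - 2) by nlinarith)
  simp only [dotProduct, topVec, Fin.sum_univ_three, Matrix.cons_val_zero, Matrix.cons_val_one,
    Matrix.cons_val, neg_mul_neg, div_mul_div_comm, hE, ← add_div]
  have : (n - 1) * (n - 2) ≠ 0 := by nlinarith
  rw [div_eq_one_iff_eq this]
  have hA := Real.sq_sqrt (show 0 ≤ M by linarith)
  have hB := Real.sq_sqrt (show 0 ≤ M - 1 by linarith)
  have hC := Real.sq_sqrt (show 0 ≤ n - M by linarith)
  have hD := Real.sq_sqrt (show 0 ≤ n - M - 1 by linarith)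
  have h22 := Real.sq_sqrt (show (0 : ℝ) ≤ 2 by norm_num)
  generalize √M = A, √(M - 1) = B, √(n - M) = C, √(n - M - 1) = D, √2 = r at *
  calc _ = A ^ 2 * B ^ 2 + r ^ 2 * D ^ 2 * B ^ 2 + C ^ 2 * D ^ 2 := by ring
    _ = _ := by rw [hA, hB, hC, hD, h22]; ring

theorem flatVec_dot_topVec : flatVec n M ⬝ᵥ topVec n M = 0 := by
  simp only [dotProduct, topVec, flatVec, Fin.sum_univ_three, Matrix.cons_val_zero,
    Matrix.cons_val_one, Matrix.cons_val]
  have h22 := Real.mul_self_sqrt (show (0 : ℝ) ≤ 2 by norm_num)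
  linear_combination -(√M * √(n - M) * √(n - M - 1) * √(M - 1) / √(n * (n - 1)) /
    √((n - 1) * (n - 2))) * h22

theorem reducedLaplacian_mulVec (hM : 1 ≤ M) (hn : M + 1 ≤ n) (h2 : 2 < n) (v : Fin 3 → ℝ) :
    reducedLaplacian n M *ᵥ v =
      n • (v - (flatVec n M ⬝ᵥ v) • flatVec n M) + ((n - 2) * (topVec n M ⬝ᵥ v)) • topVec n M := by
  funext i
  simp only [Matrix.mulVec, dotProduct, reducedLaplacian_decomp hM hn h2, Pi.add_apply,
    Pi.smul_apply, Pi.sub_apply, smul_eq_mul]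
  fin_cases i <;> simp [Fin.sum_univ_three] <;> ring

theorem reducedLaplacian_gap (hM : 1 ≤ M) (hn : M + 1 ≤ n) (h2 : 2 < n) (v : Fin 3 → ℝ)
    (hv : flatVec n M ⬝ᵥ v = 0) :
    n ^ 2 * (v ⬝ᵥ v) ≤ (reducedLaplacian n M *ᵥ v) ⬝ᵥ (reducedLaplacian n M *ᵥ v) := by
  rw [reducedLaplacian_mulVec hM hn h2, hv]
  simp only [zero_smul, sub_zero, add_dotProduct, dotProduct_add, smul_dotProduct, dotProduct_smul,
    smul_eq_mul, topVec_dot_self hM hn h2, dotProduct_comm v (topVec n M)]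
  have : 0 ≤ (topVec n M ⬝ᵥ v) ^ 2 * ((n - 2) * (2 * n + (n - 2))) :=
    mul_nonneg (sq_nonneg _) (mul_nonneg (by linarith) (by linarith))
  nlinarith

/-- The vector is the pseudo-inverse of L applied to the part of e₂ orthogonal to the kernel. The
gap n bounds it by 1/n. It serves both the continuous-time estimate and the query walk. -/
theorem exists_potential (hM : 1 ≤ M) (hn : M + 1 ≤ n) (h2 : 2 < n) :
    ∃ y : Fin 3 → ℝ, flatVec n M ⬝ᵥ y = 0 ∧
      reducedLaplacian n M *ᵥ y = Pi.single 2 1 - flatVec n M 2 • flatVec n M ∧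
      n ^ 2 * (y ⬝ᵥ y) ≤ 1 := by
  have hs := flatVec_dot_self hM hn h2
  have he := topVec_dot_self hM hn h2
  have hse := flatVec_dot_topVec (n := n) (M := M)
  set s := flatVec n M
  set e := topVec n M
  set v : Fin 3 → ℝ := Pi.single 2 1 - s 2 • s with hv
  have hsv : s ⬝ᵥ v = 0 := by
    simp [hv, dotProduct_sub, hs]
  have hn0 : n ≠ 0 := by linarith
  have hn1 : n - 1 ≠ 0 := by linarith
  -- On the complement of the kernel the inverse is 1/n, except along `e`, where it is 1/(2(n - 1));
  -- the coefficient is the difference of these two values.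
  set y := (1 / n) • (v - ((n - 2) / (2 * (n - 1)) * (e ⬝ᵥ v)) • e) with hy
  have hsy : s ⬝ᵥ y = 0 := by
    simp [hy, dotProduct_sub, hsv, hse]
  have hXy : reducedLaplacian n M *ᵥ y = v := by
    rw [reducedLaplacian_mulVec hM hn h2, hsy]
    have hey : e ⬝ᵥ y = 1 / (2 * (n - 1)) * (e ⬝ᵥ v) := by
      simp only [hy, dotProduct_sub, dotProduct_smul, he, smul_eq_mul]
      field_simp
      ring
    rw [hey, hy]
    ext i
    simp only [Pi.add_apply, Pi.smul_apply, Pi.sub_apply, smul_eq_mul]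
    field_simp
    ring
  refine ⟨y, hsy, hXy, ?_⟩
  refine (reducedLaplacian_gap hM hn h2 y hsy).trans ?_
  rw [hXy]
  have : v ⬝ᵥ v = 1 - s 2 ^ 2 := by
    rw [hv]
    simp only [sub_dotProduct, dotProduct_sub, smul_dotProduct, dotProduct_smul, hs, smul_eq_mul,
      single_one_dotProduct, dotProduct_single_one, Pi.sub_apply, Pi.smul_apply, Pi.single_eq_same]
    ring
  rw [this]
  nlinarith [sq_nonneg (s 2)]

end spectral

/-! ### The size of the subsets -/

theorem subsetSize_bounds (N : ℕ) :
    (N : ℝ) ^ (2 / 3 : ℝ) - 1 / 2 ≤ subsetSize N ∧ (subsetSize N : ℝ) ≤ N ^ (2 / 3 : ℝ) + 1 / 2 := by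
  have h0 : (0 : ℝ) ≤ (N : ℝ) ^ (2 / 3 : ℝ) := by positivity
  have h1 : 0 ≤ round ((N : ℝ) ^ (2 / 3 : ℝ)) := by
    rw [round_eq]
    exact Int.floor_nonneg.2 (by linarith)
  have h2 : (subsetSize N : ℝ) = (round ((N : ℝ) ^ (2 / 3 : ℝ)) : ℤ) := by
    unfold subsetSize
    exact_mod_cast Int.toNat_of_nonneg h1
  rw [h2]
  have := abs_le.1 (abs_sub_round ((N : ℝ) ^ (2 / 3 : ℝ)))
  constructor <;> linarith [this.1, this.2]

theorem rpow_two_thirds_cube (N : ℕ) : ((N : ℝ) ^ (2 / 3 : ℝ)) ^ 3 = (N : ℝ) ^ 2 := by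
  rw [← Real.rpow_natCast, ← Real.rpow_mul (by positivity)]
  norm_num

/-- Cubing reduces this to N² < (N - 3/2)³. It fails at N = 4, where M = 3, which explains the
threshold 5. -/
theorem subsetSize_add_two_le {N : ℕ} (hN : 5 ≤ N) : subsetSize N + 2 ≤ N := by
  have h5 : (5 : ℝ) ≤ N := by exact_mod_cast hN
  have h : (N : ℝ) ^ (2 / 3 : ℝ) < N - 3 / 2 := by
    refine lt_of_pow_lt_pow_left₀ 3 (by linarith) ?_
    rw [rpow_two_thirds_cube]
    nlinarith [mul_nonneg (sub_nonneg.2 h5) (sub_nonneg.2 h5), mul_nonneg (mul_nonneg (sub_nonneg.2 h5) (sub_nonneg.2 h5)) (sub_nonneg.2 h5)]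
  have := (subsetSize_bounds N).2
  have h3 : (subsetSize N : ℝ) < (N - 1 : ℕ) := by
    rw [Nat.cast_sub (by omega)]; push_cast; linarith
  have := Nat.cast_lt.1 h3
  omega

theorem two_le_subsetSize {N : ℕ} (hN : 5 ≤ N) : 2 ≤ subsetSize N := by
  have h5 : (5 : ℝ) ≤ N := by exact_mod_cast hN
  have h : (2 : ℝ) ≤ (N : ℝ) ^ (2 / 3 : ℝ) := by
    refine le_of_pow_le_pow_left₀ (n := 3) (by norm_num) (by positivity) ?_
    rw [rpow_two_thirds_cube]
    nlinarith
  have := (subsetSize_bounds N).1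
  have h3 : ((1 : ℕ) : ℝ) < subsetSize N := by push_cast; linarith
  exact Nat.cast_lt.1 h3

theorem subsetSize_le (N : ℕ) : subsetSize N ≤ N := by
  rcases Nat.lt_or_ge N 5 with h | h
  · rcases Nat.eq_zero_or_pos N with rfl | h0
    · simp [subsetSize]
    have hb := (subsetSize_bounds N).2
    have h1 : (1 : ℝ) ≤ N := by exact_mod_cast h0
    have : (N : ℝ) ^ (2 / 3 : ℝ) ≤ N := by
      refine le_of_pow_le_pow_left₀ (n := 3) (by norm_num) (by positivity) ?_
      rw [rpow_two_thirds_cube]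
      nlinarith [sq_nonneg (N : ℝ)]
    have h3 : (subsetSize N : ℝ) < (N + 1 : ℕ) := by push_cast; linarith
    have := Nat.cast_lt.1 h3
    omega
  · have := subsetSize_add_two_le h
    omega

end EDWalk

namespace EDWalk

/-! ### Norms of nonnegative symmetric matrices -/

section nonneg

variable {ι : Type*} [Fintype ι] [DecidableEq ι] {B : Matrix ι ι ℝ}

/-- The Schur test: Cauchy–Schwarz in each row with weights B i j d j, then a second use of the row
bound for the columns, by symmetry. -/
theorem norm_le_of_mulVec_le (hB : ∀ i j, 0 ≤ B i j) (hs : ∀ i j, B i j = B j i) {d : ι → ℝ}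
    (hd : ∀ i, 0 < d i) {r : ℝ} (hr : 0 ≤ r) (h : ∀ i, (B *ᵥ d) i ≤ r * d i) :
    ‖Matrix.toEuclideanCLM (n := ι) (𝕜 := ℝ) B‖ ≤ r := by
  refine ContinuousLinearMap.opNorm_le_bound _ hr fun v => ?_
  refine le_of_sq_le_sq ?_ (by positivity)
  rw [mul_pow, EuclideanSpace.real_norm_sq_eq, EuclideanSpace.real_norm_sq_eq]
  simp only [Matrix.ofLp_toEuclideanCLM]
  have h1 : ∀ i, (B *ᵥ v.ofLp) i ^ 2 ≤ (B *ᵥ d) i * ∑ j, B i j * (v.ofLp j ^ 2 / d j) := by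
    intro i
    refine Finset.sum_sq_le_sum_mul_sum_of_sq_le_mul _ (fun j _ => mul_nonneg (hB i j) (hd j).le)
      (fun j _ => mul_nonneg (hB i j) (div_nonneg (sq_nonneg _) (hd j).le)) fun j _ => le_of_eq ?_
    have := (hd j).ne'
    field_simp
  calc ∑ i, (B *ᵥ v.ofLp) i ^ 2
      ≤ ∑ i, r * d i * ∑ j, B i j * (v.ofLp j ^ 2 / d j) := by
        refine Finset.sum_le_sum fun i _ => (h1 i).trans ?_
        refine mul_le_mul_of_nonneg_right (h i) (Finset.sum_nonneg fun j _ =>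
          mul_nonneg (hB i j) (div_nonneg (sq_nonneg _) (hd j).le))
    _ = ∑ j, r * (v.ofLp j ^ 2 / d j) * (B *ᵥ d) j := by
        simp only [Matrix.mulVec, dotProduct, Finset.mul_sum]
        rw [Finset.sum_comm]
        refine Finset.sum_congr rfl fun j _ => Finset.sum_congr rfl fun i _ => ?_
        rw [hs j i]
        ring
    _ ≤ ∑ j, r * (v.ofLp j ^ 2 / d j) * (r * d j) := by
        refine Finset.sum_le_sum fun j _ => mul_le_mul_of_nonneg_left (h j) ?_
        exact mul_nonneg hr (div_nonneg (sq_nonneg _) (hd j).le)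
    _ = r ^ 2 * ∑ j, v.ofLp j ^ 2 := by
        rw [Finset.mul_sum]
        refine Finset.sum_congr rfl fun j _ => ?_
        have := (hd j).ne'
        field_simp

theorem le_norm_of_le_dotProduct {d : ι → ℝ} {r : ℝ} (hd : d ⬝ᵥ d = 1)
    (h : r ≤ d ⬝ᵥ (B *ᵥ d)) : r ≤ ‖Matrix.toEuclideanCLM (n := ι) (𝕜 := ℝ) B‖ := by
  have hn : ‖WithLp.toLp 2 d‖ = 1 := by
    rw [← sq_eq_sq₀ (norm_nonneg _) zero_le_one, EuclideanSpace.real_norm_sq_eq, one_pow, ← hd]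
    simp [dotProduct, sq]
  have h2 := Matrix.inner_toEuclideanCLM B (WithLp.toLp 2 d) (WithLp.toLp 2 d)
  have h3 := real_inner_le_norm (WithLp.toLp 2 d) (Matrix.toEuclideanCLM (n := ι) (𝕜 := ℝ) B (WithLp.toLp 2 d))
  have h4 := ContinuousLinearMap.le_opNorm (Matrix.toEuclideanCLM (n := ι) (𝕜 := ℝ) B) (WithLp.toLp 2 d)
  rw [h2, hn, one_mul] at h3
  rw [hn, mul_one] at h4
  exact h.trans (h3.trans h4)

theorem mulVec_dot_self_le (v : ι → ℝ) :
    (B *ᵥ v) ⬝ᵥ (B *ᵥ v) ≤ ‖Matrix.toEuclideanCLM (n := ι) (𝕜 := ℝ) B‖ ^ 2 * (v ⬝ᵥ v) := by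
  have h4 := ContinuousLinearMap.le_opNorm (Matrix.toEuclideanCLM (n := ι) (𝕜 := ℝ) B) (WithLp.toLp 2 v)
  have h5 := pow_le_pow_left₀ (norm_nonneg _) h4 2
  rw [mul_pow, EuclideanSpace.real_norm_sq_eq, EuclideanSpace.real_norm_sq_eq] at h5
  simpa [dotProduct, sq] using h5

/-- Perron–Frobenius without the spectral theorem: the norm is attained on the compact unit sphere,
and entrywise absolute values preserve a maximizer. -/
theorem exists_nonneg_eigenvector [Nonempty ι] (hB : ∀ i j, 0 ≤ B i j) (hs : ∀ i j, B i j = B j i)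
    (h0 : 0 < ‖Matrix.toEuclideanCLM (n := ι) (𝕜 := ℝ) B‖) :
    ∃ w : ι → ℝ, (∀ i, 0 ≤ w i) ∧ w ≠ 0 ∧
      B *ᵥ w = ‖Matrix.toEuclideanCLM (n := ι) (𝕜 := ℝ) B‖ • w := by
  set T := Matrix.toEuclideanCLM (n := ι) (𝕜 := ℝ) B with hT
  set r := ‖T‖ with hr
  obtain ⟨x, hx, hmax⟩ := (isCompact_sphere (0 : EuclideanSpace ℝ ι) 1).exists_isMaxOn
    (NormedSpace.sphere_nonempty.2 zero_le_one) (f := fun x => ‖T x‖)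
    (by fun_prop)
  have hx1 : ‖x‖ = 1 := by simpa using hx
  have hrx : r ≤ ‖T x‖ := by
    refine ContinuousLinearMap.opNorm_le_of_unit_norm (norm_nonneg _) fun y hy => ?_
    exact hmax (by simpa using hy)
  set v : ι → ℝ := fun i => |x.ofLp i| with hv
  have hvv : v ⬝ᵥ v = 1 := by
    have := EuclideanSpace.real_norm_sq_eq x
    rw [hx1] at this
    simp only [dotProduct, hv, abs_mul_abs_self]
    simp only [sq] at this
    linarith
  have hBv : r ^ 2 ≤ (B *ᵥ v) ⬝ᵥ (B *ᵥ v) := by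
    refine (pow_le_pow_left₀ (norm_nonneg _) hrx 2).trans ?_
    rw [EuclideanSpace.real_norm_sq_eq]
    refine Finset.sum_le_sum fun i _ => ?_
    rw [hT, Matrix.ofLp_toEuclideanCLM, ← sq, sq_le_sq]
    refine le_trans ?_ (le_abs_self _)
    simp only [Matrix.mulVec, dotProduct]
    refine (Finset.abs_sum_le_sum_abs _ _).trans (Finset.sum_le_sum fun j _ => ?_)
    rw [abs_mul, abs_of_nonneg (hB i j)]
  have hsym : ∀ a b : ι → ℝ, (B *ᵥ a) ⬝ᵥ b = a ⬝ᵥ (B *ᵥ b) := by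
    intro a b
    have : Bᵀ = B := by ext i j; exact hs j i
    rw [Matrix.dotProduct_mulVec, ← Matrix.mulVec_transpose, this]
  -- Equality case: ‖B²v - r²v‖² = ‖B²v‖² - 2r²‖Bv‖² + r⁴ ≤ 0, because ‖Bv‖ = r and ‖B²v‖ ≤ r².
  have h2 : B *ᵥ (B *ᵥ v) = r ^ 2 • v := by
    rw [← sub_eq_zero, ← dotProduct_self_eq_zero]
    have hle := mulVec_dot_self_le (B := B) (B *ᵥ v)
    have hle2 := mulVec_dot_self_le (B := B) v
    rw [← hT, ← hr] at hle hle2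
    refine le_antisymm ?_ (Finset.sum_nonneg fun i _ => mul_self_nonneg _)
    simp only [sub_dotProduct, dotProduct_sub, smul_dotProduct, dotProduct_smul, hvv, smul_eq_mul]
    have e1 : (B *ᵥ (B *ᵥ v)) ⬝ᵥ v = (B *ᵥ v) ⬝ᵥ (B *ᵥ v) := hsym _ _
    rw [dotProduct_comm v, e1]
    rw [hvv, mul_one] at hle2
    have e2 : (B *ᵥ v) ⬝ᵥ (B *ᵥ v) = r ^ 2 := le_antisymm hle2 hBv
    rw [e2] at hle ⊢
    nlinarith
  -- Since (B - r)(B + r)v = 0, the vector (B + r)v is an eigenvector for +r; it does not vanish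
  -- because v ≥ 0 is nonzero and r > 0.
  refine ⟨B *ᵥ v + r • v, fun i => ?_, fun h => ?_, ?_⟩
  · exact add_nonneg (Finset.sum_nonneg fun j _ => mul_nonneg (hB i j) (abs_nonneg _))
      (mul_nonneg h0.le (abs_nonneg _))
  · have hz : v = 0 := by
      funext i
      have hi := congrFun h i
      have h1 : 0 ≤ (B *ᵥ v) i := Finset.sum_nonneg fun j _ => mul_nonneg (hB i j) (abs_nonneg _)
      have h3 : 0 ≤ r * v i := mul_nonneg h0.le (abs_nonneg _)
      have h4 : (B *ᵥ v) i + r * v i = 0 := hi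
      have : r * v i = 0 := by linarith
      rcases mul_eq_zero.1 this with h | h
      · exact absurd h h0.ne'
      · exact h
    rw [hz] at hvv
    simp at hvv
  · rw [Matrix.mulVec_add, Matrix.mulVec_smul, h2, smul_add, smul_smul, sq, add_comm]

end nonneg

/-! ### The norm of `abs(H)` -/

theorem elemAbs_neg {ι : Type*} (H : Matrix ι ι ℂ) : elemAbs (-H) = elemAbs H := by
  funext i j
  simp [elemAbs]

theorem elemAbs_nonneg {ι : Type*} (H : Matrix ι ι ℂ) (i j : ι) : 0 ≤ elemAbs H i j :=
  norm_nonneg _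

theorem absNorm_neg {ι : Type*} [Fintype ι] [DecidableEq ι] (H : Matrix ι ι ℂ) :
    absNorm (-H) = absNorm H := by
  rw [absNorm, elemAbs_neg, absNorm]

theorem reducedHamiltonian_symm (N : ℕ) (i j : Fin 4) :
    reducedHamiltonian N i j = reducedHamiltonian N j i := by
  fin_cases i <;> fin_cases j <;> simp [reducedHamiltonian, reducedHU, reducedHC]

theorem elemAbs_symm (N : ℕ) (i j : Fin 4) :
    elemAbs (reducedHamiltonian N) i j = elemAbs (reducedHamiltonian N) j i := by
  rw [elemAbs, elemAbs, reducedHamiltonian_symm]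

theorem mulVec_castSucc (B : Matrix (Fin 4) (Fin 4) ℝ) (d : Fin 3 → ℝ) (c : ℝ) (i : Fin 4) :
    (B *ᵥ Fin.snoc (α := fun _ => ℝ) d c) i =
      ∑ j : Fin 3, B i j.castSucc * d j + B i (Fin.last 3) * c := by
  rw [Matrix.mulVec, dotProduct, Fin.sum_univ_castSucc]
  simp only [Fin.snoc_castSucc, Fin.snoc_last]

section norm

variable {N : ℕ}

theorem real_bounds (hN : 5 ≤ N) : (2 : ℝ) ≤ subsetSize N ∧ (subsetSize N : ℝ) + 2 ≤ N ∧
    (5 : ℝ) ≤ N := by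
  refine ⟨?_, ?_, ?_⟩
  · exact_mod_cast two_le_subsetSize hN
  · exact_mod_cast subsetSize_add_two_le hN
  · exact_mod_cast hN

/-- The signs of the entries of `topVec`. -/
def altSign : Fin 3 → ℝ := ![1, -1, 1]

/-- L is tridiagonal with nonnegative diagonal and nonpositive off-diagonal entries, so alternating
signs conjugate it into its absolute value. -/
theorem abs_reducedLaplacian (hN : 5 ≤ N) (i j : Fin 3) :
    |reducedLaplacian N (subsetSize N) i j| =
      altSign i * altSign j * reducedLaplacian N (subsetSize N) i j := by
  obtain ⟨h1, h2, h3⟩ := real_bounds hN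
  fin_cases i <;> fin_cases j <;> simp [reducedLaplacian, altSign, abs_of_nonneg, Real.sqrt_nonneg, -Real.sqrt_mul', -Real.sqrt_mul] <;>
    first | linarith | exact subsetSize_le N

theorem altSign_mul_self (i : Fin 3) : altSign i * altSign i = 1 := by
  fin_cases i <;> simp [altSign]

theorem topVec_sign_pos (hN : 5 ≤ N) (i : Fin 3) :
    0 < altSign i * topVec N (subsetSize N) i := by
  obtain ⟨h1, h2, h3⟩ := real_bounds hN
  have hA := Real.sqrt_pos.2 (show (0 : ℝ) < subsetSize N by linarith)
  have hB := Real.sqrt_pos.2 (show (0 : ℝ) < subsetSize N - 1 by linarith)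
  have hC := Real.sqrt_pos.2 (show (0 : ℝ) < N - subsetSize N by linarith)
  have hD := Real.sqrt_pos.2 (show (0 : ℝ) < N - subsetSize N - 1 by linarith)
  have hF := Real.sqrt_pos.2 (show (0 : ℝ) < ((N : ℝ) - 1) * (N - 2) by nlinarith)
  fin_cases i <;> simp only [altSign, topVec, Fin.zero_eta, Fin.mk_one, Fin.reduceFinMk,
    Matrix.cons_val_zero, Matrix.cons_val_one, Matrix.cons_val, one_mul, neg_mul_neg] <;> positivity

theorem elemAbs_castSucc (hN : 5 ≤ N) (i j : Fin 3) :
    elemAbs (reducedHamiltonian N) i.castSucc j.castSucc =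
      1 / (N : ℝ) ^ (2 / 3 : ℝ) *
        (altSign i * altSign j * reducedLaplacian N (subsetSize N) i j) := by
  rw [elemAbs, reducedHamiltonian_castSucc, norm_mul, norm_neg, Complex.norm_real,
    Complex.norm_real, Real.norm_eq_abs, Real.norm_eq_abs, abs_reducedLaplacian hN, abs_of_nonneg]
  positivity

theorem elemAbs_mulVec_topVec (hN : 5 ≤ N) (i : Fin 3) :
    ∑ j : Fin 3, elemAbs (reducedHamiltonian N) i.castSucc j.castSucc *
        (altSign j * topVec N (subsetSize N) j) =
      2 * ((N : ℝ) - 1) / (N : ℝ) ^ (2 / 3 : ℝ) * (altSign i * topVec N (subsetSize N) i) := by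
  obtain ⟨h1, h2, h3⟩ := real_bounds hN
  have h := congrFun (reducedLaplacian_mulVec (n := N) (M := subsetSize N) (by linarith)
    (by linarith) (by linarith) (topVec N (subsetSize N))) i
  rw [flatVec_dot_topVec, topVec_dot_self (by linarith) (by linarith) (by linarith)] at h
  simp only [Pi.add_apply, Pi.smul_apply, Pi.sub_apply, zero_smul, smul_eq_mul, Pi.zero_apply,
    Matrix.mulVec, dotProduct] at h
  calc _ = 1 / (N : ℝ) ^ (2 / 3 : ℝ) * altSign i *
        ∑ j, reducedLaplacian N (subsetSize N) i j * topVec N (subsetSize N) j := by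
        rw [Finset.mul_sum]
        refine Finset.sum_congr rfl fun j _ => ?_
        rw [elemAbs_castSucc hN]
        linear_combination (1 / (N : ℝ) ^ (2 / 3 : ℝ) * altSign i * topVec N (subsetSize N) j *
          reducedLaplacian N (subsetSize N) i j) * altSign_mul_self j
    _ = _ := by rw [h]; ring

theorem elemAbs_last (N : ℕ) (j : Fin 3) :
    elemAbs (reducedHamiltonian N) (Fin.last 3) j.castSucc = if j = 2 then 1 else 0 := by
  rw [elemAbs, reducedHamiltonian_last_castSucc]
  split_ifs <;> simp

theorem elemAbs_last_last (N : ℕ) :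
    elemAbs (reducedHamiltonian N) (Fin.last 3) (Fin.last 3) = 0 := by
  rw [elemAbs, reducedHamiltonian_last_last, norm_zero]

/-- Let d > 0 be the sign-corrected top eigenvector of the 3 × 3 part, with eigenvalue r. The vector
(d, 0) has Rayleigh quotient r. For the upper bound the Schur test takes (d, d₂/r): the pendant
entry adds d₂/r to row 2, and the last row gives d₂ = r · (d₂/r). -/
theorem absNorm_bounds (hN : 5 ≤ N) :
    2 * ((N : ℝ) - 1) / (N : ℝ) ^ (2 / 3 : ℝ) ≤ absNorm (reducedHamiltonian N) ∧
    absNorm (reducedHamiltonian N) ≤ 2 * ((N : ℝ) - 1) / (N : ℝ) ^ (2 / 3 : ℝ) +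
      1 / (2 * ((N : ℝ) - 1) / (N : ℝ) ^ (2 / 3 : ℝ)) := by
  obtain ⟨h1, h2, h3⟩ := real_bounds hN
  have hpow : 0 < (N : ℝ) ^ (2 / 3 : ℝ) := by positivity
  have hr : 0 < 2 * ((N : ℝ) - 1) / (N : ℝ) ^ (2 / 3 : ℝ) := div_pos (by linarith) hpow
  set r := 2 * ((N : ℝ) - 1) / (N : ℝ) ^ (2 / 3 : ℝ) with hrdef
  set d : Fin 3 → ℝ := fun i => altSign i * topVec N (subsetSize N) i with hd
  have hrow : ∀ i : Fin 3, ∑ j : Fin 3, elemAbs (reducedHamiltonian N) i.castSucc j.castSucc * d j =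
      r * d i := elemAbs_mulVec_topVec hN
  have hpos : ∀ i, 0 < d i := topVec_sign_pos hN
  have hdd : d ⬝ᵥ d = 1 := by
    rw [← topVec_dot_self (n := N) (M := subsetSize N) (by linarith) (by linarith) (by linarith)]
    refine Finset.sum_congr rfl fun i _ => ?_
    rw [hd]
    linear_combination (topVec N (subsetSize N) i * topVec N (subsetSize N) i) * altSign_mul_self i
  constructor
  · refine le_norm_of_le_dotProduct (B := elemAbs (reducedHamiltonian N)) (d := Fin.snoc (α := fun _ => ℝ) d 0) ?_ ?_
    · rw [← hdd, dotProduct, Fin.sum_univ_castSucc]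
      simp only [Fin.snoc_castSucc, Fin.snoc_last, mul_zero, add_zero, dotProduct]
    · rw [dotProduct, Fin.sum_univ_castSucc]
      simp only [mulVec_castSucc, hrow, Fin.snoc_castSucc, Fin.snoc_last, mul_zero, add_zero, zero_mul]
      have : ∑ i, d i * (r * d i) = r * (d ⬝ᵥ d) := by
        rw [dotProduct, Finset.mul_sum]
        exact Finset.sum_congr rfl fun i _ => by ring
      rw [this, hdd, mul_one]
  · refine norm_le_of_mulVec_le (B := elemAbs (reducedHamiltonian N))
      (d := Fin.snoc (α := fun _ => ℝ) d (d 2 / r)) (elemAbs_nonneg _) (elemAbs_symm N) ?_ (by positivity) ?_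
    · refine Fin.lastCases ?_ fun i => ?_
      · rw [Fin.snoc_last]; exact div_pos (hpos 2) hr
      · rw [Fin.snoc_castSucc]; exact hpos i
    · refine Fin.lastCases ?_ fun i => ?_
      · rw [mulVec_castSucc, Fin.snoc_last, elemAbs_last_last]
        simp only [elemAbs_last, ite_mul, one_mul, zero_mul, Finset.sum_ite_eq', Finset.mem_univ,
          if_true, add_zero]
        have := hpos 2
        rw [add_mul, mul_div_cancel₀ _ hr.ne']
        have : 0 ≤ 1 / r * (d 2 / r) := by positivity
        linarith
      · rw [mulVec_castSucc, Fin.snoc_castSucc, hrow, elemAbs_symm, elemAbs_last]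
        have := hpos i
        split_ifs with h
        · subst h
          apply le_of_eq; ring
        · have : 0 ≤ 1 / r * d i := by positivity
          linarith

theorem absNorm_isBigO :
    (fun N : ℕ => absNorm (reducedHamiltonian N) - 2 * (N : ℝ) ^ (1 / 3 : ℝ))
      =O[atTop] fun N : ℕ => (N : ℝ) ^ (-(1 / 3) : ℝ) := by
  refine IsBigO.of_bound 3 ?_
  filter_upwards [eventually_ge_atTop 5] with N hN
  obtain ⟨h1, h2, h3⟩ := real_bounds hN
  obtain ⟨hl, hu⟩ := absNorm_bounds hN
  have h0 : (0 : ℝ) < N := by linarith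
  -- With e = N^{-1/3} all powers become polynomial: 2(N - 1)/N^{2/3} = 2Ne² - 2e², where 2Ne² =
  -- 2N^{1/3}, and Ne³ = 1. The deviation 2e² and the reciprocal term are O(e).
  set e : ℝ := (N : ℝ) ^ (-(1 / 3) : ℝ) with he
  have hepos : 0 < e := by positivity
  have e1 : (N : ℝ) ^ (1 / 3 : ℝ) = N * e ^ 2 := by
    rw [he, ← Real.rpow_natCast, ← Real.rpow_mul h0.le, ← Real.rpow_one_add' h0.le (by norm_num)]
    norm_num
  have e2 : 1 / (N : ℝ) ^ (2 / 3 : ℝ) = e ^ 2 := by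
    rw [he, ← Real.rpow_natCast, ← Real.rpow_mul h0.le, one_div, ← Real.rpow_neg h0.le]
    norm_num
  have e3 : (N : ℝ) * e ^ 3 = 1 := by
    rw [he, ← Real.rpow_natCast, ← Real.rpow_mul h0.le]
    norm_num
    rw [Real.rpow_neg_one]
    field_simp
  have hle1 : e ≤ 1 := by
    by_contra h
    push Not at h
    have : 1 < e ^ 3 := one_lt_pow₀ h (by norm_num)
    nlinarith
  have e4 : 2 * ((N : ℝ) - 1) / (N : ℝ) ^ (2 / 3 : ℝ) = 2 * N * e ^ 2 - 2 * e ^ 2 := by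
    rw [← e2]; ring
  have hinv : 1 / (2 * N * e ^ 2 - 2 * e ^ 2) ≤ e := by
    have hp : 0 < 2 * N * e ^ 2 - 2 * e ^ 2 := by nlinarith [sq_nonneg e, pow_pos hepos 2]
    rw [div_le_iff₀ hp]
    nlinarith [pow_pos hepos 3]
  rw [e4] at hl hu
  rw [e1, Real.norm_eq_abs, Real.norm_eq_abs, abs_of_pos hepos, abs_le]
  constructor <;> nlinarith

/-- The matrix is irreducible: its nonzero off-diagonal entries link 0 – 1 – 2 – 3. A zero of a
nonnegative eigenvector spreads along this path to all coordinates. -/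
theorem exists_isPrincipal (hN : 5 ≤ N) :
    ∃ d : Fin 4 → ℝ, IsPrincipal (-reducedHamiltonian N) d := by
  obtain ⟨h1, h2, h3⟩ := real_bounds hN
  have hpow : 0 < (N : ℝ) ^ (2 / 3 : ℝ) := by positivity
  have hpos : 0 < absNorm (reducedHamiltonian N) :=
    (div_pos (by linarith) hpow).trans_le (absNorm_bounds hN).1
  obtain ⟨w, hw0, hw, hBw⟩ := exists_nonneg_eigenvector (B := elemAbs (reducedHamiltonian N))
    (elemAbs_nonneg _) (elemAbs_symm N) hpos
  have hstep : ∀ i j, 0 < elemAbs (reducedHamiltonian N) i j → w i = 0 → w j = 0 := by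
    intro i j hij hi
    have h := congrFun hBw i
    rw [Pi.smul_apply, hi, smul_zero] at h
    rw [Matrix.mulVec, dotProduct] at h
    have h' := (Finset.sum_eq_zero_iff_of_nonneg
      (fun j _ => mul_nonneg (elemAbs_nonneg _ _ _) (hw0 j))).1 h j (Finset.mem_univ _)
    exact (mul_eq_zero.1 h').resolve_left hij.ne'
  have hp : 0 < √(2 * (subsetSize N : ℝ) * (N - subsetSize N - 1)) :=
    Real.sqrt_pos.2 (mul_pos (by linarith) (by linarith))
  have hq : 0 < √(2 * ((N : ℝ) - subsetSize N) * (subsetSize N - 1)) :=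
    Real.sqrt_pos.2 (mul_pos (by linarith) (by linarith))
  have h01 : 0 < elemAbs (reducedHamiltonian N) 0 1 := by
    refine (elemAbs_castSucc hN 0 1).symm ▸ ?_
    simp only [altSign, reducedLaplacian, Matrix.of_apply, Matrix.cons_val', Matrix.cons_val_zero,
      Matrix.cons_val_one, one_mul, neg_mul_neg]
    positivity
  have h12 : 0 < elemAbs (reducedHamiltonian N) 1 2 := by
    refine (elemAbs_castSucc hN 1 2).symm ▸ ?_
    simp only [altSign, reducedLaplacian, Matrix.of_apply, Matrix.cons_val', Matrix.cons_val,
      Matrix.cons_val_one, one_mul, neg_mul_neg, mul_one]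
    positivity
  have h23 : 0 < elemAbs (reducedHamiltonian N) 2 3 := by
    have := elemAbs_last N 2
    rw [elemAbs_symm] at this
    refine this.symm ▸ ?_
    simp
  have h10 := elemAbs_symm N 0 1 ▸ h01
  have h21 := elemAbs_symm N 1 2 ▸ h12
  have h32 := elemAbs_symm N 2 3 ▸ h23
  have hall : ∀ i, w i = 0 → w = 0 := by
    intro i hi
    have s01 := hstep _ _ h01
    have s12 := hstep _ _ h12
    have s23 := hstep _ _ h23
    have s10 := hstep _ _ h10
    have s21 := hstep _ _ h21
    have s32 := hstep _ _ h32
    funext j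
    fin_cases i <;> fin_cases j <;> simp at hi ⊢ <;> tauto
  refine ⟨w, fun i => (hw0 i).lt_of_ne fun h => hw (hall i h.symm), ?_⟩
  rw [elemAbs_neg, absNorm_neg]
  exact hBw

end norm

end EDWalk

namespace EDWalk

/-! ### Squared norms of vectors -/

section l2

variable {ι κ : Type*} [Fintype ι] [Fintype κ]

/-- The squared Euclidean norm. -/
noncomputable def normSq (v : ι → ℂ) : ℝ := ∑ i, ‖v i‖ ^ 2

theorem normSq_nonneg (v : ι → ℂ) : 0 ≤ normSq v := Finset.sum_nonneg fun _ _ => sq_nonneg _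

theorem star_dotProduct_self (v : ι → ℂ) : star v ⬝ᵥ v = (normSq v : ℂ) := by
  rw [normSq, dotProduct]
  push_cast
  refine Finset.sum_congr rfl fun i _ => ?_
  rw [Pi.star_apply, RCLike.star_def, Complex.conj_mul']

theorem normSq_add_le (v w : ι → ℂ) : normSq (v + w) ≤ 2 * normSq v + 2 * normSq w := by
  rw [normSq, normSq, normSq, Finset.mul_sum, Finset.mul_sum, ← Finset.sum_add_distrib]
  refine Finset.sum_le_sum fun i _ => ?_
  have := norm_add_le (v i) (w i)
  have h2 := pow_le_pow_left₀ (norm_nonneg _) this 2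
  rw [Pi.add_apply]
  nlinarith [sq_nonneg (‖v i‖ - ‖w i‖)]

theorem normSq_smul (c : ℂ) (v : ι → ℂ) : normSq (c • v) = ‖c‖ ^ 2 * normSq v := by
  simp only [normSq, Pi.smul_apply, norm_smul, mul_pow, Finset.mul_sum]

theorem star_mulVec_dotProduct (A : Matrix κ ι ℂ) (v : ι → ℂ) (w : κ → ℂ) :
    star (A *ᵥ v) ⬝ᵥ w = star v ⬝ᵥ (Aᴴ *ᵥ w) := by
  rw [Matrix.star_mulVec, Matrix.dotProduct_mulVec]

theorem normSq_mulVec_of_isometry [DecidableEq ι] {A : Matrix κ ι ℂ} (hA : Aᴴ * A = 1) (v : ι → ℂ) :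
    normSq (A *ᵥ v) = normSq v := by
  have h := star_mulVec_dotProduct A v (A *ᵥ v)
  rw [Matrix.mulVec_mulVec, hA, Matrix.one_mulVec, star_dotProduct_self, star_dotProduct_self] at h
  exact_mod_cast h

end l2

/-! ### Matrix exponentials -/

section exp

variable {ι κ : Type*} [Fintype ι] [Fintype κ] [DecidableEq ι] [DecidableEq κ]

-- `B` may be rectangular. This transports evolutions from the graph to the four-dimensional space,
-- and from the walk space into the space with a phase register.
open scoped Matrix.Norms.Operator in
theorem exp_mul_of_intertwine {A : Matrix κ κ ℂ} {B : Matrix κ ι ℂ} {C : Matrix ι ι ℂ}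
    (h : A * B = B * C) : NormedSpace.exp A * B = B * NormedSpace.exp C := by
  have hpow : ∀ n : ℕ, A ^ n * B = B * C ^ n := by
    intro n
    induction n with
    | zero => simp
    | succ n ih => rw [pow_succ, pow_succ', Matrix.mul_assoc, h, ← Matrix.mul_assoc, ih,
        Matrix.mul_assoc, ← pow_succ, pow_succ']
  have h1 := (NormedSpace.exp_series_hasSum_exp' (𝕂 := ℂ) A).map
    (AddMonoidHom.mk' (fun X : Matrix κ κ ℂ => X * B) fun X Y => Matrix.add_mul X Y B)
    (Continuous.matrix_mul continuous_id continuous_const)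
  have h2 := (NormedSpace.exp_series_hasSum_exp' (𝕂 := ℂ) C).map
    (AddMonoidHom.mk' (fun X : Matrix ι ι ℂ => B * X) fun X Y => Matrix.mul_add B X Y)
    (Continuous.matrix_mul continuous_const continuous_id)
  refine h1.unique ?_
  convert h2 using 1
  · funext n
    simp [hpow]
  · rfl

theorem exp_smul_conjTranspose {X : Matrix ι ι ℂ} (hX : X.IsHermitian) (r : ℝ) :
    (NormedSpace.exp ((-(Complex.I * r)) • X))ᴴ = NormedSpace.exp ((Complex.I * r) • X) := by
  rw [← Matrix.exp_conjTranspose, Matrix.conjTranspose_smul, hX.eq]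
  simp

theorem exp_smul_isometry {X : Matrix ι ι ℂ} (hX : X.IsHermitian) (r : ℝ) :
    (NormedSpace.exp ((-(Complex.I * r)) • X))ᴴ * NormedSpace.exp ((-(Complex.I * r)) • X) = 1 := by
  rw [exp_smul_conjTranspose hX, ← Matrix.exp_add_of_commute, ← add_smul]
  · simp
  · exact (Commute.refl X).smul_left _ |>.smul_right _

theorem one_sub_sq_le_re_exp (x : ℝ) : 1 - x ^ 2 / 2 ≤ (Complex.exp (-(Complex.I * x))).re := by
  have : (Complex.exp (-(Complex.I * x))).re = Real.cos x := by
    rw [show -(Complex.I * x) = ((-x : ℝ) : ℂ) * Complex.I by push_cast; ring,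
      Complex.exp_ofReal_mul_I_re, Real.cos_neg]
  rw [this]
  exact Real.one_sub_sq_div_two_le_cos

/-- Diagonalize and apply cos x ≥ 1 - x²/2 to each eigenvalue. Only the second moment of `X` in the
given state enters, so no bound on ‖X‖ is needed. -/
theorem re_expectation_exp_ge {X : Matrix ι ι ℂ} (hX : X.IsHermitian) (v : ι → ℂ) :
    normSq v - normSq (X *ᵥ v) / 2 ≤ (star v ⬝ᵥ (NormedSpace.exp ((-Complex.I) • X) *ᵥ v)).re := by
  set V : Matrix ι ι ℂ := hX.eigenvectorUnitary.1 with hV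
  have hVV : V * Vᴴ = 1 := Matrix.mem_unitaryGroup_iff.1 hX.eigenvectorUnitary.2
  have hVV' : Vᴴ * V = 1 := Matrix.mem_unitaryGroup_iff'.1 hX.eigenvectorUnitary.2
  set D : Matrix ι ι ℂ := Matrix.diagonal (RCLike.ofReal ∘ hX.eigenvalues) with hD
  have hspec : X = V * D * Vᴴ := hX.spectral_theorem
  have hinv : V⁻¹ = Vᴴ := Matrix.inv_eq_right_inv hVV
  have hexp : NormedSpace.exp ((-Complex.I) • X) =
      V * Matrix.diagonal (fun j => Complex.exp (-(Complex.I * hX.eigenvalues j))) * Vᴴ := by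
    have e1 : (-Complex.I) • X = V * ((-Complex.I) • D) * V⁻¹ := by
      rw [hinv, hspec]
      simp
    rw [e1, Matrix.exp_conj _ _ (IsUnit.of_mul_eq_one _ hVV), hinv]
    congr 2
    rw [hD, ← Matrix.diagonal_smul, Matrix.exp_diagonal]
    congr 1
    funext j
    rw [Pi.coe_exp, Complex.exp_eq_exp_ℂ]
    simp
  set w := Vᴴ *ᵥ v with hw
  have hvw : normSq v = normSq w := by
    rw [hw, normSq_mulVec_of_isometry]
    rw [Matrix.conjTranspose_conjTranspose, hVV]
  have hXv : normSq (X *ᵥ v) = ∑ j, hX.eigenvalues j ^ 2 * ‖w j‖ ^ 2 := by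
    have : X *ᵥ v = V *ᵥ (D *ᵥ w) := by
      rw [hw, Matrix.mulVec_mulVec, Matrix.mulVec_mulVec, ← hspec]
    rw [this, normSq_mulVec_of_isometry hVV', normSq]
    refine Finset.sum_congr rfl fun j _ => ?_
    rw [hD, Matrix.mulVec_diagonal, norm_mul, mul_pow]
    simp
  have hE : star v ⬝ᵥ (NormedSpace.exp ((-Complex.I) • X) *ᵥ v) =
      ∑ j, Complex.exp (-(Complex.I * hX.eigenvalues j)) * (‖w j‖ ^ 2 : ℝ) := by
    rw [hexp, ← Matrix.mulVec_mulVec, ← Matrix.mulVec_mulVec, ← hw]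
    have := star_mulVec_dotProduct Vᴴ v (Matrix.diagonal (fun j => Complex.exp (-(Complex.I * hX.eigenvalues j))) *ᵥ w)
    rw [Matrix.conjTranspose_conjTranspose] at this
    rw [← this, ← hw, dotProduct]
    refine Finset.sum_congr rfl fun j _ => ?_
    rw [Matrix.mulVec_diagonal, Pi.star_apply, mul_left_comm, RCLike.star_def, Complex.conj_mul']
    push_cast
    rfl
  rw [hE, hvw, hXv, normSq, Complex.re_sum, Finset.sum_div, ← Finset.sum_sub_distrib]
  refine Finset.sum_le_sum fun j _ => ?_
  rw [Complex.re_mul_ofReal]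
  have := one_sub_sq_le_re_exp (hX.eigenvalues j)
  nlinarith [sq_nonneg ‖w j‖]

end exp

/-! ### The Fourier matrix and the sine window -/

theorem sum_exp_eq_zero {K : ℕ} (d : ℤ) (hd : ¬ (K : ℤ) ∣ d) :
    ∑ j ∈ Finset.range K, Complex.exp (2 * Real.pi * Complex.I * (d / K)) ^ j = 0 := by
  rcases Nat.eq_zero_or_pos K with rfl | h
  · simp
  have hK : (K : ℂ) ≠ 0 := by exact_mod_cast h.ne'
  have hne : Complex.exp (2 * Real.pi * Complex.I * (d / K)) ≠ 1 := by
    intro h1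
    obtain ⟨n, hn⟩ := Complex.exp_eq_one_iff.1 h1
    rw [mul_comm (n : ℂ)] at hn
    have h2 := mul_left_cancel₀ Complex.two_pi_I_ne_zero hn
    rw [div_eq_iff hK] at h2
    exact hd ⟨n, by rw [mul_comm]; exact_mod_cast h2⟩
  have hpow : Complex.exp (2 * Real.pi * Complex.I * (d / K)) ^ K = 1 := by
    rw [← Complex.exp_nat_mul, Complex.exp_eq_one_iff]
    exact ⟨d, by field_simp⟩
  have := mul_geom_sum (Complex.exp (2 * Real.pi * Complex.I * (d / K))) K
  rw [hpow, sub_self] at this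
  exact (mul_eq_zero.1 this).resolve_left (sub_ne_zero.2 hne)

/-- The discrete Fourier transform. -/
noncomputable def fourier (K : ℕ) : Matrix (Fin K) (Fin K) ℂ :=
  Matrix.of fun j x => ((1 / √(K : ℝ) : ℝ) : ℂ) *
    Complex.exp (-(2 * Real.pi * ((x : ℕ) : ℝ) * ((j : ℕ) : ℝ) / (K : ℝ)) * Complex.I)

theorem fourier_isometry (K : ℕ) : (fourier K)ᴴ * fourier K = 1 := by
  ext x y
  have hK : 0 < K := x.pos
  have hK' : (K : ℂ) ≠ 0 := by exact_mod_cast hK.ne'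
  have hsq : ((1 / √(K : ℝ) : ℝ) : ℂ) * ((1 / √(K : ℝ) : ℝ) : ℂ) = 1 / K := by
    rw [← Complex.ofReal_mul, div_mul_div_comm, Real.mul_self_sqrt (Nat.cast_nonneg _)]
    push_cast
    ring
  have hterm : ∀ j : Fin K, star (fourier K j x) * fourier K j y =
      1 / K * Complex.exp (2 * Real.pi * Complex.I * (((x : ℤ) - (y : ℤ) : ℤ) / K)) ^ (j : ℕ) := by
    intro j
    rw [fourier, Matrix.of_apply, Matrix.of_apply, RCLike.star_def, map_mul, Complex.conj_ofReal,
      ← Complex.exp_conj, mul_mul_mul_comm, hsq, ← Complex.exp_add, ← Complex.exp_nat_mul]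
    congr 2
    simp only [map_mul, map_neg, map_div₀, Complex.conj_ofReal, Complex.conj_I, map_ofNat]
    push_cast
    field_simp
    ring
  rw [Matrix.mul_apply]
  simp only [Matrix.conjTranspose_apply, hterm]
  rw [← Finset.mul_sum, Fin.sum_univ_eq_sum_range
    (fun j => Complex.exp (2 * Real.pi * Complex.I * (((x : ℤ) - (y : ℤ) : ℤ) / K)) ^ j)]
  by_cases hxy : x = y
  · subst hxy
    simp [hK']
  · rw [sum_exp_eq_zero, mul_zero, Matrix.one_apply_ne hxy]
    intro hdvd
    have h1 := x.2
    have h2 := y.2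
    have h3 : (x : ℕ) ≠ y := fun h => hxy (Fin.ext h)
    have := Int.eq_zero_of_abs_lt_dvd hdvd (by rw [abs_lt]; omega)
    omega

/-- The sine window. -/
noncomputable def window (K x : ℕ) : ℝ :=
  √(2 / ((K : ℝ) + 1)) * Real.sin (Real.pi * ((x : ℝ) + 1) / ((K : ℝ) + 1))

theorem window_top (K : ℕ) : window K K = 0 := by
  have : ((K : ℝ) + 1) ≠ 0 := by positivity
  rw [window, mul_div_assoc, div_self this, mul_one, Real.sin_pi, mul_zero]

/-- By sin² = (1 - cos)/2 this is the vanishing of the sum of the (K + 1)-th roots of unity; the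
term missing at 0 contributes the 1. -/
theorem sum_window_sq {K : ℕ} (hK : 1 ≤ K) : ∑ x : Fin K, window K x ^ 2 = 1 := by
  have h0 : ((K : ℝ) + 1) ≠ 0 := by positivity
  have h1 : ∑ j ∈ Finset.range (K + 1),
      Real.cos (2 * Real.pi * (j : ℝ) / (K + 1)) = 0 := by
    have h := congrArg Complex.re (sum_exp_eq_zero (K := K + 1) 1 (by
      intro h
      have := Int.le_of_dvd one_pos h
      push_cast at this
      omega))
    rw [Complex.re_sum, Complex.zero_re] at h
    rw [← h]
    refine Finset.sum_congr rfl fun j _ => ?_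
    rw [← Complex.exp_nat_mul, ← Complex.exp_ofReal_mul_I_re]
    congr 2
    push_cast
    field_simp
  rw [Finset.sum_range_succ'] at h1
  simp only [Nat.cast_zero, mul_zero, zero_div, Real.cos_zero] at h1
  have h2 : ∀ x : ℕ, window K x ^ 2 =
      1 / ((K : ℝ) + 1) * (1 - Real.cos (2 * Real.pi * ((x + 1 : ℕ) : ℝ) / (K + 1))) := by
    intro x
    rw [window, mul_pow, Real.sq_sqrt (by positivity), Real.sin_sq_eq_half_sub]
    have : 2 * (Real.pi * ((x : ℝ) + 1) / ((K : ℝ) + 1)) =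
      2 * Real.pi * ((x + 1 : ℕ) : ℝ) / (K + 1) := by push_cast; ring
    rw [this]
    field_simp
  rw [Fin.sum_univ_eq_sum_range (fun x => window K x ^ 2)]
  simp only [h2]
  rw [← Finset.mul_sum, Finset.sum_sub_distrib, Finset.sum_const, Finset.card_range]
  have h3 : ∑ j ∈ Finset.range K, Real.cos (2 * Real.pi * ((j + 1 : ℕ) : ℝ) / (K + 1)) = -1 := by
    linarith
  rw [h3]
  simp only [nsmul_eq_mul, mul_one, sub_neg_eq_add]
  field_simp

theorem window_sub_sq_le (K x : ℕ) :
    (window K (x + 1) - window K x) ^ 2 ≤ 2 / ((K : ℝ) + 1) * (Real.pi / ((K : ℝ) + 1)) ^ 2 := by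
  rw [window, window, ← mul_sub, mul_pow, Real.sq_sqrt (by positivity)]
  refine mul_le_mul_of_nonneg_left ?_ (by positivity)
  rw [sq_le_sq]
  refine (Real.abs_sin_sub_sin_le _ _).trans (le_of_eq ?_)
  congr 1
  push_cast
  ring

theorem window_zero_sq_le (K : ℕ) :
    window K 0 ^ 2 ≤ 2 / ((K : ℝ) + 1) * (Real.pi / ((K : ℝ) + 1)) ^ 2 := by
  rw [window, mul_pow, Real.sq_sqrt (by positivity)]
  refine mul_le_mul_of_nonneg_left ?_ (by positivity)
  rw [sq_le_sq]
  refine Real.abs_sin_le_abs.trans (le_of_eq ?_)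
  congr 1
  push_cast
  ring

end EDWalk

/-! ### Coherent phase estimation with the sine window, and its error as a simulation. -/

namespace EDWalk

open scoped Kronecker

section estimation

variable {κ : Type*} [Fintype κ] [DecidableEq κ]

/-- The superposition of the powers of `U` weighted by the sine window. -/
noncomputable def windowedPowers (U : Matrix κ κ ℂ) (K : ℕ) : Matrix (κ × Fin K) κ ℂ :=
  Matrix.of fun p q => (window K p.2 : ℂ) * (U ^ (p.2 : ℕ)) p.1 q

theorem one_kronecker_mul_apply {ι : Type*} {K : ℕ} (F : Matrix (Fin K) (Fin K) ℂ)
    (Q : Matrix (κ × Fin K) ι ℂ) (p : κ × Fin K) (q : ι) :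
    (((1 : Matrix κ κ ℂ) ⊗ₖ F) * Q) p q = ∑ x, F p.2 x * Q (p.1, x) q := by
  rw [Matrix.mul_apply, Fintype.sum_prod_type, Finset.sum_eq_single p.1]
  · simp [Matrix.kroneckerMap_apply]
  · intro b _ hb
    simp [Matrix.kroneckerMap_apply, Matrix.one_apply_ne hb.symm]
  · simp

theorem kronecker_one_mul_apply {κ ι : Type*} [Fintype κ] {K : ℕ} (A : Matrix κ κ ℂ)
    (Q : Matrix (κ × Fin K) ι ℂ) (p : κ × Fin K) (q : ι) :
    ((A ⊗ₖ (1 : Matrix (Fin K) (Fin K) ℂ)) * Q) p q = ∑ k, A p.1 k * Q (k, p.2) q := by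
  rw [Matrix.mul_apply, Fintype.sum_prod_type]
  refine Finset.sum_congr rfl fun k _ => ?_
  rw [Finset.sum_eq_single p.2]
  · simp [Matrix.kroneckerMap_apply]
  · intro b _ hb
    simp [Matrix.kroneckerMap_apply, Matrix.one_apply_ne hb.symm]
  · simp

theorem phaseEstimation_eq (U : Matrix κ κ ℂ) (K : ℕ) :
    phaseEstimation U K = ((1 : Matrix κ κ ℂ) ⊗ₖ fourier K) * windowedPowers U K := by
  ext p q
  rw [one_kronecker_mul_apply, phaseEstimation, Matrix.of_apply]
  refine Finset.sum_congr rfl fun x _ => ?_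
  simp only [fourier, windowedPowers, window, Matrix.of_apply]
  push_cast
  ring

theorem one_kronecker_isometry {K : ℕ} {F : Matrix (Fin K) (Fin K) ℂ} (hF : Fᴴ * F = 1) :
    ((1 : Matrix κ κ ℂ) ⊗ₖ F)ᴴ * ((1 : Matrix κ κ ℂ) ⊗ₖ F) = 1 := by
  rw [Matrix.conjTranspose_kronecker, ← Matrix.mul_kronecker_mul, hF, Matrix.conjTranspose_one,
    Matrix.one_mul, Matrix.one_kronecker_one]

theorem pow_isometry {U : Matrix κ κ ℂ} (hU : Uᴴ * U = 1) (n : ℕ) : (U ^ n)ᴴ * U ^ n = 1 := by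
  induction n with
  | zero => simp
  | succ n ih =>
    rw [pow_succ, Matrix.conjTranspose_mul, Matrix.mul_assoc, ← Matrix.mul_assoc _ _ U, ih,
      Matrix.one_mul, hU]

theorem windowedPowers_isometry {U : Matrix κ κ ℂ} (hU : Uᴴ * U = 1) {K : ℕ} (hK : 1 ≤ K) :
    (windowedPowers U K)ᴴ * windowedPowers U K = 1 := by
  ext q q'
  rw [Matrix.mul_apply, Fintype.sum_prod_type, Finset.sum_comm]
  have h : ∀ x : Fin K, ∑ k, (windowedPowers U K)ᴴ q (k, x) * windowedPowers U K (k, x) q' =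
      ((window K x ^ 2 : ℝ) : ℂ) * (1 : Matrix κ κ ℂ) q q' := by
    intro x
    rw [← pow_isometry hU x, Matrix.mul_apply, Finset.mul_sum]
    refine Finset.sum_congr rfl fun k _ => ?_
    simp only [Matrix.conjTranspose_apply, windowedPowers, Matrix.of_apply, star_mul',
      RCLike.star_def, Complex.conj_ofReal]
    push_cast
    ring
  rw [Finset.sum_congr rfl fun x _ => h x, ← Finset.sum_mul, ← Complex.ofReal_sum,
    sum_window_sq hK]
  simp

theorem phaseEstimation_isometry {U : Matrix κ κ ℂ} (hU : Uᴴ * U = 1) {K : ℕ} (hK : 1 ≤ K) :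
    (phaseEstimation U K)ᴴ * phaseEstimation U K = 1 := by
  rw [phaseEstimation_eq, Matrix.conjTranspose_mul, Matrix.mul_assoc, ← Matrix.mul_assoc _ _ (windowedPowers U K),
    one_kronecker_isometry (fourier_isometry K), Matrix.one_mul, windowedPowers_isometry hU hK]

theorem kronecker_mul_phaseEstimation {A U : Matrix κ κ ℂ} (h : Commute A U) (K : ℕ) :
    (A ⊗ₖ (1 : Matrix (Fin K) (Fin K) ℂ)) * phaseEstimation U K = phaseEstimation U K * A := by
  ext p q
  rw [kronecker_one_mul_apply, Matrix.mul_apply]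
  simp only [phaseEstimation, Matrix.of_apply, Finset.mul_sum, Finset.sum_mul]
  rw [Finset.sum_comm]
  conv_rhs => rw [Finset.sum_comm]
  refine Finset.sum_congr rfl fun x _ => ?_
  have hx := congrFun (congrFun (h.pow_right x).eq p.1) q
  rw [Matrix.mul_apply, Matrix.mul_apply] at hx
  simp only [mul_left_comm (A _ _), mul_assoc, ← Finset.mul_sum]
  rw [hx]

/-- The phases of the outcomes. -/
noncomputable def phaseDiag (K : ℕ) : Matrix (Fin K) (Fin K) ℂ :=
  Matrix.diagonal fun j => Complex.exp ((2 * Real.pi * ((j : ℕ) : ℝ) / (K : ℝ) : ℝ) * Complex.I)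

/-- The sines of the phases of the outcomes. -/
noncomputable def sinDiag (K : ℕ) : Matrix (Fin K) (Fin K) ℂ :=
  Matrix.diagonal fun j => (Real.sin (2 * Real.pi * ((j : ℕ) : ℝ) / (K : ℝ)) : ℂ)

/-- The differences of consecutive weighted powers. -/
noncomputable def windowDiff (U : Matrix κ κ ℂ) (K : ℕ) : Matrix (κ × Fin K) κ ℂ :=
  Matrix.of fun p q => ((window K (p.2 + 1) - window K p.2 : ℝ) : ℂ) * (U ^ (p.2 + 1 : ℕ)) p.1 q

/-- The boundary term of the weighted powers. -/
noncomputable def windowBoundary (κ : Type*) [DecidableEq κ] (K : ℕ) : Matrix (κ × Fin K) κ ℂ :=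
  Matrix.of fun p q => if (p.2 : ℕ) + 1 = K then (window K 0 : ℂ) * (1 : Matrix κ κ ℂ) p.1 q else 0

/-- Multiplication by the outcome phase shifts the Fourier index by one, and multiplication by `U`
raises the power by one. The two therefore differ only by differences of neighbouring window values,
and by one boundary term from the cyclic wrap-around. -/
theorem shift_phaseEstimation (U : Matrix κ κ ℂ) {K : ℕ} :
    ((1 : Matrix κ κ ℂ) ⊗ₖ phaseDiag K) * phaseEstimation U K -
        (U ⊗ₖ (1 : Matrix (Fin K) (Fin K) ℂ)) * phaseEstimation U K =
      ((1 : Matrix κ κ ℂ) ⊗ₖ fourier K) * (windowDiff U K + windowBoundary κ K) := by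
  rw [kronecker_mul_phaseEstimation (Commute.refl U)]
  rcases K with _ | n
  · ext p q
    exact p.2.elim0
  ext ⟨k, j⟩ q
  have hn : ((n + 1 : ℕ) : ℂ) ≠ 0 := by exact_mod_cast n.succ_ne_zero
  set G : ℕ → ℂ := fun x => ((1 / √((n + 1 : ℕ) : ℝ) : ℝ) : ℂ) *
    Complex.exp (-(2 * Real.pi * (x : ℝ) * ((j : ℕ) : ℝ) / ((n + 1 : ℕ) : ℝ)) * Complex.I) with hG
  set e := Complex.exp ((2 * Real.pi * ((j : ℕ) : ℝ) / ((n + 1 : ℕ) : ℝ) : ℝ) * Complex.I) with he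
  have hGs : ∀ x, e * G (x + 1) = G x := by
    intro x
    rw [hG, he, mul_left_comm, ← Complex.exp_add]
    congr 2
    push_cast
    field_simp
    ring
  -- Cyclicity modulo K = n + 1: the index -1 is the last index. This is the source of the boundary
  -- term, which carries U⁰ = 1.
  have hG0 : e * G 0 = G n := by
    rw [hG, he, mul_left_comm, ← Complex.exp_add]
    congr 1
    rw [Complex.exp_eq_exp_iff_exists_int]
    refine ⟨j, ?_⟩
    push_cast
    push_cast at hn
    field_simp
    ring
  have hP : ∀ q', phaseEstimation U (n + 1) (k, j) q' =
      ∑ x ∈ Finset.range (n + 1), G x * (window (n + 1) x * (U ^ x) k q') := by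
    intro q'
    rw [phaseEstimation_eq, one_kronecker_mul_apply,
      ← Fin.sum_univ_eq_sum_range (fun x => G x * (window (n + 1) x * (U ^ x) k q'))]
    rfl
  have hPU : (phaseEstimation U (n + 1) * U) (k, j) q =
      ∑ x ∈ Finset.range (n + 1), G x * (window (n + 1) x * (U ^ (x + 1)) k q) := by
    rw [Matrix.mul_apply]
    simp only [hP, Finset.sum_mul]
    rw [Finset.sum_comm]
    refine Finset.sum_congr rfl fun x _ => ?_
    rw [pow_succ, Matrix.mul_apply, Finset.mul_sum, Finset.mul_sum]
    refine Finset.sum_congr rfl fun k' _ => ?_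
    ring
  have hEP : (((1 : Matrix κ κ ℂ) ⊗ₖ phaseDiag (n + 1)) * phaseEstimation U (n + 1)) (k, j) q =
      e * ∑ x ∈ Finset.range (n + 1), G x * (window (n + 1) x * (U ^ x) k q) := by
    rw [one_kronecker_mul_apply, ← hP, Finset.sum_eq_single j]
    · simp [phaseDiag, he]
    · intro b _ hb
      simp [phaseDiag, Matrix.diagonal_apply_ne _ hb.symm]
    · simp
  have hR : (((1 : Matrix κ κ ℂ) ⊗ₖ fourier (n + 1)) *
      (windowDiff U (n + 1) + windowBoundary κ (n + 1))) (k, j) q =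
      ∑ y ∈ Finset.range (n + 1), G y * (((window (n + 1) (y + 1) - window (n + 1) y : ℝ) : ℂ) *
        (U ^ (y + 1)) k q) + G n * (window (n + 1) 0 * (1 : Matrix κ κ ℂ) k q) := by
    rw [one_kronecker_mul_apply]
    simp only [Matrix.add_apply, mul_add, Finset.sum_add_distrib]
    congr 1
    · rw [← Fin.sum_univ_eq_sum_range (fun y => G y *
        (((window (n + 1) (y + 1) - window (n + 1) y : ℝ) : ℂ) * (U ^ (y + 1)) k q))]
      rfl
    · rw [Finset.sum_eq_single (Fin.last n)]
      · simp [windowBoundary, fourier, hG]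
      · intro b _ hb
        have : (b : ℕ) ≠ n := fun h => hb (Fin.ext h)
        simp [windowBoundary, this]
      · simp
  rw [Matrix.sub_apply, hEP, hPU, hR, Finset.sum_range_succ', mul_add, Finset.mul_sum]
  have h1 : ∀ x, e * (G (x + 1) * (window (n + 1) (x + 1) * (U ^ (x + 1)) k q)) =
      G x * (window (n + 1) (x + 1) * (U ^ (x + 1)) k q) := fun x => by
    rw [← mul_assoc, hGs]
  simp only [h1]
  -- The window vanishes at K, so the sum may be extended by one term and matched with the other
  -- one.
  have h2 : ∑ x ∈ Finset.range (n + 1), G x * (window (n + 1) (x + 1) * (U ^ (x + 1)) k q) =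
      ∑ x ∈ Finset.range n, G x * (window (n + 1) (x + 1) * (U ^ (x + 1)) k q) := by
    rw [Finset.sum_range_succ, window_top]
    simp
  rw [← h2, ← mul_assoc e, hG0, pow_zero, sub_eq_iff_eq_add, add_right_comm, ← Finset.sum_add_distrib]
  congr 1
  refine Finset.sum_congr rfl fun x _ => ?_
  push_cast
  ring

theorem normSq_prod {κ : Type*} [Fintype κ] {K : ℕ} (v : κ × Fin K → ℂ) : normSq v = ∑ x, normSq fun k => v (k, x) := by
  simp only [normSq]
  rw [Fintype.sum_prod_type, Finset.sum_comm]

/-- There are K differences and one boundary value, each with square at most b = (2/(K + 1))(π/(K +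
1))². The factor 2 from splitting the sum gives 2(K + 1)b = 4π²/(K + 1)². -/
theorem normSq_windowDiff_le {U : Matrix κ κ ℂ} (hU : Uᴴ * U = 1) (K : ℕ) (v : κ → ℂ) :
    normSq ((windowDiff U K + windowBoundary κ K) *ᵥ v) ≤
      4 * Real.pi ^ 2 / ((K : ℝ) + 1) ^ 2 * normSq v := by
  have hK : (0 : ℝ) < (K : ℝ) + 1 := by positivity
  have hv := normSq_nonneg v
  set b := 2 / ((K : ℝ) + 1) * (Real.pi / ((K : ℝ) + 1)) ^ 2 with hb
  have hb0 : 0 ≤ b := by positivity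
  have h1 : normSq (windowDiff U K *ᵥ v) ≤ K * b * normSq v := by
    rw [normSq_prod]
    have : ∀ x : Fin K, normSq (fun k => (windowDiff U K *ᵥ v) (k, x)) ≤ b * normSq v := by
      intro x
      have e : (fun k => (windowDiff U K *ᵥ v) (k, x)) =
          ((window K (x + 1) - window K x : ℝ) : ℂ) • (U ^ (x + 1 : ℕ) *ᵥ v) := by
        funext k
        simp only [Matrix.mulVec, dotProduct, windowDiff, Matrix.of_apply, Pi.smul_apply,
          smul_eq_mul, Finset.mul_sum, mul_assoc]
      rw [e, normSq_smul, normSq_mulVec_of_isometry (pow_isometry hU _), Complex.norm_real,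
        Real.norm_eq_abs, sq_abs]
      exact mul_le_mul_of_nonneg_right (window_sub_sq_le K x) hv
    refine (Finset.sum_le_sum fun x _ => this x).trans (le_of_eq ?_)
    simp [mul_assoc]
  have h2 : normSq (windowBoundary κ K *ᵥ v) ≤ b * normSq v := by
    rw [normSq_prod]
    rcases K with _ | n
    · simp only [Finset.univ_eq_empty, Finset.sum_empty]
      positivity
    rw [Finset.sum_eq_single (Fin.last n)]
    · have e : (fun k => (windowBoundary κ (n + 1) *ᵥ v) (k, Fin.last n)) =
          ((window (n + 1) 0 : ℝ) : ℂ) • v := by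
        funext k
        simp [Matrix.mulVec, dotProduct, windowBoundary, Matrix.one_apply]
      rw [e, normSq_smul, Complex.norm_real, Real.norm_eq_abs, sq_abs]
      exact mul_le_mul_of_nonneg_right (window_zero_sq_le _) hv
    · intro x _ hx
      have : (x : ℕ) ≠ n := fun h => hx (Fin.ext h)
      simp [normSq, Matrix.mulVec, dotProduct, windowBoundary, this]
    · simp
  rw [Matrix.add_mulVec]
  refine (normSq_add_le _ _).trans ?_
  have h3 : 2 * (K * b * normSq v) + 2 * (b * normSq v) =
      4 * Real.pi ^ 2 / ((K : ℝ) + 1) ^ 2 * normSq v := by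
    rw [hb]
    field_simp
    ring
  linarith

theorem normSq_shift_le {U : Matrix κ κ ℂ} (hU : Uᴴ * U = 1) (K : ℕ) (v : κ → ℂ) :
    normSq ((((1 : Matrix κ κ ℂ) ⊗ₖ phaseDiag K) * phaseEstimation U K -
        (U ⊗ₖ (1 : Matrix (Fin K) (Fin K) ℂ)) * phaseEstimation U K) *ᵥ v) ≤
      4 * Real.pi ^ 2 / ((K : ℝ) + 1) ^ 2 * normSq v := by
  rw [shift_phaseEstimation, ← Matrix.mulVec_mulVec,
    normSq_mulVec_of_isometry (one_kronecker_isometry (fourier_isometry K))]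
  exact normSq_windowDiff_le hU K v

theorem phaseDiag_unitary (K : ℕ) : (phaseDiag K)ᴴ * phaseDiag K = 1 ∧ phaseDiag K * (phaseDiag K)ᴴ = 1 := by
  have h : ∀ x : ℝ, star (Complex.exp (x * Complex.I)) * Complex.exp (x * Complex.I) = 1 := by
    intro x
    rw [RCLike.star_def, Complex.conj_mul', Complex.norm_exp_ofReal_mul_I]
    simp
  constructor
  · rw [phaseDiag, Matrix.diagonal_conjTranspose, Matrix.diagonal_mul_diagonal, ← Matrix.diagonal_one]
    congr 1
    funext j
    exact h _
  · rw [phaseDiag, Matrix.diagonal_conjTranspose, Matrix.diagonal_mul_diagonal, ← Matrix.diagonal_one]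
    congr 1
    funext j
    rw [mul_comm]
    exact h _

theorem sinDiag_eq (K : ℕ) : sinDiag K = (-(Complex.I / 2)) • (phaseDiag K - (phaseDiag K)ᴴ) := by
  rw [sinDiag, phaseDiag, Matrix.diagonal_conjTranspose, Matrix.diagonal_sub, ← Matrix.diagonal_smul]
  congr 1
  funext j
  rw [Pi.smul_apply, Pi.star_apply, RCLike.star_def, ← Complex.exp_conj, Complex.ofReal_sin,
    Complex.sin]
  simp only [map_mul, Complex.conj_ofReal, Complex.conj_I, smul_eq_mul]
  rw [mul_neg, ← neg_mul]
  ring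

/-- With E the outcome phase and V = U ⊗ 1, the difference of sines is -i/2 times (E - V) - (E† -
V†). The adjoint part reduces to the first by (E† - V†)P = -E†(E - V)P U†, so the prefactor 1/4
absorbs the two copies of the bound exactly. -/
theorem normSq_sin_le {U : Matrix κ κ ℂ} (hU : Uᴴ * U = 1) (K : ℕ) (v : κ → ℂ) :
    normSq (((1 : Matrix κ κ ℂ) ⊗ₖ sinDiag K -
        ((-(Complex.I / 2)) • (U - Uᴴ)) ⊗ₖ (1 : Matrix (Fin K) (Fin K) ℂ)) *ᵥ (phaseEstimation U K *ᵥ v)) ≤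
      4 * Real.pi ^ 2 / ((K : ℝ) + 1) ^ 2 * normSq v := by
  set P := phaseEstimation U K with hP
  have hU' : U * Uᴴ = 1 := mul_eq_one_comm.1 hU
  set E : Matrix (κ × Fin K) (κ × Fin K) ℂ := (1 : Matrix κ κ ℂ) ⊗ₖ phaseDiag K with hE
  set V : Matrix (κ × Fin K) (κ × Fin K) ℂ := U ⊗ₖ (1 : Matrix (Fin K) (Fin K) ℂ) with hV
  have hEh : Eᴴ = (1 : Matrix κ κ ℂ) ⊗ₖ (phaseDiag K)ᴴ := by
    rw [hE, Matrix.conjTranspose_kronecker, Matrix.conjTranspose_one]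
  have hVh : Vᴴ = Uᴴ ⊗ₖ (1 : Matrix (Fin K) (Fin K) ℂ) := by
    rw [hV, Matrix.conjTranspose_kronecker, Matrix.conjTranspose_one]
  have hEE : Eᴴ * E = 1 := one_kronecker_isometry (phaseDiag_unitary K).1
  have hEE' : E * Eᴴ = 1 := mul_eq_one_comm.1 hEE
  have hVP : V * P = P * U := kronecker_mul_phaseEstimation (Commute.refl U) K
  have hVhP : Vᴴ * P = P * Uᴴ := by
    rw [hVh]
    exact kronecker_mul_phaseEstimation (show Uᴴ * U = U * Uᴴ by rw [hU, hU']) K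
  have h1 : (1 : Matrix κ κ ℂ) ⊗ₖ sinDiag K -
      ((-(Complex.I / 2)) • (U - Uᴴ)) ⊗ₖ (1 : Matrix (Fin K) (Fin K) ℂ) =
      (-(Complex.I / 2)) • ((E - V) - (Eᴴ - Vᴴ)) := by
    rw [hEh, hVh, hE, hV, sinDiag_eq, Matrix.kronecker_smul, Matrix.smul_kronecker, ← smul_sub]
    congr 1
    have e1 : (1 : Matrix κ κ ℂ) ⊗ₖ (phaseDiag K - (phaseDiag K)ᴴ) =
        (1 : Matrix κ κ ℂ) ⊗ₖ phaseDiag K - (1 : Matrix κ κ ℂ) ⊗ₖ (phaseDiag K)ᴴ := by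
      ext; simp [Matrix.kroneckerMap_apply, mul_sub]
    have e2 : (U - Uᴴ) ⊗ₖ (1 : Matrix (Fin K) (Fin K) ℂ) =
        U ⊗ₖ (1 : Matrix (Fin K) (Fin K) ℂ) - Uᴴ ⊗ₖ (1 : Matrix (Fin K) (Fin K) ℂ) := by
      ext; simp [Matrix.kroneckerMap_apply, sub_mul]
    rw [e1, e2]
    abel
  have h2 : (Eᴴ - Vᴴ) * P = -(Eᴴ * ((E * P - V * P) * Uᴴ)) := by
    rw [Matrix.sub_mul, Matrix.sub_mul, Matrix.mul_sub, hVP, Matrix.mul_assoc P, hU', Matrix.mul_one,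
      Matrix.mul_assoc E, ← Matrix.mul_assoc Eᴴ, hEE, Matrix.one_mul, hVhP]
    abel
  have h3 : ((1 : Matrix κ κ ℂ) ⊗ₖ sinDiag K -
      ((-(Complex.I / 2)) • (U - Uᴴ)) ⊗ₖ (1 : Matrix (Fin K) (Fin K) ℂ)) *ᵥ (P *ᵥ v) =
      (-(Complex.I / 2)) • ((E * P - V * P) *ᵥ v + Eᴴ *ᵥ ((E * P - V * P) *ᵥ (Uᴴ *ᵥ v))) := by
    rw [h1, Matrix.mulVec_mulVec, Matrix.smul_mul, Matrix.sub_mul, h2, Matrix.sub_mul, sub_neg_eq_add,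
      Matrix.smul_mulVec, Matrix.add_mulVec, Matrix.mulVec_mulVec, Matrix.mulVec_mulVec,
      Matrix.mul_assoc]
  rw [h3, normSq_smul]
  have h4 := normSq_shift_le hU K v
  have h5 := normSq_shift_le hU K (Uᴴ *ᵥ v)
  rw [normSq_mulVec_of_isometry (A := Uᴴ) (by rw [Matrix.conjTranspose_conjTranspose, hU'])] at h5
  have h6 := normSq_add_le ((E * P - V * P) *ᵥ v) (Eᴴ *ᵥ ((E * P - V * P) *ᵥ (Uᴴ *ᵥ v)))
  rw [normSq_mulVec_of_isometry (A := Eᴴ) (by rw [Matrix.conjTranspose_conjTranspose, hEE'])] at h6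
  have h7 : ‖-(Complex.I / 2)‖ ^ 2 = 1 / 4 := by
    rw [norm_neg, norm_div, Complex.norm_I]
    norm_num
  rw [h7]
  linarith

theorem phaseGate_eq_exp (K : ℕ) (s : ℝ) :
    phaseGate κ K s = NormedSpace.exp ((-(Complex.I * s)) • ((1 : Matrix κ κ ℂ) ⊗ₖ sinDiag K)) := by
  have : (-(Complex.I * s)) • ((1 : Matrix κ κ ℂ) ⊗ₖ sinDiag K) =
      Matrix.diagonal fun p : κ × Fin K =>
        -(Complex.I * s) * (Real.sin (2 * Real.pi * ((p.2 : ℕ) : ℝ) / (K : ℝ)) : ℂ) := by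
    rw [sinDiag, ← Matrix.diagonal_one, Matrix.diagonal_kronecker_diagonal, ← Matrix.diagonal_smul]
    congr 1
    funext p
    simp
  rw [this, Matrix.exp_diagonal, phaseGate]
  congr 1
  funext p
  rw [Pi.coe_exp, ← Complex.exp_eq_exp_ℂ]
  congr 1
  push_cast
  ring

/-- Simulation of `exp(-i s G)` by coherent phase estimation of `U`, where `G` is the sine of `U` on the
range of an isometry `T`. -/
theorem simulation_fidelity {ι : Type*} [Fintype ι] [DecidableEq ι] {U : Matrix κ κ ℂ}
    (hU : Uᴴ * U = 1) {T : Matrix κ ι ℂ} (hT : Tᴴ * T = 1) {G : Matrix ι ι ℂ}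
    (hUT : ((-(Complex.I / 2)) • (U - Uᴴ)) * T = T * G) {K : ℕ} (hK : 1 ≤ K) (s : ℝ) (ψ : ι → ℂ) :
    (1 - 2 * Real.pi ^ 2 * s ^ 2 / ((K : ℝ) + 1) ^ 2) * normSq ψ ≤
      ‖star (NormedSpace.exp ((-(Complex.I * s)) • G) *ᵥ ψ) ⬝ᵥ
        ((Tᴴ * (phaseEstimation U K)ᴴ * phaseGate κ K s * phaseEstimation U K * T) *ᵥ ψ)‖ := by
  refine le_trans ?_ (Complex.re_le_norm _)
  set P := phaseEstimation U K with hP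
  have hU' : U * Uᴴ = 1 := mul_eq_one_comm.1 hU
  set W := (-(Complex.I / 2)) • (U - Uᴴ) with hW
  set Wt : Matrix (κ × Fin K) (κ × Fin K) ℂ := W ⊗ₖ (1 : Matrix (Fin K) (Fin K) ℂ) with hWt
  set Sn : Matrix (κ × Fin K) (κ × Fin K) ℂ := (1 : Matrix κ κ ℂ) ⊗ₖ sinDiag K with hSn
  have hWU : Commute W U := by
    refine Commute.smul_left (Commute.sub_left (Commute.refl U) ?_) _
    show Uᴴ * U = U * Uᴴ
    rw [hU, hU']
  have hWP : Wt * P = P * W := kronecker_mul_phaseEstimation hWU K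
  have hWherm : Wᴴ = W := by
    rw [hW, Matrix.conjTranspose_smul, Matrix.conjTranspose_sub, Matrix.conjTranspose_conjTranspose,
      ← neg_sub U, smul_neg, ← neg_smul]
    congr 1
    simp [neg_div]
  have hWth : Wt.IsHermitian := by
    rw [Matrix.IsHermitian, hWt, Matrix.conjTranspose_kronecker, hWherm, Matrix.conjTranspose_one]
  have hSnh : Sn.IsHermitian := by
    rw [Matrix.IsHermitian, hSn, Matrix.conjTranspose_kronecker, Matrix.conjTranspose_one, sinDiag,
      Matrix.diagonal_conjTranspose]
    congr 2
    funext j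
    exact Complex.conj_ofReal _
  have hcomm : Commute Wt Sn := by
    show Wt * Sn = Sn * Wt
    rw [hWt, hSn, ← Matrix.mul_kronecker_mul, ← Matrix.mul_kronecker_mul, Matrix.mul_one,
      Matrix.one_mul, Matrix.one_mul, Matrix.mul_one]
  set v := P *ᵥ (T *ᵥ ψ) with hv
  have hvn : normSq v = normSq ψ := by
    rw [hv, normSq_mulVec_of_isometry (phaseEstimation_isometry hU hK), normSq_mulVec_of_isometry hT]
  -- The exact evolution under `G` can be moved past `P * T`, where it becomes the evolution under
  -- `Wt`.
  have hint : NormedSpace.exp ((-(Complex.I * s)) • Wt) * (P * T) =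
      (P * T) * NormedSpace.exp ((-(Complex.I * s)) • G) := by
    refine exp_mul_of_intertwine ?_
    rw [Matrix.smul_mul, Matrix.mul_smul, ← Matrix.mul_assoc, hWP, Matrix.mul_assoc, hUT,
      Matrix.mul_assoc]
  -- `Wt` acts on the walk space and is commuted past `Sn`, which acts on the phase register; so the
  -- ideal and the approximate evolution merge into one exponential of their difference.
  have hfid : star (NormedSpace.exp ((-(Complex.I * s)) • G) *ᵥ ψ) ⬝ᵥ
        ((Tᴴ * Pᴴ * phaseGate κ K s * P * T) *ᵥ ψ) =
      star v ⬝ᵥ (NormedSpace.exp ((-Complex.I) • ((s : ℂ) • (Sn - Wt))) *ᵥ v) := by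
    have e1 : (Tᴴ * Pᴴ * phaseGate κ K s * P * T) *ᵥ ψ =
        (P * T)ᴴ *ᵥ (phaseGate κ K s *ᵥ v) := by
      rw [hv, Matrix.mulVec_mulVec, Matrix.mulVec_mulVec, Matrix.mulVec_mulVec,
        Matrix.conjTranspose_mul]
    rw [e1, ← star_mulVec_dotProduct, Matrix.mulVec_mulVec, ← hint, ← Matrix.mulVec_mulVec,
      ← Matrix.mulVec_mulVec, ← hv, star_mulVec_dotProduct, exp_smul_conjTranspose hWth,
      phaseGate_eq_exp, Matrix.mulVec_mulVec, ← Matrix.exp_add_of_commute]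
    · congr 3
      rw [smul_smul, smul_sub, sub_eq_neg_add, neg_mul, neg_smul, neg_smul, neg_neg]
    · exact (hcomm.smul_left _).smul_right _
  have hX : ((s : ℂ) • (Sn - Wt)).IsHermitian := by
    rw [Matrix.IsHermitian, Matrix.conjTranspose_smul, Matrix.conjTranspose_sub, hSnh.eq, hWth.eq]
    simp
  have hb := re_expectation_exp_ge hX v
  rw [hfid]
  refine le_trans ?_ hb
  have hs := normSq_sin_le hU K (T *ᵥ ψ)
  rw [normSq_mulVec_of_isometry hT] at hs
  rw [Matrix.smul_mulVec, normSq_smul, hvn, Complex.norm_real, Real.norm_eq_abs, sq_abs]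
  have := mul_le_mul_of_nonneg_left hs (sq_nonneg s)
  have e : (1 - 2 * Real.pi ^ 2 * s ^ 2 / ((K : ℝ) + 1) ^ 2) * normSq ψ =
      normSq ψ - s ^ 2 * (4 * Real.pi ^ 2 / ((K : ℝ) + 1) ^ 2 * normSq ψ) / 2 := by ring
  rw [e]
  linarith

end estimation

end EDWalk

namespace EDWalk

set_option linter.unusedSectionVars false

/-! ### The discrete-time walk: its isometry, its sine on the range of T, and the simulation. -/

section discrete

variable {ι : Type*} [Fintype ι] [LinearOrder ι] {G : Matrix ι ι ℂ} {d : ι → ℝ}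

theorem cpow_half_sq (z : ℂ) : (z ^ (1 / 2 : ℂ)) ^ 2 = z := by
  have := Complex.cpow_nat_inv_pow z two_ne_zero
  rwa [Nat.cast_ofNat, ← one_div] at this

theorem norm_rootEntry_sq (hG : G.IsHermitian) (j k : ι) : ‖rootEntry G j k‖ ^ 2 = ‖G j k‖ := by
  rw [rootEntry]
  split_ifs with h
  · rw [← norm_pow, cpow_half_sq, norm_star]
  · rw [norm_star, ← norm_pow, cpow_half_sq, norm_star, ← hG.apply j k, norm_star]

/-- Off the diagonal the conjugate branches make the product the square of a single root. On the
diagonal it is |G_jj| instead, so the diagonal must be nonnegative; this is why -H is used rather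
than H. -/
theorem star_rootEntry_mul (hG : G.IsHermitian) (hd : ∀ j, G j j = (‖G j j‖ : ℂ)) (j k : ι) :
    star (rootEntry G j k) * rootEntry G k j = G j k := by
  rcases lt_trichotomy j k with h | rfl | h
  · rw [rootEntry, rootEntry, if_pos h.le, if_neg (not_le.2 h), ← star_mul', ← sq, cpow_half_sq,
      star_star]
  · rw [RCLike.star_def, Complex.conj_mul', hd j]
    exact_mod_cast norm_rootEntry_sq hG j j
  · rw [rootEntry, rootEntry, if_pos h.le, if_neg (not_le.2 h), star_star, ← sq, cpow_half_sq]
    exact hG.apply j k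

theorem isometryT_self (j k : ι) : isometryT G d (j, k) j =
    rootEntry G j k * ((√(d k / d j) / √(absNorm G) : ℝ) : ℂ) := if_pos rfl

theorem sum_isometryT {F : ι × ι → ι → ℂ} (l : ι) :
    ∑ p, star (isometryT G d p l) * F p l = ∑ k, star (isometryT G d (l, k) l) * F (l, k) l := by
  rw [Fintype.sum_prod_type, Finset.sum_eq_single l]
  · intro b _ hb
    refine Finset.sum_eq_zero fun k _ => ?_
    rw [isometryT, Matrix.of_apply, if_neg hb, star_zero, zero_mul]
  · simp

/-- Distinct columns have disjoint supports, since they differ in the first coordinate. The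
normalization of a column is exactly the eigenvector equation for `d`. -/
theorem isometryT_isometry (hG : G.IsHermitian) (hp : IsPrincipal G d) (h0 : 0 < absNorm G) :
    (isometryT G d)ᴴ * isometryT G d = 1 := by
  ext l l'
  rw [Matrix.mul_apply]
  simp only [Matrix.conjTranspose_apply]
  rw [sum_isometryT (F := fun p _ => isometryT G d p l') l]
  by_cases h : l = l'
  · subst h
    have h1 : ∀ k, star (isometryT G d (l, k) l) * isometryT G d (l, k) l =
        ((elemAbs G l k * d k / (d l * absNorm G) : ℝ) : ℂ) := by
      intro k
      rw [RCLike.star_def, Complex.conj_mul', ← Complex.ofReal_pow, isometryT_self, norm_mul,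
        mul_pow, norm_rootEntry_sq hG, Complex.norm_real, Real.norm_eq_abs, sq_abs, div_pow,
        Real.sq_sqrt (div_pos (hp.1 k) (hp.1 l)).le, Real.sq_sqrt h0.le]
      congr 1
      change ‖G l k‖ * _ = ‖G l k‖ * _ / _
      have := (hp.1 l).ne'
      field_simp
    rw [Finset.sum_congr rfl fun k _ => h1 k, ← Complex.ofReal_sum, ← Finset.sum_div]
    have h2 := congrFun hp.2 l
    rw [Matrix.mulVec, dotProduct, Pi.smul_apply, smul_eq_mul, mul_comm] at h2
    rw [h2, div_self (mul_pos (hp.1 l) h0).ne', Matrix.one_apply_eq, Complex.ofReal_one]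
  · rw [Matrix.one_apply_ne h]
    refine Finset.sum_eq_zero fun k _ => ?_
    rw [isometryT, Matrix.of_apply, Matrix.of_apply, if_neg h, mul_zero]

theorem swapS_mul_apply {κ : Type*} (A : Matrix (ι × ι) κ ℂ) (p : ι × ι) (q : κ) :
    (swapS ι * A) p q = A p.swap q := by
  rw [Matrix.mul_apply, Finset.sum_eq_single p.swap]
  · simp [swapS]
  · intro b _ hb
    rw [swapS, Matrix.of_apply, if_neg, zero_mul]
    rintro rfl
    simp at hb
  · simp

/-- After the swap |ψ_l⟩ and |ψ_l'⟩ meet only in the entry (l, l'), where the weights d l'/d l and d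
l/d l' cancel. -/
theorem isometryT_swap (hG : G.IsHermitian) (hd : ∀ j, G j j = (‖G j j‖ : ℂ)) (hp : IsPrincipal G d)
    (h0 : 0 < absNorm G) :
    (isometryT G d)ᴴ * (swapS ι * isometryT G d) = ((absNorm G : ℂ)⁻¹) • G := by
  ext l l'
  rw [Matrix.mul_apply]
  simp only [Matrix.conjTranspose_apply, swapS_mul_apply]
  rw [sum_isometryT (F := fun p _ => isometryT G d p.swap l') l, Finset.sum_eq_single l']
  · rw [Prod.swap_prod_mk, isometryT_self, isometryT_self, star_mul',
      mul_mul_mul_comm, star_rootEntry_mul hG hd, Matrix.smul_apply, smul_eq_mul,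
      mul_comm, RCLike.star_def, Complex.conj_ofReal, ← Complex.ofReal_mul, div_mul_div_comm,
      ← Real.sqrt_mul (div_pos (hp.1 l') (hp.1 l)).le, Real.mul_self_sqrt h0.le]
    have := (hp.1 l).ne'
    have := (hp.1 l').ne'
    have e : d l' / d l * (d l / d l') = 1 := by field_simp
    rw [e, Real.sqrt_one, one_div, Complex.ofReal_inv]
  · intro b _ hb
    rw [Prod.swap_prod_mk, isometryT, Matrix.of_apply, Matrix.of_apply, if_neg hb, mul_zero]
  · simp

theorem swapS_conjTranspose : (swapS ι)ᴴ = swapS ι := by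
  ext p q
  rw [Matrix.conjTranspose_apply, swapS, Matrix.of_apply, Matrix.of_apply]
  by_cases h : p = q.swap
  · subst h; simp
  · rw [if_neg h, if_neg, star_zero]
    rintro rfl
    simp at h

theorem swapS_mul_self : swapS ι * swapS ι = 1 := by
  ext p q
  rw [swapS_mul_apply, swapS, Matrix.of_apply, Matrix.one_apply]
  simp [Prod.swap_inj]

variable {κ : Type*} [Fintype κ] [DecidableEq κ]

theorem reflection_mul_self {T : Matrix κ ι ℂ} (hT : Tᴴ * T = 1) :
    ((2 : ℂ) • (T * Tᴴ) - 1) * ((2 : ℂ) • (T * Tᴴ) - 1) = 1 := by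
  have : T * Tᴴ * (T * Tᴴ) = T * Tᴴ := by
    rw [Matrix.mul_assoc, ← Matrix.mul_assoc Tᴴ, hT, Matrix.one_mul]
  rw [Matrix.sub_mul, Matrix.mul_sub, Matrix.smul_mul, Matrix.mul_smul, this, Matrix.mul_one,
    Matrix.one_mul, smul_smul]
  module

theorem reflection_conjTranspose (T : Matrix κ ι ℂ) :
    ((2 : ℂ) • (T * Tᴴ) - 1)ᴴ = (2 : ℂ) • (T * Tᴴ) - 1 := by
  simp

theorem walk_isometry {S : Matrix κ κ ℂ} (hS : Sᴴ = S) (hSS : S * S = 1) {T : Matrix κ ι ℂ}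
    (hT : Tᴴ * T = 1) :
    (Complex.I • (S * ((2 : ℂ) • (T * Tᴴ) - 1)))ᴴ * (Complex.I • (S * ((2 : ℂ) • (T * Tᴴ) - 1))) = 1 := by
  rw [Matrix.conjTranspose_smul, Matrix.conjTranspose_mul, hS, reflection_conjTranspose,
    Matrix.smul_mul, Matrix.mul_smul, Matrix.mul_assoc, ← Matrix.mul_assoc S, hSS, Matrix.one_mul,
    reflection_mul_self hT, smul_smul]
  simp

/-- On the range of T one has U T = iS T and U†T = -i(2TT† - 1)S T. In their difference the terms S
T cancel and 2iT(T†S T) remains. -/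
theorem walk_sine {S : Matrix κ κ ℂ} (hS : Sᴴ = S) {T : Matrix κ ι ℂ}
    (hT : Tᴴ * T = 1) :
    ((-(Complex.I / 2)) • (Complex.I • (S * ((2 : ℂ) • (T * Tᴴ) - 1)) -
      (Complex.I • (S * ((2 : ℂ) • (T * Tᴴ) - 1)))ᴴ)) * T = T * (Tᴴ * (S * T)) := by
  have h1 : ((2 : ℂ) • (T * Tᴴ) - 1) * T = T := by
    rw [Matrix.sub_mul, Matrix.smul_mul, Matrix.mul_assoc, hT, Matrix.mul_one, Matrix.one_mul]
    module
  have h2 : ((2 : ℂ) • (T * Tᴴ) - 1) * (S * T) = (2 : ℂ) • (T * (Tᴴ * (S * T))) - S * T := by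
    rw [Matrix.sub_mul, Matrix.smul_mul, Matrix.mul_assoc, Matrix.one_mul]
  rw [Matrix.conjTranspose_smul, Matrix.conjTranspose_mul, hS, reflection_conjTranspose,
    Matrix.smul_mul, Matrix.sub_mul, Matrix.smul_mul, Matrix.smul_mul, Matrix.mul_assoc, h1,
    Matrix.mul_assoc, h2, RCLike.star_def, Complex.conj_I, neg_smul Complex.I, sub_neg_eq_add, ← smul_add,
    smul_smul, add_sub_cancel, smul_smul]
  have : -(Complex.I / 2) * Complex.I * 2 = 1 := by
    linear_combination -Complex.I_mul_I
  rw [this, one_smul]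

end discrete

theorem reducedHamiltonian_isHermitian (N : ℕ) : (reducedHamiltonian N).IsHermitian := by
  ext i j
  rw [Matrix.conjTranspose_apply, reducedHamiltonian_symm, reducedHamiltonian, Matrix.map_apply,
    RCLike.star_def, Complex.conj_ofReal]

theorem neg_reducedHamiltonian_diag {N : ℕ} (hN : 5 ≤ N) (j : Fin 4) :
    (-reducedHamiltonian N) j j = (‖(-reducedHamiltonian N) j j‖ : ℂ) := by
  obtain ⟨h1, h2, h3⟩ := real_bounds hN
  have h : ∃ r : ℝ, 0 ≤ r ∧ (-reducedHamiltonian N) j j = r := by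
    refine Fin.lastCases ?_ (fun i => ?_) j
    · exact ⟨0, le_rfl, by rw [Matrix.neg_apply, reducedHamiltonian_last_last]; simp⟩
    · refine ⟨1 / (N : ℝ) ^ (2 / 3 : ℝ) * reducedLaplacian N (subsetSize N) i i, ?_, ?_⟩
      · refine mul_nonneg (by positivity) ?_
        fin_cases i <;> simp [reducedLaplacian] <;> first | linarith | exact subsetSize_le N
      · rw [Matrix.neg_apply, reducedHamiltonian_castSucc]
        push_cast
        ring
  obtain ⟨r, hr, h⟩ := h
  rw [h, Complex.norm_real, Real.norm_eq_abs, abs_of_nonneg hr]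

theorem discrete_simulation :
    ∃ C > (0 : ℝ), ∀ N : ℕ, 5 ≤ N → ∃ d : Fin 4 → ℝ,
      IsPrincipal (-reducedHamiltonian N) d ∧
      ∀ t : ℝ, 0 ≤ t → ∀ δ : ℝ, 0 < δ → δ ≤ 1 → ∃ K : ℕ, 1 ≤ K ∧
        (simulationSteps K : ℝ) ≤ C * (absNorm (reducedHamiltonian N) * t / √δ) ∧
        ∀ ψ : Fin 4 → ℂ, ∑ j, ‖ψ j‖ ^ 2 = 1 →
          1 - δ ≤ ‖star (evolution (reducedHamiltonian N) t *ᵥ ψ) ⬝ᵥ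
            (simulation (-reducedHamiltonian N) d K (-t) *ᵥ ψ)‖ := by
  refine ⟨10, by norm_num, fun N hN => ?_⟩
  obtain ⟨d, hd⟩ := exists_isPrincipal hN
  refine ⟨d, hd, fun t ht δ hδ _ => ?_⟩
  obtain ⟨h1, h2, h3⟩ := real_bounds hN
  have hpow : 0 < (N : ℝ) ^ (2 / 3 : ℝ) := by positivity
  have hpos : 0 < absNorm (reducedHamiltonian N) :=
    (div_pos (by linarith) hpow).trans_le (absNorm_bounds hN).1
  have hpos' : 0 < absNorm (-reducedHamiltonian N) := by rwa [absNorm_neg]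
  set L := absNorm (reducedHamiltonian N) with hL
  set a := L * t / √δ with ha
  have hsδ : 0 < √δ := Real.sqrt_pos.2 hδ
  have ha0 : 0 ≤ a := by positivity
  -- With K + 1 ≥ 5a the loss is at most 2π²a²δ/(25a²) for a > 0, and 2π² ≤ 24 < 25. The number of
  -- steps is 2⌊5a⌋ ≤ 10a.
  refine ⟨⌊5 * a⌋₊ + 1, by omega, ?_, fun ψ hψ => ?_⟩
  · rw [simulationSteps, Nat.add_sub_cancel]
    push_cast
    have := Nat.floor_le (show 0 ≤ 5 * a by positivity)
    linarith
  · set K := ⌊5 * a⌋₊ + 1 with hK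
    have hherm : (-reducedHamiltonian N).IsHermitian := (reducedHamiltonian_isHermitian N).neg
    have hT := isometryT_isometry hherm hd hpos'
    have hUT := walk_sine (S := swapS (Fin 4)) swapS_conjTranspose hT
    rw [isometryT_swap hherm (neg_reducedHamiltonian_diag hN) hd hpos'] at hUT
    have key := simulation_fidelity (walk_isometry swapS_conjTranspose swapS_mul_self hT) hT hUT
      (show 1 ≤ K by omega) (absNorm (-reducedHamiltonian N) * (-t)) ψ
    -- The sine of the walk is G/‖abs(G)‖, so the time is rescaled by the norm; the signs of G = -H
    -- and of -t cancel.
    have hev : NormedSpace.exp ((-(Complex.I * ((absNorm (-reducedHamiltonian N) * (-t) : ℝ) : ℂ))) •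
        ((absNorm (-reducedHamiltonian N) : ℂ)⁻¹ • -reducedHamiltonian N)) =
        evolution (reducedHamiltonian N) t := by
      rw [evolution, smul_smul, smul_neg, ← neg_smul]
      congr 2
      have : (absNorm (-reducedHamiltonian N) : ℂ) ≠ 0 := by exact_mod_cast hpos'.ne'
      push_cast
      field_simp
    rw [hev] at key
    refine le_trans ?_ key
    rw [normSq, hψ, mul_one, absNorm_neg, ← hL]
    have hKa : 5 * a ≤ (K : ℝ) + 1 := by
      have := Nat.lt_floor_add_one (5 * a)
      rw [hK]; push_cast
      linarith
    have hLt : L * t = a * √δ := by rw [ha]; field_simp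
    have hpi : Real.pi ^ 2 ≤ 12 := by nlinarith [Real.pi_lt_d2, Real.pi_pos]
    have hK1 : (0 : ℝ) < (K : ℝ) + 1 := by positivity
    have : 2 * Real.pi ^ 2 * (L * -t) ^ 2 / ((K : ℝ) + 1) ^ 2 ≤ δ := by
      rw [div_le_iff₀ (by positivity), mul_neg, neg_sq, hLt, mul_pow, Real.sq_sqrt hδ.le]
      have h25 : 25 * a ^ 2 ≤ ((K : ℝ) + 1) ^ 2 := by nlinarith
      nlinarith [sq_nonneg a, mul_nonneg hδ.le (sq_nonneg a)]
    linarith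

end EDWalk

namespace EDWalk

/-! ### The walk in the reduced space -/

open scoped Matrix.Norms.Operator in
theorem hasDerivAt_evolution {ι : Type*} [Fintype ι] [DecidableEq ι] (X : Matrix ι ι ℂ)
    (w v : ι → ℂ) (t : ℝ) :
    HasDerivAt (fun t : ℝ => w ⬝ᵥ (evolution X t *ᵥ v))
      (-Complex.I * (w ⬝ᵥ (X *ᵥ (evolution X t *ᵥ v)))) t := by
  have h := hasDerivAt_exp_smul_const' (𝕂 := ℝ) (-Complex.I • X) t
  have e : ∀ t : ℝ, NormedSpace.exp (t • (-Complex.I • X)) = evolution X t := fun t => by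
    rw [evolution, ← Complex.coe_smul t, smul_smul]
    congr 2
    ring
  have h : HasDerivAt (fun t : ℝ => evolution X t) ((-Complex.I • X) * evolution X t) t := by
    rw [← e t]
    exact h.congr_of_eventuallyEq (Filter.Eventually.of_forall fun t => (e t).symm)
  let L : Matrix ι ι ℂ →ₗ[ℝ] ℂ :=
    { toFun := fun Y => w ⬝ᵥ (Y *ᵥ v)
      map_add' := fun Y Z => by rw [Matrix.add_mulVec, dotProduct_add]
      map_smul' := fun r Y => by rw [Matrix.smul_mulVec, dotProduct_smul]; rfl }
  have h2 := (LinearMap.toContinuousLinearMap L).hasFDerivAt.comp_hasDerivAt t h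
  refine h2.congr_deriv ?_
  change w ⬝ᵥ (((-Complex.I • X) * evolution X t) *ᵥ v) = _
  rw [Matrix.smul_mul, Matrix.smul_mulVec, dotProduct_smul, Matrix.mulVec_mulVec, smul_eq_mul]

theorem evolution_zero {ι : Type*} [Fintype ι] [DecidableEq ι] (X : Matrix ι ι ℂ) :
    evolution X 0 = 1 := by
  simp [evolution]

theorem evolution_isometry {ι : Type*} [Fintype ι] [DecidableEq ι] {X : Matrix ι ι ℂ}
    (hX : X.IsHermitian) (t : ℝ) : (evolution X t)ᴴ * evolution X t = 1 :=
  exp_smul_isometry hX t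

theorem mul_evolution {ι : Type*} [Fintype ι] [DecidableEq ι] (X : Matrix ι ι ℂ) (t : ℝ) :
    X * evolution X t = evolution X t * X :=
  (exp_mul_of_intertwine (by rw [Matrix.smul_mul, Matrix.mul_smul])).symm

theorem norm_sq_dotProduct_le {ι : Type*} [Fintype ι] (w : ι → ℝ) (z : ι → ℂ) :
    ‖(fun i => (w i : ℂ)) ⬝ᵥ z‖ ^ 2 ≤ (w ⬝ᵥ w) * normSq z := by
  calc ‖(fun i => (w i : ℂ)) ⬝ᵥ z‖ ^ 2 ≤ (∑ i, |w i| * ‖z i‖) ^ 2 := by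
        gcongr
        refine (norm_sum_le _ _).trans_eq (Finset.sum_congr rfl fun i _ => ?_)
        rw [norm_mul, Complex.norm_real, Real.norm_eq_abs]
    _ ≤ (∑ i, |w i| ^ 2) * ∑ i, ‖z i‖ ^ 2 := Finset.sum_mul_sq_le_sq_mul_sq _ _ _
    _ = _ := by simp only [sq_abs, normSq, dotProduct, ← sq]

section reduced

variable {N : ℕ}

/-- The vector with real coordinates `v` at `A₀, A₁, A₂` and `c` at `B₂`. -/
noncomputable def liftVec (v : Fin 3 → ℝ) (c : ℝ) : Fin 4 → ℝ := Fin.snoc (α := fun _ => ℝ) v c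

theorem liftVec_dotProduct (v w : Fin 3 → ℝ) (c d : ℝ) :
    liftVec v c ⬝ᵥ liftVec w d = v ⬝ᵥ w + c * d := by
  simp [dotProduct, Fin.sum_univ_castSucc, liftVec, -Fin.reduceLast]

/-- The entries of a real vector as complex numbers. -/
noncomputable def toC {ι : Type*} (v : ι → ℝ) : ι → ℂ := fun i => (v i : ℂ)

theorem toC_dotProduct {ι : Type*} [Fintype ι] (v w : ι → ℝ) :
    toC v ⬝ᵥ toC w = ((v ⬝ᵥ w : ℝ) : ℂ) := by
  simp [toC, dotProduct]

theorem normSq_toC {ι : Type*} [Fintype ι] (v : ι → ℝ) : normSq (toC v) = v ⬝ᵥ v := by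
  simp [normSq, toC, dotProduct, sq]

theorem liftVec_dotProduct_toC (v : Fin 3 → ℝ) (c : ℝ) (z : Fin 4 → ℂ) :
    toC (liftVec v c) ⬝ᵥ z = ∑ i : Fin 3, (v i : ℂ) * z i.castSucc + c * z (Fin.last 3) := by
  simp [dotProduct, Fin.sum_univ_castSucc, liftVec, toC, -Fin.reduceLast]

theorem reducedHamiltonian_mulVec_liftVec (v : Fin 3 → ℝ) (c : ℝ) :
    reducedHamiltonian N *ᵥ toC (liftVec v c) =
      toC (liftVec (c • Pi.single 2 1 -
        (1 / (N : ℝ) ^ (2 / 3 : ℝ)) • reducedLaplacian N (subsetSize N) *ᵥ v) (v 2)) := by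
  funext i
  rw [Matrix.mulVec, dotProduct, Fin.sum_univ_castSucc]
  refine Fin.lastCases ?_ (fun i => ?_) i
  · simp [reducedHamiltonian_last_castSucc, reducedHamiltonian_last_last, toC, liftVec, -Fin.reduceLast]
  · simp only [reducedHamiltonian_castSucc, reducedHamiltonian_castSucc_last, toC, liftVec,
      Fin.snoc_castSucc, Fin.snoc_last, Pi.sub_apply, Pi.smul_apply, Matrix.mulVec, dotProduct,
      smul_eq_mul, Finset.mul_sum]
    push_cast
    rw [sub_eq_add_neg, add_comm]
    congr 1
    · by_cases h : i = 2 <;> simp [h]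
    · rw [← Finset.sum_neg_distrib]
      refine Finset.sum_congr rfl fun j _ => ?_
      ring

theorem dotProduct_reducedHamiltonian_mulVec (w z : Fin 4 → ℂ) :
    w ⬝ᵥ (reducedHamiltonian N *ᵥ z) = (reducedHamiltonian N *ᵥ w) ⬝ᵥ z := by
  have : (reducedHamiltonian N)ᵀ = reducedHamiltonian N :=
    Matrix.ext fun i j => reducedHamiltonian_symm N j i
  rw [Matrix.dotProduct_mulVec, ← Matrix.mulVec_transpose, this]

/-- The uniform superposition of the original vertices in reduced coordinates. -/
noncomputable def startVec (N : ℕ) : Fin 4 → ℝ := liftVec (flatVec N (subsetSize N)) 0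

/-- The state at time `t` in reduced coordinates. -/
noncomputable def reducedState (N : ℕ) (t : ℝ) : Fin 4 → ℂ :=
  evolution (reducedHamiltonian N) t *ᵥ toC (startVec N)

theorem startVec_dotProduct_self (hN : 5 ≤ N) : startVec N ⬝ᵥ startVec N = 1 := by
  obtain ⟨h1, h2, h3⟩ := real_bounds hN
  rw [startVec, liftVec_dotProduct, flatVec_dot_self (by linarith) (by linarith) (by linarith)]
  simp

theorem normSq_reducedState (hN : 5 ≤ N) (t : ℝ) : normSq (reducedState N t) = 1 := by
  rw [reducedState, normSq_mulVec_of_isometry (evolution_isometry (reducedHamiltonian_isHermitian N) t),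
    normSq_toC, startVec_dotProduct_self hN]

theorem reducedLaplacian_mulVec_flatVec (hN : 5 ≤ N) :
    reducedLaplacian N (subsetSize N) *ᵥ flatVec N (subsetSize N) = 0 := by
  obtain ⟨h1, h2, h3⟩ := real_bounds hN
  rw [reducedLaplacian_mulVec (by linarith) (by linarith) (by linarith),
    flatVec_dot_self (by linarith) (by linarith) (by linarith), dotProduct_comm, flatVec_dot_topVec]
  simp

theorem reducedHamiltonian_mulVec_startVec (hN : 5 ≤ N) :
    reducedHamiltonian N *ᵥ toC (startVec N) =
      toC (liftVec 0 (flatVec N (subsetSize N) 2)) := by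
  rw [startVec, reducedHamiltonian_mulVec_liftVec, reducedLaplacian_mulVec_flatVec hN]
  simp

theorem flatVec_two_bounds (hN : 5 ≤ N) :
    ((N : ℝ) ^ (2 / 3 : ℝ) - 3 / 2) / N ≤ flatVec N (subsetSize N) 2 ∧
      flatVec N (subsetSize N) 2 ≤ subsetSize N / N := by
  obtain ⟨h1, h2, h3⟩ := real_bounds hN
  obtain ⟨h4, h5⟩ := subsetSize_bounds N
  change _ ≤ √(subsetSize N : ℝ) * √((subsetSize N : ℝ) - 1) / √((N : ℝ) * (N - 1)) ∧
    √(subsetSize N : ℝ) * √((subsetSize N : ℝ) - 1) / √((N : ℝ) * (N - 1)) ≤ _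
  rw [← Real.sqrt_mul (by linarith), ← Real.sqrt_div (by nlinarith)]
  constructor
  · refine Real.le_sqrt_of_sq_le ?_
    rw [div_pow]
    have : 0 ≤ (N : ℝ) ^ (2 / 3 : ℝ) := by positivity
    refine div_le_div₀ ?_ ?_ ?_ ?_ <;> nlinarith
  · rw [Real.sqrt_le_left (by positivity), div_pow, div_le_div_iff₀ (by nlinarith) (by positivity)]
    nlinarith [mul_nonneg (mul_nonneg (show (0:ℝ) ≤ subsetSize N by linarith)
      (show (0:ℝ) ≤ N by linarith)) (show (0:ℝ) ≤ N - subsetSize N by linarith)]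

theorem rpow_third_sq (N : ℕ) : ((N : ℝ) ^ (1 / 3 : ℝ)) ^ 2 = (N : ℝ) ^ (2 / 3 : ℝ) := by
  rw [← Real.rpow_natCast, ← Real.rpow_mul (by positivity)]
  norm_num

theorem rpow_third_cube (N : ℕ) : ((N : ℝ) ^ (1 / 3 : ℝ)) ^ 3 = N := by
  rw [← Real.rpow_natCast, ← Real.rpow_mul (by positivity)]
  norm_num

/-- The amplitude of the start vector at `A₂` is of order `N^{-1/3}`. -/
theorem flatVec_two_mul_bounds (hN : 1000 ≤ N) :
    1 / 2 ≤ flatVec N (subsetSize N) 2 * (N : ℝ) ^ (1 / 3 : ℝ) ∧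
      flatVec N (subsetSize N) 2 * (N : ℝ) ^ (1 / 3 : ℝ) ≤ 2 := by
  obtain ⟨h1, h2⟩ := flatVec_two_bounds (N := N) (by omega)
  obtain ⟨h4, h5⟩ := subsetSize_bounds N
  have hN' : (1000 : ℝ) ≤ N := by exact_mod_cast hN
  set r := (N : ℝ) ^ (1 / 3 : ℝ) with hr
  have hr0 : 0 < r := by positivity
  have h10 : 10 ≤ r := by
    refine le_of_pow_le_pow_left₀ (n := 3) (by norm_num) hr0.le ?_
    rw [rpow_third_cube]; linarith
  have h23 := rpow_third_sq N
  have h3 := rpow_third_cube N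
  rw [← hr] at h23 h3
  rw [← h23] at h1 h5
  have hN0 : (0 : ℝ) < N := by linarith
  constructor
  · calc 1 / 2 ≤ (r ^ 2 - 3 / 2) / N * r := by
          rw [div_mul_eq_mul_div, le_div_iff₀ hN0, ← h3]
          nlinarith [mul_pos hr0 hr0, pow_pos hr0 3]
      _ ≤ _ := by gcongr
  · calc _ ≤ (r ^ 2 + 1 / 2) / N * r := by
          gcongr
          exact h2.trans (by gcongr)
      _ ≤ 2 := by
          rw [div_mul_eq_mul_div, div_le_iff₀ hN0, ← h3]
          nlinarith [mul_pos hr0 hr0, pow_pos hr0 3]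

/-- Suppose the pendant amplitude stays below 1/20 up to T = N^{1/3}. Since H s = α|B₂⟩, the overlap
with s stays near 1. Then the overlap with the vector w, close to |B₂⟩, grows at rate about α and
reaches about αT ≥ 1/2, which is impossible. -/
theorem exists_time_overlap_pendant (hN : 1000 ≤ N) :
    ∃ t : ℝ, 0 ≤ t ∧ t ≤ (N : ℝ) ^ (1 / 3 : ℝ) ∧ 1 / 20 ≤ ‖reducedState N t (Fin.last 3)‖ := by
  by_contra! hcon
  have h5 : 5 ≤ N := by omega
  obtain ⟨h1, h2, h3⟩ := real_bounds h5
  obtain ⟨y, hy0, hy1, hy2⟩ := exists_potential (n := N) (M := subsetSize N) (by linarith)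
    (by linarith) (by linarith)
  obtain ⟨ha1, ha2⟩ := flatVec_two_mul_bounds hN
  have hN' : (1000 : ℝ) ≤ N := by exact_mod_cast hN
  have h23 := rpow_third_sq N
  have hc3 := rpow_third_cube N
  set T := (N : ℝ) ^ (1 / 3 : ℝ) with hT
  set α := flatVec N (subsetSize N) 2 with hα
  have hT0 : 0 < T := by positivity
  have h10 : 10 ≤ T := by
    refine le_of_pow_le_pow_left₀ (n := 3) (by norm_num) hT0.le ?_
    rw [hc3]; linarith
  have hα0 : 0 < α := by
    by_contra! h
    nlinarith
  set ψ := reducedState N with hψ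
  -- The coefficient T² = N^{2/3} undoes the scaling of the Laplacian, so the Johnson part of H w is
  -- e₂ - L y = αs. Only T² y₂ ≤ 1/T in modulus remains at |B₂⟩.
  set w := liftVec (T ^ 2 • y) 1 with hw
  have hσ := reducedHamiltonian_mulVec_startVec h5
  have hHw : reducedHamiltonian N *ᵥ toC w = toC (liftVec (α • flatVec N (subsetSize N)) (T ^ 2 * y 2)) := by
    rw [hw, reducedHamiltonian_mulVec_liftVec, Matrix.mulVec_smul, hy1, ← h23, smul_smul,
      one_div, inv_mul_cancel₀ (by positivity)]
    congr 2
    · module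
  have hd1 : ∀ t, HasDerivAt (fun t => toC (startVec N) ⬝ᵥ ψ t)
      (-Complex.I * (α * ψ t (Fin.last 3))) t := fun t => by
    have := hasDerivAt_evolution (reducedHamiltonian N) (toC (startVec N)) (toC (startVec N)) t
    rw [dotProduct_reducedHamiltonian_mulVec, hσ, liftVec_dotProduct_toC] at this
    refine this.congr_deriv ?_
    simp [-Fin.reduceLast, hψ, reducedState, hα]
  have hd2 : ∀ t, HasDerivAt (fun t => toC w ⬝ᵥ ψ t)
      (-Complex.I * (α * (toC (startVec N) ⬝ᵥ ψ t) + (T ^ 2 * y 2 : ℝ) * ψ t (Fin.last 3))) t :=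
    fun t => by
    have := hasDerivAt_evolution (reducedHamiltonian N) (toC w) (toC (startVec N)) t
    rw [dotProduct_reducedHamiltonian_mulVec, hHw, liftVec_dotProduct_toC] at this
    refine this.congr_deriv ?_
    have hs : toC (startVec N) ⬝ᵥ ψ t = ∑ i, (flatVec N (subsetSize N) i : ℂ) * ψ t i.castSucc := by
      rw [startVec, liftVec_dotProduct_toC]
      simp
    rw [hs, Finset.mul_sum]
    simp only [Pi.smul_apply, smul_eq_mul, Complex.ofReal_mul, mul_assoc]
    rfl
  have hψ0 : ψ 0 = toC (startVec N) := by
    rw [hψ, reducedState, evolution_zero, Matrix.one_mulVec]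
  have hyy : |T ^ 2 * y 2| * T ≤ 1 := by
    have h : y 2 ^ 2 ≤ y ⬝ᵥ y := by
      simp only [dotProduct, Fin.sum_univ_three]
      nlinarith [mul_self_nonneg (y 0), mul_self_nonneg (y 1)]
    have h' : |y 2| * N ≤ 1 := by
      refine le_of_pow_le_pow_left₀ (n := 2) (by norm_num) zero_le_one ?_
      rw [mul_pow, sq_abs]
      nlinarith [sq_nonneg (N : ℝ)]
    rw [abs_mul, abs_of_nonneg (by positivity)]
    calc T ^ 2 * |y 2| * T = |y 2| * T ^ 3 := by ring
      _ ≤ 1 := by rw [hc3]; exact h'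
  have hg1 : ∀ t ∈ Set.Icc 0 T, ‖toC (startVec N) ⬝ᵥ ψ t - 1‖ ≤ α * (1 / 20) * (t - 0) := by
    have hh := norm_image_sub_le_of_norm_deriv_le_segment' (f := fun t => toC (startVec N) ⬝ᵥ ψ t)
      (f' := fun t => -Complex.I * (α * ψ t (Fin.last 3))) (C := α * (1 / 20)) (a := 0) (b := T)
      (fun t _ => (hd1 t).hasDerivWithinAt) (fun t ht => by
        rw [norm_mul, norm_neg, Complex.norm_I, one_mul, norm_mul, Complex.norm_real,
          Real.norm_of_nonneg hα0.le]
        gcongr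
        exact (hcon t ht.1 ht.2.le).le)
    intro t ht
    have := hh t ht
    simp only [hψ0, toC_dotProduct, startVec_dotProduct_self h5] at this
    simpa using this
  have hg2 : ‖(toC w ⬝ᵥ ψ T + Complex.I * α * T) - (toC w ⬝ᵥ ψ 0 + Complex.I * α * (0 : ℝ))‖ ≤
      (α * (α * (1 / 20) * T) + |T ^ 2 * y 2| * (1 / 20)) * (T - 0) := by
    refine norm_image_sub_le_of_norm_deriv_le_segment'
      (f := fun t : ℝ => toC w ⬝ᵥ ψ t + Complex.I * α * t)
      (f' := fun t => -Complex.I * (α * (toC (startVec N) ⬝ᵥ ψ t) +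
        (T ^ 2 * y 2 : ℝ) * ψ t (Fin.last 3)) + Complex.I * α)
      (fun t _ => ?_) (fun t ht => ?_) T ⟨hT0.le, le_rfl⟩
    · refine ((hd2 t).add ?_).hasDerivWithinAt
      simpa using (Complex.ofRealCLM.hasDerivAt (x := t)).const_mul (Complex.I * α)
    · have e : -Complex.I * (α * (toC (startVec N) ⬝ᵥ ψ t) +
          (T ^ 2 * y 2 : ℝ) * ψ t (Fin.last 3)) + Complex.I * α =
          -Complex.I * (α * (toC (startVec N) ⬝ᵥ ψ t - 1) +
            (T ^ 2 * y 2 : ℝ) * ψ t (Fin.last 3)) := by ring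
      rw [e, norm_mul, norm_neg, Complex.norm_I, one_mul]
      refine (norm_add_le _ _).trans ?_
      rw [norm_mul, norm_mul, Complex.norm_real, Complex.norm_real, Real.norm_of_nonneg hα0.le,
        Real.norm_eq_abs]
      gcongr
      · refine (hg1 t ⟨ht.1, ht.2.le⟩).trans ?_
        rw [sub_zero]
        gcongr
        exact ht.2.le
      · exact (hcon t ht.1 ht.2.le).le
  have hw0 : toC w ⬝ᵥ ψ 0 = 0 := by
    rw [hψ0, toC_dotProduct, hw, startVec, liftVec_dotProduct, smul_dotProduct, dotProduct_comm, hy0]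
    simp
  have hwT : ‖toC w ⬝ᵥ ψ T‖ ≤ 1 / 20 + 1 / 10 := by
    have e : toC w ⬝ᵥ ψ T = toC (liftVec (T ^ 2 • y) 0) ⬝ᵥ ψ T + ψ T (Fin.last 3) := by
      rw [hw, liftVec_dotProduct_toC, liftVec_dotProduct_toC]
      simp
    rw [e]
    refine (norm_add_le _ _).trans ?_
    rw [add_comm]
    gcongr
    · exact (hcon T hT0.le le_rfl).le
    · refine le_of_pow_le_pow_left₀ (n := 2) (by norm_num) (by norm_num) ?_
      refine (norm_sq_dotProduct_le _ _).trans ?_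
      rw [hψ, normSq_reducedState h5, liftVec_dotProduct, smul_dotProduct, dotProduct_smul]
      simp only [smul_eq_mul, mul_one, mul_zero, add_zero]
      rw [← hc3] at hy2
      have h6 : T ^ 2 * (T ^ 2 * (T ^ 2 * (y ⬝ᵥ y))) ≤ 1 := by
        calc _ = (T ^ 3) ^ 2 * (y ⬝ᵥ y) := by ring
          _ ≤ 1 := hy2
      have h7 : 0 ≤ T ^ 2 * (T ^ 2 * (y ⬝ᵥ y)) := by
        have : 0 ≤ y ⬝ᵥ y := by
          simp only [dotProduct]; exact Finset.sum_nonneg fun i _ => mul_self_nonneg _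
        positivity
      nlinarith [mul_nonneg h7 (show 0 ≤ T ^ 2 - 100 by nlinarith)]
  rw [hw0] at hg2
  have h7 : α * T ≤ ‖toC w ⬝ᵥ ψ T + Complex.I * α * T‖ + ‖toC w ⬝ᵥ ψ T‖ := by
    have := norm_sub_le (toC w ⬝ᵥ ψ T + Complex.I * α * T) (toC w ⬝ᵥ ψ T)
    rw [add_sub_cancel_left, norm_mul, norm_mul, Complex.norm_I, Complex.norm_real,
      Complex.norm_real, Real.norm_of_nonneg hα0.le, Real.norm_of_nonneg hT0.le, one_mul] at this
    exact this
  simp only [Complex.ofReal_zero, mul_zero, add_zero, sub_zero] at hg2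
  -- The final balance: 1/2 ≤ αT ≤ (αT)²/20 + 1/20 + 1/20 + 1/10 ≤ 2/5, a contradiction.
  have h8 : (α * T) * (α * T) ≤ 2 * 2 := by gcongr
  nlinarith

end reduced

end EDWalk

namespace EDWalk

/-! ### The spectral gap confines the evolution to a plane. -/

section span

variable {N : ℕ}

theorem normSq_eq_re_add_im {ι : Type*} [Fintype ι] (z : ι → ℂ) :
    normSq z = (fun i => (z i).re) ⬝ᵥ (fun i => (z i).re) + (fun i => (z i).im) ⬝ᵥ (fun i => (z i).im) := by
  simp only [normSq, dotProduct, ← Finset.sum_add_distrib, Complex.sq_norm, Complex.normSq_apply]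

theorem reducedLaplacian_gap_real {n M : ℝ} (hM : 1 ≤ M) (hn : M + 1 ≤ n) (h2 : 2 < n)
    (v : Fin 3 → ℝ) :
    n ^ 2 * (v ⬝ᵥ v - (flatVec n M ⬝ᵥ v) ^ 2) ≤
      (reducedLaplacian n M *ᵥ v) ⬝ᵥ (reducedLaplacian n M *ᵥ v) := by
  have hs := flatVec_dot_self hM hn h2
  have h := reducedLaplacian_gap hM hn h2 (v - (flatVec n M ⬝ᵥ v) • flatVec n M) (by
    rw [dotProduct_sub, dotProduct_smul, hs]; simp)
  have hX : reducedLaplacian n M *ᵥ flatVec n M = 0 := by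
    rw [reducedLaplacian_mulVec hM hn h2, hs, dotProduct_comm, flatVec_dot_topVec]; simp
  rw [Matrix.mulVec_sub, Matrix.mulVec_smul, hX, smul_zero, sub_zero] at h
  refine le_of_eq_of_le ?_ h
  simp only [sub_dotProduct, dotProduct_sub, smul_dotProduct, dotProduct_smul, hs, smul_eq_mul,
    dotProduct_comm v (flatVec n M)]
  ring

theorem reducedLaplacian_gap_complex {n M : ℝ} (hM : 1 ≤ M) (hn : M + 1 ≤ n) (h2 : 2 < n)
    (z : Fin 3 → ℂ) :
    n ^ 2 * (normSq z - ‖toC (flatVec n M) ⬝ᵥ z‖ ^ 2) ≤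
      normSq ((reducedLaplacian n M).map (fun r : ℝ => (r : ℂ)) *ᵥ z) := by
  have h3 := reducedLaplacian_gap_real hM hn h2 (fun i => (z i).re)
  have h4 := reducedLaplacian_gap_real hM hn h2 (fun i => (z i).im)
  have e1 : (fun i => (((reducedLaplacian n M).map (fun r : ℝ => (r : ℂ)) *ᵥ z) i).re) =
      reducedLaplacian n M *ᵥ (fun i => (z i).re) := by
    funext i; simp [Matrix.mulVec, dotProduct]
  have e2 : (fun i => (((reducedLaplacian n M).map (fun r : ℝ => (r : ℂ)) *ᵥ z) i).im) =
      reducedLaplacian n M *ᵥ (fun i => (z i).im) := by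
    funext i; simp [Matrix.mulVec, dotProduct]
  have e3 : ‖toC (flatVec n M) ⬝ᵥ z‖ ^ 2 = (flatVec n M ⬝ᵥ (fun i => (z i).re)) ^ 2 +
      (flatVec n M ⬝ᵥ (fun i => (z i).im)) ^ 2 := by
    rw [Complex.sq_norm, Complex.normSq_apply, ← sq, ← sq]
    simp [dotProduct, toC]
  rw [normSq_eq_re_add_im, normSq_eq_re_add_im, e1, e2, e3]
  linarith

/-- The walk remains close to the span of the start vector and `B₂`. -/
theorem one_sub_le_reducedState (hN : 1000 ≤ N) (t : ℝ) :
    1 - 9 / (N : ℝ) ^ (2 / 3 : ℝ) ≤ ‖toC (startVec N) ⬝ᵥ reducedState N t‖ ^ 2 +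
      ‖reducedState N t (Fin.last 3)‖ ^ 2 := by
  have h5 : 5 ≤ N := by omega
  obtain ⟨h1, h2, h3⟩ := real_bounds h5
  obtain ⟨ha1, ha2⟩ := flatVec_two_mul_bounds hN
  have h23 := rpow_third_sq N
  have hc3 := rpow_third_cube N
  have hN' : (1000 : ℝ) ≤ N := by exact_mod_cast hN
  set T := (N : ℝ) ^ (1 / 3 : ℝ) with hT
  have hT0 : 0 < T := by positivity
  have h10 : 10 ≤ T := by
    refine le_of_pow_le_pow_left₀ (n := 3) (by norm_num) hT0.le ?_
    rw [hc3]; linarith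
  set α := flatVec N (subsetSize N) 2 with hα
  have hα0 : 0 < α := by
    by_contra! h
    nlinarith
  have hα1 : α ≤ 1 := by nlinarith
  set ψ := reducedState N t with hψ
  have hn := normSq_reducedState h5 t
  rw [← hψ] at hn
  have hsplit : ∀ z : Fin 4 → ℂ, normSq z = normSq (fun i : Fin 3 => z i.castSucc) +
      ‖z (Fin.last 3)‖ ^ 2 := fun z => by rw [normSq, normSq, Fin.sum_univ_castSucc]
  set z : Fin 3 → ℂ := fun i => ψ i.castSucc with hz
  -- H commutes with its evolution, so ‖Hψ(t)‖ keeps its initial value ‖H s‖ = α.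
  have hH : normSq (reducedHamiltonian N *ᵥ ψ) = α ^ 2 := by
    rw [hψ, reducedState, Matrix.mulVec_mulVec, mul_evolution, ← Matrix.mulVec_mulVec,
      normSq_mulVec_of_isometry (evolution_isometry (reducedHamiltonian_isHermitian N) t),
      reducedHamiltonian_mulVec_startVec h5, normSq_toC, liftVec_dotProduct]
    simp [sq, hα]
  have hgap := reducedLaplacian_gap_complex (n := N) (M := subsetSize N) (by linarith)
    (by linarith) (by linarith) z
  have hlast : ‖ψ (Fin.last 3)‖ ^ 2 ≤ 1 := by
    have := hsplit ψ
    have h0 := normSq_nonneg (fun i : Fin 3 => ψ i.castSucc)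
    linarith
  have hX : normSq ((reducedLaplacian N (subsetSize N)).map (fun r : ℝ => (r : ℂ)) *ᵥ z) ≤
      T ^ 4 * 4 := by
    -- Solving the Johnson rows of Hψ for L z: both terms on the right are bounded, so ‖L z‖² ≤ 4T⁴.
    -- The gap T³ then bounds the part of z off the uniform vector by 4/T² in squared norm.
    have e : (reducedLaplacian N (subsetSize N)).map (fun r : ℝ => (r : ℂ)) *ᵥ z =
        ((T ^ 2 : ℝ) : ℂ) • ((fun i => if i = 2 then ψ (Fin.last 3) else 0) +
          (-1 : ℂ) • fun i : Fin 3 => (reducedHamiltonian N *ᵥ ψ) i.castSucc) := by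
      funext i
      have hT2 : ((T ^ 2 : ℝ) : ℂ) ≠ 0 := by exact_mod_cast (by positivity : T ^ 2 ≠ 0)
      simp only [Matrix.mulVec, dotProduct, Matrix.map_apply, Pi.smul_apply, Pi.add_apply,
        Fin.sum_univ_castSucc (n := 3) (f := fun j => reducedHamiltonian N i.castSucc j * ψ j),
        reducedHamiltonian_castSucc, reducedHamiltonian_castSucc_last, ← h23, smul_eq_mul]
      rw [mul_add, mul_left_comm, mul_add, Finset.mul_sum, one_div, Complex.ofReal_inv]
      have : ∀ j : Fin 3, ((T ^ 2 : ℝ) : ℂ) * (-((T ^ 2 : ℝ) : ℂ)⁻¹ *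
          (reducedLaplacian N (subsetSize N) i j : ℂ) * ψ j.castSucc) =
          -((reducedLaplacian N (subsetSize N) i j : ℂ) * z j) := fun j => by
        rw [hz]; field_simp
      simp only [this, Finset.sum_neg_distrib]
      by_cases hi : i = 2
      · rw [if_pos hi, if_pos hi]; ring
      · rw [if_neg hi, if_neg hi]; ring
    rw [e, normSq_smul, Complex.norm_real, Real.norm_of_nonneg (by positivity)]
    have h6 := normSq_add_le (fun i : Fin 3 => if i = 2 then ψ (Fin.last 3) else 0)
      ((-1 : ℂ) • fun i : Fin 3 => (reducedHamiltonian N *ᵥ ψ) i.castSucc)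
    rw [normSq_smul, norm_neg, norm_one, one_pow, one_mul] at h6
    have h7 : normSq (fun i : Fin 3 => if i = 2 then ψ (Fin.last 3) else 0) =
        ‖ψ (Fin.last 3)‖ ^ 2 := by
      simp [normSq, Fin.sum_univ_three, -Fin.reduceLast]
    have h8 := hsplit (reducedHamiltonian N *ᵥ ψ)
    rw [hH] at h8
    have h9 : α ^ 2 ≤ 1 := by nlinarith
    calc _ = T ^ 4 * _ := by rw [← pow_mul]
      _ ≤ _ := by
        gcongr
        refine h6.trans ?_
        nlinarith [sq_nonneg ‖(reducedHamiltonian N *ᵥ ψ) (Fin.last 3)‖]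
  have h6 := hsplit ψ
  rw [hn] at h6
  have h7 : toC (startVec N) ⬝ᵥ ψ = toC (flatVec N (subsetSize N)) ⬝ᵥ z := by
    rw [startVec, liftVec_dotProduct_toC]
    simp [toC, dotProduct, hz]
  rw [h7]
  rw [← hc3] at hgap
  have h8 : T ^ 4 * (T ^ 2 * (normSq z - ‖toC (flatVec (T ^ 3) (subsetSize N)) ⬝ᵥ z‖ ^ 2)) ≤
      T ^ 4 * 4 := by
    rw [hc3]
    rw [hc3] at hgap
    refine le_trans (le_of_eq ?_) (hgap.trans hX)
    rw [← hc3]; ring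
  rw [hc3] at h8
  have h9 := le_of_mul_le_mul_left h8 (by positivity)
  rw [← h23]
  have h10 : normSq z - ‖toC (flatVec N (subsetSize N)) ⬝ᵥ z‖ ^ 2 ≤ 9 / T ^ 2 := by
    rw [le_div_iff₀ (by positivity)]
    linarith
  linarith

end span

/-! ### From the reduced space to the walk -/

section transfer

variable {N m M : ℕ}

/-- The two edge counts fix the ratios of the three class sizes, and these sum to the number of
subsets. No binomial coefficients are needed. -/
theorem card_pairClass_eq {x y : Fin N} (hxy : x ≠ y) (h1 : (2 : ℝ) ≤ M) (h2 : (M : ℝ) + 2 ≤ N)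
    (j : Fin 3) :
    ((pairClass M x y j).card : ℝ) = flatVec N M j ^ 2 * Fintype.card (Subsets N M) := by
  have e0 := card_pairClass_zero (M := M) hxy
  have e1 := card_pairClass_one (M := M) hxy
  have hC : (Fintype.card (Subsets N M) : ℝ) = (pairClass M x y 0).card +
      (pairClass M x y 1).card + (pairClass M x y 2).card := by
    have : (Finset.univ : Finset (Subsets N M)) =
        (pairClass M x y 0 ∪ pairClass M x y 1) ∪ pairClass M x y 2 := by
      ext s
      have := pairCount_le_two x y s.1
      simp only [Finset.mem_univ, Finset.mem_union, mem_pairClass, true_iff]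
      omega
    rw [← Finset.card_univ, this, Finset.card_union_of_disjoint, Finset.card_union_of_disjoint]
    · push_cast; ring
    · rw [Finset.disjoint_left]; intro s; simp only [mem_pairClass]; omega
    · rw [Finset.disjoint_left]; intro s; simp only [Finset.mem_union, mem_pairClass]; omega
  have hn : (0 : ℝ) < N * (N - 1) := by nlinarith
  have f0 : flatVec N M 0 ^ 2 = (N - M) * (N - M - 1) / (N * (N - 1)) := by
    change (√((N : ℝ) - M) * √((N : ℝ) - M - 1) / √((N : ℝ) * (N - 1))) ^ 2 = _
    rw [div_pow, mul_pow, Real.sq_sqrt (by linarith), Real.sq_sqrt (by linarith), Real.sq_sqrt hn.le]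
  have f1 : flatVec N M 1 ^ 2 = 2 * M * (N - M) / (N * (N - 1)) := by
    change (√2 * √(M : ℝ) * √((N : ℝ) - M) / √((N : ℝ) * (N - 1))) ^ 2 = _
    rw [div_pow, mul_pow, mul_pow, Real.sq_sqrt (by linarith), Real.sq_sqrt (by linarith),
      Real.sq_sqrt hn.le, Real.sq_sqrt (by linarith)]
  have f2 : flatVec N M 2 ^ 2 = M * (M - 1) / (N * (N - 1)) := by
    change (√(M : ℝ) * √((M : ℝ) - 1) / √((N : ℝ) * (N - 1))) ^ 2 = _
    rw [div_pow, mul_pow, Real.sq_sqrt (by linarith), Real.sq_sqrt (by linarith), Real.sq_sqrt hn.le]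
  have hc1 : ((pairClass M x y 1).card : ℝ) = (pairClass M x y 2).card * (2 * (N - M)) / (M - 1) := by
    rw [← e1, mul_div_cancel_right₀]; linarith
  have hc0 : ((pairClass M x y 0).card : ℝ) =
      (pairClass M x y 1).card * (N - M - 1) / (2 * M) := by
    rw [← e0, mul_div_cancel_right₀]; linarith
  have hM0 : (M : ℝ) ≠ 0 := by linarith
  have hM1 : (M : ℝ) - 1 ≠ 0 := by linarith
  have hN0 : (N : ℝ) ≠ 0 := by linarith
  have hN1 : (N : ℝ) - 1 ≠ 0 := by linarith
  rw [hC, hc0, hc1]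
  fin_cases j
  · change ((pairClass M x y 0).card : ℝ) = flatVec N M 0 ^ 2 * _
    rw [f0, hc0, hc1]; field_simp; ring
  · change ((pairClass M x y 1).card : ℝ) = flatVec N M 1 ^ 2 * _
    rw [f1, hc1]; field_simp; ring
  · change ((pairClass M x y 2).card : ℝ) = flatVec N M 2 ^ 2 * _
    rw [f2]; field_simp; ring

theorem flatVec_pos {n M : ℝ} (h1 : 2 ≤ M) (h2 : M + 2 ≤ n) (j : Fin 3) : 0 < flatVec n M j := by
  have hn : 0 < √(n * (n - 1)) := Real.sqrt_pos.2 (by nlinarith)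
  have a1 : 0 < √M := Real.sqrt_pos.2 (by linarith)
  have a2 : 0 < √(M - 1) := Real.sqrt_pos.2 (by linarith)
  have a3 : 0 < √(n - M) := Real.sqrt_pos.2 (by linarith)
  have a4 : 0 < √(n - M - 1) := Real.sqrt_pos.2 (by linarith)
  fin_cases j <;> simp only [flatVec] <;> simp <;> positivity

theorem card_subsets_pos (h : M ≤ N) : 0 < Fintype.card (Subsets N M) := by
  obtain ⟨s, hs⟩ := Finset.exists_subset_card_eq (s := (Finset.univ : Finset (Fin N))) (n := M)
    (by simpa using h)
  exact Fintype.card_pos_iff.2 ⟨⟨s, hs.2⟩⟩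

theorem card_pairClass_pos {x y : Fin N} (hxy : x ≠ y) (h1 : (2 : ℝ) ≤ M) (h2 : (M : ℝ) + 2 ≤ N)
    (j : Fin 3) : 0 < (pairClass M x y j).card := by
  have h := card_pairClass_eq hxy h1 h2 j
  have h3 := flatVec_pos h1 h2 j
  have h4 : (0 : ℝ) < Fintype.card (Subsets N M) := by
    have : (M : ℝ) ≤ N := by linarith
    exact_mod_cast card_subsets_pos (by exact_mod_cast this)
  have : (0 : ℝ) < (pairClass M x y j).card := by rw [h]; positivity
  exact_mod_cast this

theorem uniformOn_univ_eq_sum {x y : Fin N} (hxy : x ≠ y) (h1 : (2 : ℝ) ≤ M)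
    (h2 : (M : ℝ) + 2 ≤ N) (s : Subsets N M) :
    uniformOn Finset.univ s = ∑ j : Fin 3, (flatVec N M j : ℂ) * classVec M x y j s := by
  have hlt : pairCount x y s.1 < 3 := by have := pairCount_le_two x y s.1; omega
  rw [Finset.sum_eq_single (⟨pairCount x y s.1, hlt⟩ : Fin 3)]
  · rw [classVec, uniformOn_apply, uniformOn_apply, if_pos (Finset.mem_univ _),
      if_pos (mem_pairClass.2 rfl), card_pairClass_eq hxy h1 h2, ← Complex.ofReal_mul,
      Finset.card_univ]
    congr 1
    have h3 := flatVec_pos h1 h2 ⟨pairCount x y s.1, hlt⟩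
    rw [Real.sqrt_mul (by positivity), Real.sqrt_sq h3.le]
    field_simp
  · intro j _ hj
    rw [classVec, uniformOn_apply, if_neg, mul_zero]
    rw [mem_pairClass]
    exact fun h => hj (Fin.ext h.symm)
  · exact fun h => absurd (Finset.mem_univ _) h

theorem normSq_uniformOn {ι : Type*} [Fintype ι] [DecidableEq ι] {A : Finset ι} (hA : 0 < A.card) :
    normSq (uniformOn A) = 1 := by
  have : ∀ i, ‖uniformOn A i‖ ^ 2 = if i ∈ A then 1 / (A.card : ℝ) else 0 := fun i => by
    rw [uniformOn_apply]
    split_ifs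
    · rw [Complex.norm_real, Real.norm_eq_abs, sq_abs, div_pow, Real.sq_sqrt (by positivity), one_pow]
    · simp
  simp only [normSq, this, Finset.sum_ite_mem, Finset.univ_inter, Finset.sum_const, nsmul_eq_mul]
  rw [mul_one_div_cancel]
  exact_mod_cast hA.ne'

theorem star_uniformOn_dotProduct_of_disjoint {ι : Type*} [Fintype ι] [DecidableEq ι]
    {A B : Finset ι} (h : Disjoint A B) : star (uniformOn A) ⬝ᵥ uniformOn B = 0 := by
  refine Finset.sum_eq_zero fun i _ => ?_
  rw [Pi.star_apply, uniformOn_apply, uniformOn_apply]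
  by_cases hi : i ∈ A
  · rw [if_neg (Finset.disjoint_left.1 h hi), mul_zero]
  · rw [if_neg hi, star_zero, zero_mul]

theorem disjoint_classA (f : Fin N → Fin m) (x y : Fin N) {i j : ℕ} (h : i ≠ j) :
    Disjoint (classA f x y i) (classA f x y j) := by
  rw [classA_eq, classA_eq, Finset.disjoint_map, Finset.disjoint_left]
  intro s hs hs'
  exact h ((mem_pairClass.1 hs).symm.trans (mem_pairClass.1 hs'))

theorem disjoint_classA_pendantVertices (f : Fin N → Fin m) (x y : Fin N) (i : ℕ) :
    Disjoint (classA f x y i) (pendantVertices f) := by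
  rw [Finset.disjoint_left]
  intro v hv hv'
  rw [classA_eq, Finset.mem_map] at hv
  obtain ⟨s, _, rfl⟩ := hv
  simp [pendantVertices] at hv'

theorem reducedBasis_isometry (hN : 5 ≤ N) {f : Fin N → Fin m} {x y : Fin N}
    (h : UniqueCollision f x y) : (reducedBasis f x y)ᴴ * reducedBasis f x y = 1 := by
  obtain ⟨h1, h2, h3⟩ := real_bounds hN
  let A : Fin 4 → Finset (WalkVertex f) :=
    ![classA f x y 0, classA f x y 1, classA f x y 2, pendantVertices f]
  have hA : ∀ j : Fin 4, (fun v => reducedBasis f x y v j) = uniformOn (A j) := by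
    intro j; fin_cases j <;> rfl
  have hc : ∀ j : Fin 3, 0 < (classA f x y j).card := fun j => by
    rw [classA_eq, Finset.card_map]
    exact card_pairClass_pos h.1 h1 h2 j
  have hcard : ∀ j, 0 < (A j).card := by
    intro j
    fin_cases j
    · exact hc 0
    · exact hc 1
    · exact hc 2
    · change 0 < (pendantVertices f).card
      rw [card_pendantVertices h]
      exact card_pairClass_pos h.1 h1 h2 2
  have hdis : ∀ i j, i ≠ j → Disjoint (A i) (A j) := by
    have d01 : Disjoint (A 0) (A 1) := disjoint_classA f x y (by decide)
    have d02 : Disjoint (A 0) (A 2) := disjoint_classA f x y (by decide)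
    have d12 : Disjoint (A 1) (A 2) := disjoint_classA f x y (by decide)
    have d03 : Disjoint (A 0) (A 3) := disjoint_classA_pendantVertices f x y 0
    have d13 : Disjoint (A 1) (A 3) := disjoint_classA_pendantVertices f x y 1
    have d23 : Disjoint (A 2) (A 3) := disjoint_classA_pendantVertices f x y 2
    intro i j hij
    fin_cases i <;> fin_cases j <;>
      first
      | exact absurd rfl hij
      | assumption
      | (exact Disjoint.symm (by assumption))
  ext i j
  have e : ((reducedBasis f x y)ᴴ * reducedBasis f x y) i j =
      star (fun v => reducedBasis f x y v i) ⬝ᵥ fun v => reducedBasis f x y v j := by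
    simp [Matrix.mul_apply, dotProduct]
  rw [e, hA, hA]
  by_cases hij : i = j
  · subst hij
    rw [star_dotProduct_self, normSq_uniformOn (hcard i), Matrix.one_apply_eq, Complex.ofReal_one]
  · rw [star_uniformOn_dotProduct_of_disjoint (hdis i j hij), Matrix.one_apply_ne hij]

theorem uniformOn_originalVertices_inl (f : Fin N → Fin m) (s : Subsets N (subsetSize N)) :
    uniformOn (originalVertices f) (Sum.inl s) = uniformOn Finset.univ s := by
  have e : originalVertices f = (Finset.univ : Finset (Subsets N (subsetSize N))).map
      Function.Embedding.inl := by
    ext v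
    rcases v with s | b <;> simp [originalVertices]
  rw [uniformOn_apply, uniformOn_apply, e, Finset.card_map, if_pos, if_pos (Finset.mem_univ _)]
  exact Finset.mem_map_of_mem _ (Finset.mem_univ _)

theorem uniformOn_originalVertices_inr (f : Fin N → Fin m)
    (b : {s : Subsets N (subsetSize N) // Marked f s}) :
    uniformOn (originalVertices f) (Sum.inr b) = 0 := by
  rw [uniformOn_apply, if_neg]
  simp [originalVertices]

theorem uniformOn_originalVertices (hN : 5 ≤ N) {f : Fin N → Fin m} {x y : Fin N}
    (h : UniqueCollision f x y) :
    uniformOn (originalVertices f) = reducedBasis f x y *ᵥ toC (startVec N) := by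
  obtain ⟨h1, h2, h3⟩ := real_bounds hN
  funext v
  rw [Matrix.mulVec, dotProduct, Fin.sum_univ_castSucc]
  rcases v with s | b
  · rw [uniformOn_originalVertices_inl, uniformOn_univ_eq_sum h.1 h1 h2]
    simp only [reducedBasis_inl_castSucc, reducedBasis_inl_last, zero_mul, add_zero]
    refine Finset.sum_congr rfl fun j _ => ?_
    rw [mul_comm, toC, startVec, liftVec, Fin.snoc_castSucc]
  · rw [uniformOn_originalVertices_inr]
    simp only [reducedBasis_inr_castSucc, zero_mul, Finset.sum_const_zero, zero_add, toC, startVec,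
      liftVec, Fin.snoc_last, Complex.ofReal_zero, mul_zero]

/-- Intertwining passes to the exponential, so the state at each time is the image of a vector that
depends on N and t alone. -/
theorem walkState_eq (hN : 5 ≤ N) {f : Fin N → Fin m} {x y : Fin N}
    (h : UniqueCollision f x y) (t : ℝ) :
    walkState f t = reducedBasis f x y *ᵥ reducedState N t := by
  rw [walkState, uniformOn_originalVertices hN h, reducedState, Matrix.mulVec_mulVec,
    Matrix.mulVec_mulVec]
  congr 1
  refine exp_mul_of_intertwine ?_
  rw [Matrix.smul_mul, walkHamiltonian_mul_reducedBasis f x y h, Matrix.mul_smul]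

theorem star_pendantVertices_dotProduct_walkState (hN : 5 ≤ N) {f : Fin N → Fin m} {x y : Fin N}
    (h : UniqueCollision f x y) (t : ℝ) :
    star (uniformOn (pendantVertices f)) ⬝ᵥ walkState f t = reducedState N t (Fin.last 3) := by
  have e : uniformOn (pendantVertices f) = reducedBasis f x y *ᵥ Pi.single (Fin.last 3) 1 := by
    rw [Matrix.mulVec_single_one]
    rfl
  rw [e, walkState_eq hN h, star_mulVec_dotProduct, Matrix.mulVec_mulVec,
    reducedBasis_isometry hN h, Matrix.one_mulVec]
  simp [dotProduct, Pi.single_apply, -Fin.reduceLast]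

theorem constant_overlap : ∃ c > (0 : ℝ), ∃ C > (0 : ℝ), ∃ N₀ : ℕ, ∀ N : ℕ, N₀ ≤ N →
      ∃ t : ℝ, 0 ≤ t ∧ t ≤ C * (N : ℝ) ^ (1 / 3 : ℝ) ∧
        ∀ (m : ℕ) (f : Fin N → Fin m) (x y : Fin N), UniqueCollision f x y →
          c ≤ ‖star (uniformOn (pendantVertices f)) ⬝ᵥ walkState f t‖ := by
  refine ⟨1 / 20, by norm_num, 1, one_pos, 1000, fun N hN => ?_⟩
  obtain ⟨t, h0, h1, h2⟩ := exists_time_overlap_pendant hN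
  refine ⟨t, h0, by rwa [one_mul], fun m f x y h => ?_⟩
  rwa [star_pendantVertices_dotProduct_walkState (by omega) h]

end transfer

end EDWalk

namespace EDWalk

set_option linter.unusedSectionVars false

/-! ### Gates -/

/-- The state space with basis `I`. -/
abbrev Hil (I : Type*) [Fintype I] : Type _ := EuclideanSpace ℂ I

/-- The unitary operators of the state space with basis `I`. -/
abbrev Gate (I : Type*) [Fintype I] : Type _ := Hil I ≃ₗᵢ[ℂ] Hil I

section gates

variable {I : Type*} [Fintype I] [DecidableEq I]

/-- The basis state `|i⟩`. -/
noncomputable def ket (i : I) : Hil I := EuclideanSpace.single i 1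

theorem ket_apply (i j : I) : ket i j = if j = i then 1 else 0 := by
  simp [ket]

theorem inner_ket_left (i : I) (v : Hil I) : inner ℂ (ket i) v = v i := by
  simp [ket, EuclideanSpace.inner_single_left]

theorem norm_ket (i : I) : ‖ket i‖ = 1 := by
  simp [ket]

theorem orthonormal_ket : Orthonormal ℂ (ket : I → Hil I) :=
  EuclideanSpace.orthonormal_single

theorem eq_sum_ket (v : Hil I) : v = ∑ i, v i • ket i := by
  ext j
  simp [ket_apply, Finset.sum_apply]

/-- The gate that permutes the basis states. -/
noncomputable def permGate (e : Equiv.Perm I) : Gate I :=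
  LinearIsometryEquiv.piLpCongrLeft 2 ℂ ℂ e

theorem permGate_apply (e : Equiv.Perm I) (v : Hil I) (i : I) : permGate e v i = v (e.symm i) := rfl

theorem permGate_ket (e : Equiv.Perm I) (i : I) : permGate e (ket i) = ket (e i) := by
  ext j
  rw [permGate_apply, ket_apply, ket_apply]
  simp only [Equiv.symm_apply_eq]

theorem permGate_mul {I : Type*} [Fintype I] (e e' : Equiv.Perm I) : permGate (e * e') = permGate e * permGate e' := by
  ext v i
  rfl

/-- The unitary matrix of a gate. -/
noncomputable def gateMatrix (V : Gate I) : Matrix.unitaryGroup I ℂ :=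
  ⟨Matrix.of fun i j => V (ket j) i, by
    rw [Matrix.mem_unitaryGroup_iff']
    ext i j
    have h : inner ℂ (V (ket i)) (V (ket j)) = inner ℂ (ket i) (ket j : Hil I) := V.inner_map_map _ _
    rw [inner_ket_left, ket_apply, PiLp.inner_apply] at h
    rw [Matrix.mul_apply, Matrix.one_apply, ← h]
    refine Finset.sum_congr rfl fun k _ => ?_
    simp [Matrix.star_apply, mul_comm]⟩

theorem gateMatrix_mulVec (V : Gate I) (v : I → ℂ) :
    (gateMatrix V).1 *ᵥ v = (V (WithLp.toLp 2 v)).ofLp := by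
  funext i
  conv_rhs => rw [eq_sum_ket (WithLp.toLp 2 v)]
  simp [gateMatrix, Matrix.mulVec, dotProduct, mul_comm]

end gates

/-- Some gate maps a given orthonormal family to another one. -/
theorem exists_gate_of_orthonormal {I ι : Type*} [Fintype I] [Fintype ι] {u v : ι → Hil I}
    (hu : Orthonormal ℂ u) (hv : Orthonormal ℂ v) : ∃ V : Gate I, ∀ i, V (u i) = v i := by
  classical
  have key : ∀ {w : ι → Hil I}, Orthonormal ℂ w →
      ∃ A : EuclideanSpace ℂ ι →ₗᵢ[ℂ] Hil I, ∀ i, A (ket i) = w i := by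
    intro w hw
    let b := EuclideanSpace.basisFun ι ℂ
    have hb : ∀ i, (b.toBasis.constr ℂ w) (b.toBasis i) = w i := fun i =>
      b.toBasis.constr_basis ℂ w i
    refine ⟨(b.toBasis.constr ℂ w).isometryOfOrthonormal (v := b.toBasis) ?_ ?_, fun i => ?_⟩
    · rw [b.coe_toBasis]; exact b.orthonormal
    · convert hw using 1
      funext i
      exact hb i
    · have : ket i = b.toBasis i := by rw [b.coe_toBasis, EuclideanSpace.basisFun_apply]; rfl
      rw [this]
      exact hb i
  obtain ⟨A, hA⟩ := key hu
  obtain ⟨B, hB⟩ := key hv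
  let L := B.comp A.equivRange.symm.toLinearIsometry
  refine ⟨L.extend.toLinearIsometryEquiv rfl, fun i => ?_⟩
  have h1 : u i = ((A.equivRange (ket i) : A.range) : Hil I) := (hA i).symm
  change L.extend (u i) = v i
  rw [h1, LinearIsometry.extend_apply]
  change B (A.equivRange.symm (A.equivRange (ket i))) = v i
  rw [LinearIsometryEquiv.symm_apply_apply, hB]

/-- The reflection `2 ∑ |u_i⟩⟨u_i| - 1`. -/
noncomputable def familyReflection {I ι : Type*} [Fintype I] (u : ι → Hil I) : Gate I :=
  (Submodule.span ℂ (Set.range u)).reflection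

theorem familyReflection_apply {I ι : Type*} [Fintype I] [Fintype ι] {u : ι → Hil I}
    (hu : Orthonormal ℂ u) (v : Hil I) :
    familyReflection u v = (2 : ℂ) • (∑ i, inner ℂ (u i) v • u i) - v := by
  classical
  rw [familyReflection, Submodule.reflection_apply, two_smul, two_smul]
  have : (Submodule.span ℂ (Set.range u)).starProjection v = ∑ i, inner ℂ (u i) v • u i := by
    refine Submodule.eq_starProjection_of_mem_of_inner_eq_zero ?_ ?_
    · exact Submodule.sum_mem _ fun i _ => Submodule.smul_mem _ _ (Submodule.subset_span ⟨i, rfl⟩)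
    · intro w hw
      induction hw using Submodule.span_induction with
      | mem x hx =>
        obtain ⟨j, rfl⟩ := hx
        rw [inner_sub_left, sum_inner]
        simp only [inner_smul_left, orthonormal_iff_ite.1 hu]
        simp
      | zero => simp
      | add x y _ _ h1 h2 => rw [inner_add_right, h1, h2, add_zero]
      | smul c x _ h => rw [inner_smul_right, h, mul_zero]
  rw [this]

theorem familyReflection_involutive {I ι : Type*} [Fintype I] (u : ι → Hil I) (v : Hil I) :
    familyReflection u (familyReflection u v) = v :=
  Submodule.reflection_reflection _ v

theorem familyReflection_of_orthogonal {I ι : Type*} [Fintype I] [Fintype ι] {u : ι → Hil I}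
    (hu : Orthonormal ℂ u) {v : Hil I} (h : ∀ i, inner ℂ (u i) v = 0) :
    familyReflection u v = -v := by
  rw [familyReflection_apply hu]
  simp [h]

/-! ### Controlled gates -/

section block

variable {I α β : Type*} [Fintype I] [Fintype α] [Fintype β] [DecidableEq α]

/-- The component of a state with a fixed value in the register `α`. -/
noncomputable def slice (e : I ≃ α × β) (a : α) (v : Hil I) : Hil β :=
  WithLp.toLp 2 fun b => v (e.symm (a, b))

theorem slice_apply (e : I ≃ α × β) (a : α) (v : Hil I) (b : β) :
    slice e a v b = v (e.symm (a, b)) := rfl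

theorem slice_ext (e : I ≃ α × β) {v w : Hil I} (h : ∀ a, slice e a v = slice e a w) : v = w := by
  ext i
  have := congrArg (fun z : Hil β => z (e i).2) (h (e i).1)
  simpa [slice_apply] using this

theorem norm_sq_eq_sum_slice (e : I ≃ α × β) (v : Hil I) : ‖v‖ ^ 2 = ∑ a, ‖slice e a v‖ ^ 2 := by
  simp only [EuclideanSpace.norm_sq_eq]
  rw [← e.symm.sum_comp, Fintype.sum_prod_type]
  rfl

/-- The gate that applies `V a` to the register `β` controlled on the value `a` in the register
`α`. -/
noncomputable def blockGate (e : I ≃ α × β) (V : α → Gate β) : Gate I where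
  toFun v := WithLp.toLp 2 fun i => V (e i).1 (slice e (e i).1 v) (e i).2
  invFun v := WithLp.toLp 2 fun i => (V (e i).1).symm (slice e (e i).1 v) (e i).2
  left_inv v := by
    refine slice_ext e fun a => ?_
    have : slice e a (WithLp.toLp 2 fun i => V (e i).1 (slice e (e i).1 v) (e i).2) =
        V a (slice e a v) := by ext b; simp [slice]
    ext b
    simp [slice_apply, this]
  right_inv v := by
    refine slice_ext e fun a => ?_
    have : slice e a (WithLp.toLp 2 fun i => (V (e i).1).symm (slice e (e i).1 v) (e i).2) =
        (V a).symm (slice e a v) := by ext b; simp [slice]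
    ext b
    simp [slice_apply, this]
  map_add' v w := by
    ext i
    have : ∀ a, slice e a (v + w) = slice e a v + slice e a w := fun a => rfl
    simp [this]
  map_smul' c v := by
    ext i
    have : ∀ a, slice e a (c • v) = c • slice e a v := fun a => rfl
    simp [this]
  norm_map' v := by
    rw [← sq_eq_sq₀ (norm_nonneg _) (norm_nonneg _), norm_sq_eq_sum_slice e, norm_sq_eq_sum_slice e]
    refine Finset.sum_congr rfl fun a _ => ?_
    rw [← (V a).norm_map (slice e a v)]
    congr 2
    ext b
    simp [slice]

theorem slice_blockGate (e : I ≃ α × β) (V : α → Gate β) (a : α) (v : Hil I) :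
    slice e a (blockGate e V v) = V a (slice e a v) := by
  ext b
  simp [slice, blockGate]

theorem blockGate_mul (e : I ≃ α × β) (V V' : α → Gate β) :
    blockGate e (fun a => V a * V' a) = blockGate e V * blockGate e V' := by
  refine LinearIsometryEquiv.ext fun v => slice_ext e fun a => ?_
  rw [slice_blockGate]
  change _ = slice e a (blockGate e V (blockGate e V' v))
  rw [slice_blockGate, slice_blockGate]
  rfl

end block

/-! ### Circuits with queries -/

section circuits

variable {N m : ℕ} {W : Type} [Fintype W] [DecidableEq W]

/-- The permutation `|i, b, w⟩ ↦ |i, b + f(i), w⟩`. -/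
def oraclePerm [NeZero m] (f : Fin N → Fin m) : Equiv.Perm (Fin N × Fin m × W) where
  toFun p := (p.1, p.2.1 + f p.1, p.2.2)
  invFun p := (p.1, p.2.1 - f p.1, p.2.2)
  left_inv p := by simp
  right_inv p := by simp

theorem oracle_mulVec [NeZero m] (f : Fin N → Fin m) (v : Fin N × Fin m × W → ℂ) :
    oracle f *ᵥ v = (permGate (oraclePerm f) (WithLp.toLp 2 v)).ofLp := by
  funext p
  rw [permGate_apply, Matrix.mulVec, dotProduct, Finset.sum_eq_single ((oraclePerm f).symm p)]
  · have : p = oraclePerm f ((oraclePerm f).symm p) := (Equiv.apply_symm_apply _ p).symm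
    rw [oracle, Matrix.of_apply, if_pos, one_mul]
    exact this
  · intro q _ hq
    rw [oracle, Matrix.of_apply, if_neg, zero_mul]
    intro h
    refine hq ?_
    rw [Equiv.eq_symm_apply]
    exact h.symm
  · exact fun h => absurd (Finset.mem_univ _) h

/-- `Circuit q A`: the operators `A f` are implemented with `q` queries to `f`. -/
inductive Circuit [NeZero m] : ℕ → ((Fin N → Fin m) → Gate (Fin N × Fin m × W)) → Prop
  | gate (V : Gate (Fin N × Fin m × W)) : Circuit 0 fun _ => V
  | step {q : ℕ} {A : (Fin N → Fin m) → Gate (Fin N × Fin m × W)}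
      (V : Gate (Fin N × Fin m × W)) (h : Circuit q A) :
      Circuit (q + 1) fun f => V * (permGate (oraclePerm f) * A f)

namespace Circuit

variable [NeZero m]

theorem of_eq {q r : ℕ} {A : (Fin N → Fin m) → Gate (Fin N × Fin m × W)} (h : Circuit q A)
    (hqr : q = r) : Circuit r A := hqr ▸ h

theorem congr {q : ℕ} {A B : (Fin N → Fin m) → Gate (Fin N × Fin m × W)} (h : Circuit q A)
    (hAB : ∀ f, A f = B f) : Circuit q B := (funext hAB : A = B) ▸ h

/-- The first gate of the second circuit merges with the last gate of the first, so query counts add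
exactly. -/
theorem mul {q r : ℕ} {A B : (Fin N → Fin m) → Gate (Fin N × Fin m × W)} (hB : Circuit r B)
    (hA : Circuit q A) : Circuit (q + r) fun f => B f * A f := by
  induction hB with
  | gate V =>
    cases hA with
    | gate V' => exact gate (V * V')
    | step V' h =>
      have := step (V * V') h
      simpa only [mul_assoc, add_zero] using this
  | step V h ih =>
    have := step V ih
    simpa only [mul_assoc, add_assoc] using this

theorem permGate_inv {I : Type*} [Fintype I] (e : Equiv.Perm I) :
    (permGate e)⁻¹ = permGate e⁻¹ := by
  refine inv_eq_of_mul_eq_one_right ?_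
  rw [← permGate_mul, mul_inv_cancel]
  ext
  rfl

theorem pow {q : ℕ} {A : (Fin N → Fin m) → Gate (Fin N × Fin m × W)} (hA : Circuit q A) (k : ℕ) :
    Circuit (k * q) fun f => A f ^ k := by
  induction k with
  | zero => simpa using gate (1 : Gate (Fin N × Fin m × W))
  | succ k ih =>
    have := hA.mul ih
    simpa only [pow_succ', Nat.succ_mul] using this

theorem query : Circuit 1 fun f : Fin N → Fin m => permGate (oraclePerm (W := W) f) := by
  simpa using step 1 (gate (N := N) (m := m) (W := W) 1)

/-- Negation of the second register. -/
def negPerm : Equiv.Perm (Fin N × Fin m × W) :=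
  (Equiv.refl _).prodCongr ((Equiv.neg (Fin m)).prodCongr (Equiv.refl _))

/-- Negating the answer register before and after a query turns addition of f(i) into subtraction,
so an inverse query costs one query. -/
theorem query_inv : Circuit 1 fun f : Fin N → Fin m => permGate (oraclePerm (W := W) f)⁻¹ := by
  have h := (gate (permGate (negPerm (N := N) (m := m) (W := W)))).mul
    (query.mul (gate (permGate (negPerm (N := N) (m := m) (W := W)))))
  convert h using 2 with f
  rw [← permGate_mul, ← permGate_mul]
  congr 1
  ext p : 1
  change (p.1, p.2.1 - f p.1, p.2.2) = (p.1, -(-p.2.1 + f p.1), p.2.2)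
  congr 2
  abel

theorem inv {q : ℕ} {A : (Fin N → Fin m) → Gate (Fin N × Fin m × W)} (hA : Circuit q A) :
    Circuit q fun f => (A f)⁻¹ := by
  induction hA with
  | gate V => exact gate V⁻¹
  | step V h ih =>
    refine ((ih.mul (query_inv.mul (gate V⁻¹))).of_eq (by ring)).congr fun f => ?_
    rw [_root_.mul_inv_rev, _root_.mul_inv_rev, permGate_inv, mul_assoc]

/-- Conjugation of a gate by the query. -/
theorem query_conj (V : Gate (Fin N × Fin m × W)) : Circuit 2 fun f : Fin N → Fin m =>
    permGate (oraclePerm f)⁻¹ * (V * permGate (oraclePerm f)) :=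
  query_inv.mul ((gate V).mul query)

/-- The declared number of queries r is left free because the state after q queries does not depend
on it. In the induction, setting gate q + 1 leaves all earlier states unchanged. -/
theorem exists_algorithm {q : ℕ} {A : (Fin N → Fin m) → Gate (Fin N × Fin m × W)}
    (hA : Circuit q A) (start : Fin N × Fin m × W) :
    ∃ gate : ℕ → Matrix.unitaryGroup (Fin N × Fin m × W) ℂ, ∀ r, ∀ f : Fin N → Fin m,
      QueryAlgorithm.stateAfter ⟨W, r, gate, start⟩ f q = (A f (ket start)).ofLp := by
  induction hA with
  | gate V =>
    refine ⟨fun _ => gateMatrix V, fun r f => ?_⟩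
    exact gateMatrix_mulVec V _
  | @step q A V h ih =>
    obtain ⟨g, hg⟩ := ih
    refine ⟨Function.update g (q + 1) (gateMatrix V), fun r f => ?_⟩
    have hlt : ∀ k ≤ q, QueryAlgorithm.stateAfter
        ⟨W, r, Function.update g (q + 1) (gateMatrix V), start⟩ f k =
        QueryAlgorithm.stateAfter ⟨W, r, g, start⟩ f k := by
      intro k
      induction k with
      | zero =>
        intro _
        simp only [QueryAlgorithm.stateAfter]
        rw [Function.update_of_ne (by omega)]
      | succ k ihk =>
        intro hk
        simp only [QueryAlgorithm.stateAfter]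
        rw [Function.update_of_ne (by omega), ihk (by omega)]
    rw [QueryAlgorithm.stateAfter, hlt q le_rfl, hg]
    change (Function.update g (q + 1) (gateMatrix V) (q + 1)).1 *ᵥ _ = _
    rw [Function.update_self, gateMatrix_mulVec, oracle_mulVec]
    rfl

/-- The rearrangement of registers that moves the last one to the front. -/
def spectatorEquiv (N m : ℕ) (W Y : Type) :
    Fin N × Fin m × (W × Y) ≃ Y × (Fin N × Fin m × W) where
  toFun p := (p.2.2.2, p.1, p.2.1, p.2.2.1)
  invFun p := (p.2.1, p.2.2.1, (p.2.2.2, p.1))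
  left_inv _ := rfl
  right_inv _ := rfl

theorem spectator {Y : Type} [Fintype Y] [DecidableEq Y] {q : ℕ}
    {A : (Fin N → Fin m) → Gate (Fin N × Fin m × W)} (hA : Circuit q A) :
    Circuit q fun f => blockGate (spectatorEquiv N m W Y) fun _ => A f := by
  induction hA with
  | gate V => exact gate _
  | step V h ih =>
    have := step (blockGate (spectatorEquiv N m W Y) fun _ => V) ih
    convert this using 2 with f
    rw [blockGate_mul, blockGate_mul]
    congr 2
    refine LinearIsometryEquiv.ext fun v => slice_ext (spectatorEquiv N m W Y) fun a => ?_
    rw [slice_blockGate]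
    rfl

end Circuit

end circuits

end EDWalk

namespace EDWalk

set_option linter.unusedSectionVars false

/-! ### The walk step of the query algorithm -/

/-- The stored data: a partial function on the indices. -/
abbrev Label (N m : ℕ) : Type := Fin N → Option (Fin m)

/-- The basis states of the algorithm: the query registers, the stored data, and a bit that marks
the pendant vertices. -/
abbrev Base (N m : ℕ) : Type := Fin N × Fin m × (Label N m × Bool)

section step

variable {N m M : ℕ}

/-- The domain of a partial function. -/
def Label.supp (g : Label N m) : Finset (Fin N) := Finset.univ.filter fun l => (g l).isSome

/-- The restriction of `f` to a subset. -/
def restrict (f : Fin N → Fin m) (s : Finset (Fin N)) : Label N m :=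
  fun x => if x ∈ s then some (f x) else none

theorem supp_restrict (f : Fin N → Fin m) (s : Finset (Fin N)) : (restrict f s).supp = s := by
  ext x
  by_cases h : x ∈ s <;> simp [Label.supp, restrict, h]

theorem restrict_injective (f : Fin N → Fin m) : Function.Injective (restrict f) := fun s t h => by
  rw [← supp_restrict f s, h, supp_restrict]

theorem vertexLabel_inl (f : Fin N → Fin m) (s : Subsets N (subsetSize N)) :
    vertexLabel f (Sum.inl s) = (false, restrict f s.1) := rfl

theorem vertexLabel_inr (f : Fin N → Fin m) (b : {s : Subsets N (subsetSize N) // Marked f s}) :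
    vertexLabel f (Sum.inr b) = (true, restrict f b.1.1) := rfl

/-- The partial function `g` with the value `b` at `l` added or removed. -/
def Label.toggle (g : Label N m) (l : Fin N) (b : Fin m) : Label N m :=
  Function.update g l (Equiv.swap none (some b) (g l))

theorem Label.toggle_toggle (g : Label N m) (l : Fin N) (b : Fin m) :
    (g.toggle l b).toggle l b = g := by
  simp [Label.toggle]

theorem toggle_restrict_of_notMem (f : Fin N → Fin m) {s : Finset (Fin N)} {l : Fin N}
    (h : l ∉ s) : (restrict f s).toggle l (f l) = restrict f (insert l s) := by
  funext x
  by_cases hx : x = l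
  · subst hx; simp [Label.toggle, restrict, h]
  · simp [Label.toggle, restrict, hx]

theorem toggle_restrict_of_mem (f : Fin N → Fin m) {s : Finset (Fin N)} {l : Fin N}
    (h : l ∈ s) : (restrict f s).toggle l (f l) = restrict f (s.erase l) := by
  funext x
  by_cases hx : x = l
  · subst hx; simp [Label.toggle, restrict, h]
  · simp [Label.toggle, restrict, hx]

/-- The permutation that adds or removes the index in the first register, with the value in the
second register. -/
def togglePerm : Equiv.Perm (Base N m) :=
  Function.Involutive.toPerm (fun p => (p.1, p.2.1, (p.2.2.1.toggle p.1 p.2.1, p.2.2.2)))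
    fun p => by simp [Label.toggle_toggle]

variable [NeZero m]

/-- The permutation that adds or removes the index in the first register, with its value. -/
def indexToggle (f : Fin N → Fin m) : Equiv.Perm (Base N m) :=
  Function.Involutive.toPerm (fun p => (p.1, p.2.1, (p.2.2.1.toggle p.1 (p.2.1 + f p.1), p.2.2.2)))
    fun p => by simp [Label.toggle_toggle]

theorem indexToggle_apply (f : Fin N → Fin m) (l : Fin N) (g : Label N m) (p : Bool) :
    indexToggle f (l, 0, (g, p)) = (l, 0, (g.toggle l (f l), p)) := by
  change (l, (0 : Fin m), (g.toggle l (0 + f l), p)) = _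
  rw [zero_add]

/-- Query the value, toggle the entry with it, and erase the value by an inverse query. -/
theorem indexToggle_circuit : Circuit 2 fun f : Fin N → Fin m => permGate (indexToggle f) := by
  have h := Circuit.query_conj (N := N) (m := m) (permGate (togglePerm (N := N) (m := m)))
  convert h using 2 with f
  rw [← permGate_mul, ← permGate_mul]
  congr 1
  ext p : 1
  change (p.1, p.2.1, (p.2.2.1.toggle p.1 (p.2.1 + f p.1), p.2.2.2)) =
    (p.1, p.2.1 + f p.1 - f p.1, (p.2.2.1.toggle p.1 (p.2.1 + f p.1), p.2.2.2))
  rw [add_sub_cancel_right]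

theorem indexToggle_mul_self (f : Fin N → Fin m) (v : Hil (Base N m)) :
    permGate (indexToggle f) (permGate (indexToggle f) v) = v := by
  ext p
  rw [permGate_apply, permGate_apply]
  have h : (indexToggle f).symm ((indexToggle f).symm p) = p := by
    rw [Equiv.symm_apply_eq, Equiv.symm_apply_eq]
    exact ((Function.Involutive.toPerm_involutive _) p).symm
  rw [h]

/-- The uniform superposition of `|l, 0, g⟩` with `l ∈ T`. -/
noncomputable def starState (T : Finset (Fin N)) (g : Label N m) : Hil (Base N m) :=
  ((1 / √(T.card : ℝ) : ℝ) : ℂ) • ∑ l ∈ T, ket (l, 0, (g, false))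

theorem inner_starState_ket (T : Finset (Fin N)) (g g' : Label N m) (l : Fin N) :
    inner ℂ (starState T g) (ket (l, 0, (g', false))) =
      if l ∈ T ∧ g = g' then ((1 / √(T.card : ℝ) : ℝ) : ℂ) else 0 := by
  rw [starState, inner_smul_left, sum_inner, Complex.conj_ofReal]
  simp only [inner_ket_left, ket_apply, Prod.mk.injEq, true_and, and_true]
  by_cases hg : g = g'
  · simp only [hg, and_true, Finset.sum_ite_eq']
    by_cases hl : l ∈ T <;> simp [hl]
  · simp [hg]

theorem inner_starState_ket_true (T : Finset (Fin N)) (g g' : Label N m) (l : Fin N) (b : Fin m) :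
    inner ℂ (starState T g) (ket (l, b, (g', true))) = 0 := by
  rw [starState, inner_smul_left, sum_inner]
  simp [inner_ket_left, ket_apply]

theorem inner_starState (T : Finset (Fin N)) (g g' : Label N m) (hT : 0 < T.card) :
    inner ℂ (starState T g) (starState T g') = if g = g' then 1 else 0 := by
  conv_lhs => rw [starState.eq_1 T g']
  rw [inner_smul_right, inner_sum]
  have hsq := Real.mul_self_sqrt (show (0 : ℝ) ≤ T.card by positivity)
  have h0 : (0 : ℝ) < √(T.card : ℝ) := Real.sqrt_pos.2 (by exact_mod_cast hT)
  by_cases hg : g = g'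
  · rw [if_pos hg, Finset.sum_congr rfl fun l hl => by
      rw [inner_starState_ket, if_pos ⟨hl, hg⟩], Finset.sum_const, nsmul_eq_mul]
    rw [← Complex.ofReal_natCast, ← Complex.ofReal_mul, ← Complex.ofReal_mul, ← Complex.ofReal_one]
    congr 1
    field_simp
    linarith
  · rw [if_neg hg, Finset.sum_eq_zero, mul_zero]
    intro l _
    rw [inner_starState_ket, if_neg fun h => hg h.2]

theorem inner_starState_of_ne (T T' : Finset (Fin N)) {g g' : Label N m} (h : g ≠ g') :
    inner ℂ (starState T g) (starState T' g') = 0 := by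
  conv_lhs => rw [starState.eq_1 T' g']
  rw [inner_smul_right, inner_sum, Finset.sum_eq_zero, mul_zero]
  intro l _
  rw [inner_starState_ket, if_neg fun h' => h h'.2]

/-- Partial functions defined at `M` indices. -/
abbrev Labels (N m M : ℕ) : Type := {g : Label N m // g.supp.card = M}

/-- The uniform superposition of the indices outside the domain of `g`. -/
noncomputable def outerStar (g : Label N m) : Hil (Base N m) := starState g.suppᶜ g

theorem inner_outerStar {g g' : Label N m} (hg : g.supp.card < N) :
    inner ℂ (outerStar g) (outerStar g') = if g = g' then 1 else 0 := by
  by_cases h : g = g'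
  · subst h
    rw [outerStar, inner_starState]
    rw [Finset.card_compl, Fintype.card_fin]
    omega
  · rw [if_neg h]
    exact inner_starState_of_ne _ _ h

theorem orthonormal_outerStar (h : M < N) :
    Orthonormal ℂ fun g : Labels N m M => outerStar g.1 := by
  classical
  refine orthonormal_iff_ite.2 fun g g' => ?_
  rw [inner_outerStar (by rw [g.2]; exact h)]
  simp only [Subtype.ext_iff]

theorem orthonormal_innerStar (h : 0 < M) :
    Orthonormal ℂ fun g : Labels N m M => starState g.1.supp g.1 := by
  classical
  refine orthonormal_iff_ite.2 fun g g' => ?_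
  by_cases hg : g = g'
  · subst hg
    rw [inner_starState _ _ _ (by rw [g.2]; exact h), if_pos rfl, if_pos rfl]
  · rw [if_neg hg]
    exact inner_starState_of_ne _ _ fun h => hg (Subtype.ext h)

/-- The step operator of the walk: exchange of the index in the first register. -/
noncomputable def shift (M : ℕ) (f : Fin N → Fin m) : Gate (Base N m) :=
  permGate (indexToggle f) * (familyReflection (fun g : Labels N m (M + 1) => starState g.1.supp g.1) *
    permGate (indexToggle f))

theorem shift_circuit : Circuit 4 fun f : Fin N → Fin m => shift M f :=
  indexToggle_circuit.mul ((Circuit.gate _).mul indexToggle_circuit)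

theorem shift_apply (f : Fin N → Fin m) (v : Hil (Base N m)) : shift M f v =
    permGate (indexToggle f) (familyReflection (fun g : Labels N m (M + 1) => starState g.1.supp g.1)
      (permGate (indexToggle f) v)) := rfl

theorem shift_shift (f : Fin N → Fin m) (v : Hil (Base N m)) : shift M f (shift M f v) = v := by
  rw [shift_apply, shift_apply, indexToggle_mul_self, familyReflection_involutive,
    indexToggle_mul_self]

/-- The reflected family has pendant bit false, so the reflection is -1 on these states and the two
toggles cancel. -/
theorem shift_ket_true (f : Fin N → Fin m) (l : Fin N) (g : Label N m) :
    shift M f (ket (l, 0, (g, true))) = -ket (l, 0, (g, true)) := by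
  rw [shift_apply, permGate_ket, indexToggle_apply,
    familyReflection_of_orthogonal (orthonormal_innerStar (Nat.succ_pos M)), map_neg, ← indexToggle_apply,
    ← permGate_ket, indexToggle_mul_self]
  intro h
  exact inner_starState_ket_true _ _ _ _ _

theorem toggle_outerStar (f : Fin N → Fin m) (s : Finset (Fin N)) :
    permGate (indexToggle f) (outerStar (restrict f s)) =
      ((1 / √(sᶜ.card : ℝ) : ℝ) : ℂ) • ∑ l ∈ sᶜ, ket (l, 0, (restrict f (insert l s), false)) := by
  rw [outerStar, starState, map_smul, map_sum, supp_restrict]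
  congr 1
  refine Finset.sum_congr rfl fun l hl => ?_
  rw [permGate_ket, indexToggle_apply, toggle_restrict_of_notMem f (Finset.mem_compl.1 hl)]

theorem toggle_innerStar (f : Fin N → Fin m) (s : Finset (Fin N)) :
    permGate (indexToggle f) (starState s (restrict f s)) =
      ((1 / √(s.card : ℝ) : ℝ) : ℂ) • ∑ k ∈ s, ket (k, 0, (restrict f (s.erase k), false)) := by
  rw [starState, map_smul, map_sum]
  congr 1
  refine Finset.sum_congr rfl fun l hl => ?_
  rw [permGate_ket, indexToggle_apply, toggle_restrict_of_mem f hl]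

theorem reflection_ket (f : Fin N → Fin m) {s : Finset (Fin N)} (hs : s.card = M + 1) {l : Fin N}
    (hl : l ∈ s) :
    familyReflection (fun g : Labels N m (M + 1) => starState g.1.supp g.1)
      (ket (l, 0, (restrict f s, false))) =
      (2 * ((1 / √(M + 1 : ℝ) : ℝ) : ℂ)) • starState s (restrict f s) -
        ket (l, 0, (restrict f s, false)) := by
  rw [familyReflection_apply (orthonormal_innerStar (Nat.succ_pos M)), mul_smul]
  congr 2
  rw [Finset.sum_eq_single (⟨restrict f s, by rw [supp_restrict, hs]⟩ : Labels N m (M + 1))]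
  · change inner ℂ (starState (restrict f s).supp (restrict f s)) _ • starState (restrict f s).supp (restrict f s) = _
    rw [supp_restrict, inner_starState_ket, if_pos ⟨hl, rfl⟩, hs, Nat.cast_succ]
  · intro g _ hg
    rw [inner_starState_ket, if_neg, zero_smul]
    exact fun h => hg (Subtype.ext h.2)
  · exact fun h => absurd (Finset.mem_univ _) h

/-- Toggling inserts the index l; the reflection spreads the first register uniformly over the M + 1
elements of the enlarged set; toggling again removes the chosen one. The -1 in the reflection
returns the original state. -/
theorem shift_outerStar (f : Fin N → Fin m) {s : Finset (Fin N)} (hs : s.card = M) :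
    shift M f (outerStar (restrict f s)) =
      (((1 / √(sᶜ.card : ℝ) : ℝ) : ℂ) * (2 / (M + 1))) • (∑ l ∈ sᶜ, ∑ k ∈ insert l s,
        ket (k, 0, (restrict f ((insert l s).erase k), false))) - outerStar (restrict f s) := by
  have hc : ∀ l ∈ sᶜ, (insert l s).card = M + 1 := fun l hl => by
    rw [Finset.card_insert_of_notMem (Finset.mem_compl.1 hl), hs]
  have hsq : ((1 / √(M + 1 : ℝ) : ℝ) : ℂ) * ((1 / √(M + 1 : ℝ) : ℝ) : ℂ) = 1 / (M + 1) := by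
    rw [← Complex.ofReal_mul, div_mul_div_comm, Real.mul_self_sqrt (by positivity)]
    push_cast
    ring
  rw [shift_apply, toggle_outerStar, map_smul, map_sum, Finset.sum_congr rfl fun l hl => by
    rw [reflection_ket f (hc l hl) (Finset.mem_insert_self l s)], Finset.sum_sub_distrib, smul_sub,
    ← toggle_outerStar, map_sub, indexToggle_mul_self, map_smul, map_sum, mul_smul]
  congr 2
  rw [Finset.smul_sum]
  refine Finset.sum_congr rfl fun l hl => ?_
  rw [map_smul, toggle_innerStar, smul_smul, hc l hl, Nat.cast_succ, mul_assoc, hsq, ← mul_div_assoc,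
    mul_one]

/-- Removing the index just inserted returns `s`, in N - M ways; every other removal is an exchange
and hence a neighbour. The compression of 1 - `shift` is thus the Johnson Laplacian scaled by 2/((N
- M)(M + 1)). -/
theorem inner_outerStar_defect (hM : M < N) (f : Fin N → Fin m) (s : Subsets N M) {g : Label N m}
    (hg : g.supp.card = M) :
    inner ℂ (outerStar g) (outerStar (restrict f s.1) - shift M f (outerStar (restrict f s.1))) =
      2 / (((N : ℂ) - M) * (M + 1)) * ((M : ℂ) * (N - M) * (if g = restrict f s.1 then 1 else 0) -
        ∑ t : Subsets N M, (johnsonGraph N M).adjMatrix ℂ s t *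
          (if g = restrict f t.1 then 1 else 0)) := by
  have hcs : (s.1ᶜ.card : ℝ) = (N : ℝ) - M := by
    rw [Finset.card_compl, Fintype.card_fin, s.2, Nat.cast_sub hM.le]
  have hcg : (g.suppᶜ.card : ℝ) = (N : ℝ) - M := by
    rw [Finset.card_compl, Fintype.card_fin, hg, Nat.cast_sub hM.le]
  have hNM : (0 : ℝ) < (N : ℝ) - M := sub_pos.2 (by exact_mod_cast hM)
  have hNM' : (N : ℂ) - M ≠ 0 := by
    rw [← Complex.ofReal_natCast, ← Complex.ofReal_natCast, ← Complex.ofReal_sub]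
    exact_mod_cast hNM.ne'
  have hM1 : (M : ℂ) + 1 ≠ 0 := by exact_mod_cast Nat.succ_ne_zero M
  have hsq : ((1 / √((N : ℝ) - M) : ℝ) : ℂ) * ((1 / √((N : ℝ) - M) : ℝ) : ℂ) = 1 / (N - M) := by
    rw [← Complex.ofReal_mul, div_mul_div_comm, Real.mul_self_sqrt hNM.le]
    push_cast
    ring
  rw [shift_outerStar f s.2, inner_sub_right, inner_sub_right, inner_outerStar (by rw [hg]; exact hM),
    inner_smul_right, inner_sum]
  have hin : ∀ l ∈ s.1ᶜ, inner ℂ (outerStar g) (∑ k ∈ insert l s.1,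
      ket (k, (0 : Fin m), (restrict f ((insert l s.1).erase k), false))) =
      ((1 / √((N : ℝ) - M) : ℝ) : ℂ) * ((if g = restrict f s.1 then 1 else 0) +
        ∑ k ∈ s.1, if g = restrict f (insert l (s.1.erase k)) then 1 else 0) := by
    intro l hl
    rw [Finset.mem_compl] at hl
    have hk : ∀ k ∈ insert l s.1, inner ℂ (outerStar g)
        (ket (k, (0 : Fin m), (restrict f ((insert l s.1).erase k), false))) =
        ((1 / √((N : ℝ) - M) : ℝ) : ℂ) *
          if g = restrict f ((insert l s.1).erase k) then 1 else 0 := by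
      intro k _
      rw [outerStar, inner_starState_ket, hcg]
      by_cases h : g = restrict f ((insert l s.1).erase k)
      · rw [if_pos h, if_pos, mul_one]
        refine ⟨?_, h⟩
        rw [h, supp_restrict, Finset.mem_compl]
        exact Finset.notMem_erase _ _
      · rw [if_neg h, if_neg fun h' => h h'.2, mul_zero]
    rw [inner_sum, Finset.sum_congr rfl hk, ← Finset.mul_sum, Finset.sum_insert hl,
      Finset.erase_insert hl]
    congr 2
    refine Finset.sum_congr rfl fun k hk => ?_
    rw [Finset.erase_insert_of_ne]
    rintro rfl
    exact hl hk
  rw [Finset.sum_congr rfl hin, ← Finset.mul_sum, Finset.sum_add_distrib, Finset.sum_const,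
    Finset.sum_comm, sum_neighbors s fun t => if g = restrict f t then 1 else 0, nsmul_eq_mul,
    show ((s.1ᶜ.card : ℕ) : ℂ) = (N : ℂ) - M by
      rw [← Complex.ofReal_natCast, hcs]; push_cast; ring, hcs]
  have e : ∀ z : ℂ, ((1 / √((N : ℝ) - M) : ℝ) : ℂ) * (2 / ((M : ℂ) + 1)) *
      (((1 / √((N : ℝ) - M) : ℝ) : ℂ) * z) = 1 / (N - M) * (2 / ((M : ℂ) + 1)) * z := fun z => by
    rw [← hsq]; ring
  rw [e]
  field_simp
  ring

/-- The embedding of the vertices of the Johnson graph. -/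
noncomputable def embed (f : Fin N → Fin m) (φ : Subsets N M → ℂ) : Hil (Base N m) :=
  ∑ s, φ s • outerStar (restrict f s.1)

/-- The Laplacian of the Johnson graph. -/
noncomputable def johnsonLaplacian (φ : Subsets N M → ℂ) : Subsets N M → ℂ := fun s =>
  (M : ℂ) * (N - M) * φ s - ∑ t, (johnsonGraph N M).adjMatrix ℂ s t * φ t

theorem inner_outerStar_embed (hM : M < N) (f : Fin N → Fin m) (φ : Subsets N M → ℂ) {g : Label N m}
    (hg : g.supp.card = M) : inner ℂ (outerStar g) (embed f φ) =
      ∑ s, φ s * (if g = restrict f s.1 then 1 else 0) := by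
  rw [embed, inner_sum]
  refine Finset.sum_congr rfl fun s _ => ?_
  rw [inner_smul_right, inner_outerStar (by rw [hg]; exact hM)]

/-- The part of an embedded vector that is reversed by the walk step. -/
noncomputable def defect (f : Fin N → Fin m) (φ : Subsets N M → ℂ) : Hil (Base N m) :=
  embed f φ - shift M f (embed f φ)

theorem shift_defect (f : Fin N → Fin m) (φ : Subsets N M → ℂ) :
    shift M f (defect f φ) = -defect f φ := by
  rw [defect, map_sub, shift_shift, neg_sub]

theorem inner_outerStar_defect_embed (hM : M < N) (f : Fin N → Fin m) (φ : Subsets N M → ℂ)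
    {g : Label N m} (hg : g.supp.card = M) : inner ℂ (outerStar g) (defect f φ) =
      inner ℂ (outerStar g)
        (embed f ((2 / (((N : ℂ) - M) * (M + 1))) • johnsonLaplacian φ)) := by
  rw [inner_outerStar_embed hM f _ hg]
  have e : defect f φ = ∑ s : Subsets N M,
      φ s • (outerStar (restrict f s.1) - shift M f (outerStar (restrict f s.1))) := by
    simp only [defect, embed, map_sum, map_smul, smul_sub, Finset.sum_sub_distrib]
  rw [e, inner_sum]
  simp only [inner_smul_right, inner_outerStar_defect hM f _ hg, Pi.smul_apply, smul_eq_mul,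
    johnsonLaplacian]
  set κ : ℂ := 2 / (((N : ℂ) - M) * (M + 1))
  calc _ = κ * (∑ s, (M : ℂ) * (N - M) * φ s * (if g = restrict f s.1 then 1 else 0) -
        ∑ s, ∑ t, (johnsonGraph N M).adjMatrix ℂ s t * φ s * (if g = restrict f t.1 then 1 else 0)) := by
        rw [← Finset.sum_sub_distrib, Finset.mul_sum]
        refine Finset.sum_congr rfl fun s _ => ?_
        have : ∑ t, (johnsonGraph N M).adjMatrix ℂ s t * φ s * (if g = restrict f t.1 then 1 else 0) =
            φ s * ∑ t, (johnsonGraph N M).adjMatrix ℂ s t * (if g = restrict f t.1 then 1 else 0) := by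
          rw [Finset.mul_sum]
          exact Finset.sum_congr rfl fun t _ => by ring
        rw [this]
        ring
    _ = _ := by
        rw [Finset.sum_comm, ← Finset.sum_sub_distrib, Finset.mul_sum]
        refine Finset.sum_congr rfl fun s _ => ?_
        rw [mul_assoc κ, sub_mul, Finset.sum_mul]
        congr 2
        refine Finset.sum_congr rfl fun t _ => ?_
        rw [(johnsonGraph N M).isSymm_adjMatrix.apply s t]

theorem inner_ket_true_outerStar (l : Fin N) (b : Fin m) (g g' : Label N m) :
    inner ℂ (ket (l, b, (g, true))) (outerStar g') = 0 := by
  rw [← inner_conj_symm, outerStar, inner_starState_ket_true, map_zero]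

theorem inner_ket_true_embed (l : Fin N) (b : Fin m) (g : Label N m) (f : Fin N → Fin m)
    (φ : Subsets N M → ℂ) : inner ℂ (ket (l, b, (g, true))) (embed f φ) = 0 := by
  simp only [embed, inner_sum, inner_smul_right, inner_ket_true_outerStar, mul_zero,
    Finset.sum_const_zero]

theorem inner_ket_true_defect (l : Fin N) (g : Label N m) (f : Fin N → Fin m)
    (φ : Subsets N M → ℂ) : inner ℂ (ket (l, 0, (g, true))) (defect f φ) = 0 := by
  have h : inner ℂ (ket (l, 0, (g, true))) (shift M f (embed f φ)) = 0 := by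
    rw [← (shift M f).inner_map_map, shift_shift, shift_ket_true, inner_neg_left,
      inner_ket_true_embed, neg_zero]
  rw [defect, inner_sub_right, inner_ket_true_embed, h, sub_zero]

theorem inner_embed (f : Fin N → Fin m) (φ : Subsets N M → ℂ) (v : Hil (Base N m)) :
    inner ℂ (embed f φ) v = ∑ s, star (φ s) * inner ℂ (outerStar (restrict f s.1)) v := by
  simp only [embed, sum_inner, inner_smul_left]
  rfl

theorem inner_embed_embed (hM : M < N) (f : Fin N → Fin m) (φ χ : Subsets N M → ℂ) :
    inner ℂ (embed f φ) (embed f χ) = star φ ⬝ᵥ χ := by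
  rw [inner_embed, dotProduct]
  refine Finset.sum_congr rfl fun s _ => ?_
  rw [inner_outerStar_embed hM f χ (by rw [supp_restrict, s.2]), Finset.sum_eq_single s]
  · simp
  · intro t _ ht
    rw [if_neg, mul_zero]
    exact fun h => ht (Subtype.ext (restrict_injective f h)).symm
  · exact fun h => absurd (Finset.mem_univ _) h

/-- For an isometry S, ‖v - Sv‖² = 2 Re⟨v, v - Sv⟩, and the right side sees only the compression of
1 - S. -/
theorem norm_sq_defect (hM : M < N) (f : Fin N → Fin m) (φ : Subsets N M → ℂ) :
    ‖defect f φ‖ ^ 2 =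
      2 * (star φ ⬝ᵥ ((2 / (((N : ℂ) - M) * (M + 1))) • johnsonLaplacian φ)).re := by
  have h1 : inner ℂ (embed f φ) (defect f φ) =
      star φ ⬝ᵥ ((2 / (((N : ℂ) - M) * (M + 1))) • johnsonLaplacian φ) := by
    rw [← inner_embed_embed hM f, inner_embed, inner_embed]
    refine Finset.sum_congr rfl fun s _ => ?_
    rw [inner_outerStar_defect_embed hM f φ (by rw [supp_restrict, s.2])]
  rw [← h1, defect, @norm_sub_sq ℂ, (shift M f).norm_map, inner_sub_right, Complex.sub_re]
  have h2 := inner_self_eq_norm_sq (𝕜 := ℂ) (embed f φ)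
  simp only [RCLike.re_eq_complex_re] at h2 ⊢
  rw [h2]
  ring

end step

end EDWalk

namespace EDWalk

set_option linter.unusedSectionVars false

/-! ### The coin: a query-free reflection mixing subset states and pendant states. -/

section coin

variable {N m M : ℕ}

/-- A partial function takes some value twice. -/
def Label.Collides (g : Label N m) : Prop := ∃ x y, x ≠ y ∧ (g x).isSome ∧ g x = g y

theorem collides_restrict (f : Fin N → Fin m) (s : Finset (Fin N)) :
    (restrict f s).Collides ↔ ∃ x ∈ s, ∃ y ∈ s, x ≠ y ∧ f x = f y := by
  constructor
  · rintro ⟨x, y, hxy, hx, h⟩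
    have hxs : x ∈ s := by
      by_contra hn
      simp [restrict, hn] at hx
    have hys : y ∈ s := by
      by_contra hn
      rw [h] at hx
      simp [restrict, hn] at hx
    refine ⟨x, hxs, y, hys, hxy, ?_⟩
    simpa [restrict, hxs, hys] using h
  · rintro ⟨x, hx, y, hy, hxy, h⟩
    exact ⟨x, y, hxy, by simp [restrict, hx], by simp [restrict, hx, hy, h]⟩

variable [NeZero N] [NeZero m]

/-- The basis state of a pendant vertex. -/
noncomputable def pendState (g : Label N m) : Hil (Base N m) := ket (0, 0, (g, true))

theorem inner_pendState (g g' : Label N m) :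
    inner ℂ (pendState g) (pendState g') = if g = g' then 1 else 0 := by
  simp [pendState, inner_ket_left, ket_apply]

theorem inner_pendState_outerStar (g g' : Label N m) :
    inner ℂ (pendState g) (outerStar g') = 0 := inner_ket_true_outerStar _ _ _ _

theorem inner_outerStar_pendState (g g' : Label N m) :
    inner ℂ (outerStar g) (pendState g') = 0 := inner_starState_ket_true _ _ _ _ _

open Classical in
/-- The cosine of the coin angle at `g`. -/
noncomputable def coinCos (γ : ℝ) (g : Label N m) : ℝ := if g.Collides then Real.cos γ else 1

open Classical in
/-- The sine of the coin angle at `g`. -/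
noncomputable def coinSin (γ : ℝ) (g : Label N m) : ℝ := if g.Collides then Real.sin γ else 0

theorem coinCos_sq_add_coinSin_sq (γ : ℝ) (g : Label N m) :
    coinCos γ g * coinCos γ g + coinSin γ g * coinSin γ g = 1 := by
  unfold coinCos coinSin
  split_ifs
  · rw [← sq, ← sq, Real.cos_sq_add_sin_sq]
  · ring

/-- The states that are fixed by the coin. -/
noncomputable def coinState (γ : ℝ) (g : Label N m) : Hil (Base N m) :=
  (coinCos γ g : ℂ) • outerStar g + (coinSin γ g : ℂ) • pendState g

theorem inner_coinState_outerStar (γ : ℝ) {g g' : Label N m} (hg : g.supp.card < N) :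
    inner ℂ (coinState γ g) (outerStar g') = if g = g' then (coinCos γ g : ℂ) else 0 := by
  rw [coinState, inner_add_left, inner_smul_left, inner_smul_left, inner_outerStar hg,
    inner_pendState_outerStar, Complex.conj_ofReal]
  split_ifs <;> simp

theorem inner_coinState_pendState (γ : ℝ) (g g' : Label N m) :
    inner ℂ (coinState γ g) (pendState g') = if g = g' then (coinSin γ g : ℂ) else 0 := by
  rw [coinState, inner_add_left, inner_smul_left, inner_smul_left, inner_pendState,
    inner_outerStar_pendState, Complex.conj_ofReal]
  split_ifs <;> simp

theorem orthonormal_coinState (γ : ℝ) (h : M < N) :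
    Orthonormal ℂ fun g : Labels N m M => coinState γ g.1 := by
  classical
  refine orthonormal_iff_ite.2 fun g g' => ?_
  rw [coinState.eq_1 γ g'.1, inner_add_right, inner_smul_right, inner_smul_right,
    inner_coinState_outerStar γ (by rw [g.2]; exact h), inner_coinState_pendState]
  by_cases hg : g = g'
  · subst hg
    rw [if_pos rfl, if_pos rfl, if_pos rfl, ← Complex.ofReal_mul, ← Complex.ofReal_mul,
      ← Complex.ofReal_add, coinCos_sq_add_coinSin_sq, Complex.ofReal_one]
  · have : g.1 ≠ g'.1 := fun h => hg (Subtype.ext h)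
    simp [hg, this]

/-- The coin operator. -/
noncomputable def coin (M : ℕ) (γ : ℝ) : Gate (Base N m) :=
  familyReflection fun g : Labels N m M => coinState γ g.1

theorem coin_of_inner (γ : ℝ) (h : M < N) {g : Label N m} (hg : g.supp.card = M)
    {v : Hil (Base N m)} {c : ℂ}
    (hv : ∀ g' : Label N m, g'.supp.card = M →
      inner ℂ (coinState γ g') v = if g' = g then c else 0) :
    coin M γ v = (2 * c) • coinState γ g - v := by
  rw [coin, familyReflection_apply (orthonormal_coinState γ h), mul_smul]
  congr 2
  rw [Finset.sum_eq_single (⟨g, hg⟩ : Labels N m M)]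
  · rw [hv g hg, if_pos rfl]
  · intro g' _ hg'
    rw [hv g'.1 g'.2, if_neg fun h => hg' (Subtype.ext h), zero_smul]
  · exact fun h => absurd (Finset.mem_univ _) h

theorem coin_outerStar (γ : ℝ) (h : M < N) {g : Label N m} (hg : g.supp.card = M) :
    coin M γ (outerStar g) =
      (2 * coinCos γ g * coinCos γ g - 1 : ℂ) • outerStar g +
        (2 * coinCos γ g * coinSin γ g : ℂ) • pendState g := by
  rw [coin_of_inner γ h hg (c := coinCos γ g), coinState]
  · module
  · intro g' hg'
    rw [inner_coinState_outerStar γ (by rw [hg']; exact h)]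
    by_cases h : g' = g <;> simp [h]

theorem coin_pendState (γ : ℝ) (h : M < N) {g : Label N m} (hg : g.supp.card = M) :
    coin M γ (pendState g) =
      (2 * coinSin γ g * coinCos γ g : ℂ) • outerStar g +
        (2 * coinSin γ g * coinSin γ g - 1 : ℂ) • pendState g := by
  rw [coin_of_inner γ h hg (c := coinSin γ g), coinState]
  · module
  · intro g' hg'
    rw [inner_coinState_pendState]
    by_cases h : g' = g <;> simp [h]

/-- The embedding of the pendant vertices. -/
noncomputable def embedPend (f : Fin N → Fin m) (φ : Subsets N M → ℂ) : Hil (Base N m) :=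
  ∑ s, φ s • pendState (restrict f s.1)

theorem shift_embedPend (f : Fin N → Fin m) (φ : Subsets N M → ℂ) :
    shift M f (embedPend f φ) = -embedPend f φ := by
  simp only [embedPend, map_sum, map_smul, pendState, shift_ket_true, smul_neg,
    Finset.sum_neg_distrib]

/-- Reflection about a line at angle γ sends the first axis to the direction 2γ. Whether a subset
collides can be read from its stored values. -/
theorem coin_embed_of_marked (γ : ℝ) (h : M < N) (f : Fin N → Fin m) {φ : Subsets N M → ℂ}
    (hφ : ∀ s, φ s ≠ 0 → (restrict f s.1).Collides) :
    coin M γ (embed f φ) =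
      (Real.cos (2 * γ) : ℂ) • embed f φ + (Real.sin (2 * γ) : ℂ) • embedPend f φ := by
  simp only [embed, embedPend, map_sum, map_smul, Finset.smul_sum, ← Finset.sum_add_distrib]
  refine Finset.sum_congr rfl fun s _ => ?_
  by_cases hs : φ s = 0
  · simp [hs]
  · rw [coin_outerStar γ h (by rw [supp_restrict, s.2]), coinCos, coinSin, if_pos (hφ s hs),
      if_pos (hφ s hs), Real.cos_two_mul, Real.sin_two_mul]
    push_cast
    module

theorem coin_embedPend_of_marked (γ : ℝ) (h : M < N) (f : Fin N → Fin m) {φ : Subsets N M → ℂ}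
    (hφ : ∀ s, φ s ≠ 0 → (restrict f s.1).Collides) :
    coin M γ (embedPend f φ) =
      (Real.sin (2 * γ) : ℂ) • embed f φ - (Real.cos (2 * γ) : ℂ) • embedPend f φ := by
  simp only [embed, embedPend, map_sum, map_smul, Finset.smul_sum, ← Finset.sum_sub_distrib]
  refine Finset.sum_congr rfl fun s _ => ?_
  by_cases hs : φ s = 0
  · simp [hs]
  · rw [coin_pendState γ h (by rw [supp_restrict, s.2]), coinCos, coinSin, if_pos (hφ s hs),
      if_pos (hφ s hs), Real.cos_two_mul', Real.sin_two_mul]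
    have : (Real.cos γ : ℂ) ^ 2 = 1 - (Real.sin γ : ℂ) ^ 2 := by
      rw [← Complex.ofReal_pow, Real.cos_sq']; push_cast; ring
    push_cast at this ⊢
    rw [this]
    module

theorem coin_embed_of_unmarked (γ : ℝ) (h : M < N) (f : Fin N → Fin m) {φ : Subsets N M → ℂ}
    (hφ : ∀ s, φ s ≠ 0 → ¬ (restrict f s.1).Collides) :
    coin M γ (embed f φ) = embed f φ := by
  simp only [embed, map_sum, map_smul]
  refine Finset.sum_congr rfl fun s _ => ?_
  by_cases hs : φ s = 0
  · simp [hs]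
  · rw [coin_outerStar γ h (by rw [supp_restrict, s.2]), coinCos, coinSin, if_neg (hφ s hs),
      if_neg (hφ s hs)]
    push_cast
    module

/-- Subtracting the embedded Laplacian makes the defect orthogonal to all outer stars of size M, and
it is already orthogonal to the pendant states. Hence it is orthogonal to every state fixed by the
coin, whatever the angle. -/
theorem coin_defect_sub_embed (γ : ℝ) (h : M < N) (f : Fin N → Fin m) (φ : Subsets N M → ℂ) :
    coin M γ (defect f φ - embed f ((2 / (((N : ℂ) - M) * (M + 1))) • johnsonLaplacian φ)) =
      -(defect f φ - embed f ((2 / (((N : ℂ) - M) * (M + 1))) • johnsonLaplacian φ)) := by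
  refine familyReflection_of_orthogonal (orthonormal_coinState γ h) fun g => ?_
  rw [coinState, inner_add_left, inner_smul_left, inner_smul_left, inner_sub_right, inner_sub_right,
    inner_outerStar_defect_embed h f φ g.2]
  have h1 : inner ℂ (pendState g.1) (defect f φ) = 0 := inner_ket_true_defect _ _ _ _
  rw [h1, pendState, inner_ket_true_embed]
  simp

end coin

/-! ### The potential lifted to the state space of the query algorithm. -/

section classes

variable {N m M : ℕ}

theorem johnsonLaplacian_classVec {x y : Fin N} (hxy : x ≠ y) (c : Fin 3 → ℝ) :
    johnsonLaplacian (∑ j : Fin 3, (c j : ℂ) • classVec M x y j) =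
      ∑ i : Fin 3, ((reducedLaplacian N M *ᵥ c) i : ℂ) • classVec M x y i := by
  funext s
  simp only [johnsonLaplacian, Finset.sum_apply, Pi.smul_apply, smul_eq_mul]
  have h1 : ∑ t : Subsets N M, (johnsonGraph N M).adjMatrix ℂ s t *
      ∑ j : Fin 3, (c j : ℂ) * classVec M x y j t =
      ∑ j : Fin 3, (c j : ℂ) * ∑ t : Subsets N M, (johnsonGraph N M).adjMatrix ℂ s t *
        classVec M x y j t := by
    simp only [Finset.mul_sum]
    rw [Finset.sum_comm]
    refine Finset.sum_congr rfl fun j _ => Finset.sum_congr rfl fun t _ => ?_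
    ring
  rw [h1]
  simp only [adjMatrix_classVec hxy, mul_sub, Finset.sum_sub_distrib, Finset.mul_sum]
  rw [Finset.sum_congr rfl fun j _ => mul_left_comm _ _ _, sub_sub_cancel, Finset.sum_comm]
  refine Finset.sum_congr rfl fun i _ => ?_
  simp only [Matrix.mulVec, dotProduct, Complex.ofReal_sum, Complex.ofReal_mul, Finset.sum_mul]
  refine Finset.sum_congr rfl fun j _ => ?_
  ring

/-- The uniform superposition of the vertices of the Johnson graph. -/
noncomputable def uniformVec (N M : ℕ) : Subsets N M → ℂ := uniformOn Finset.univ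

theorem star_classVec_dotProduct (h1 : (2 : ℝ) ≤ M) (h2 : (M : ℝ) + 2 ≤ N) {x y : Fin N} (hxy : x ≠ y) (i j : Fin 3) :
    star (classVec M x y i) ⬝ᵥ classVec M x y j = if i = j then 1 else 0 := by
  by_cases hij : i = j
  · subst hij
    rw [if_pos rfl, star_dotProduct_self, classVec,
      normSq_uniformOn (card_pairClass_pos hxy h1 h2 i), Complex.ofReal_one]
  · rw [if_neg hij, classVec, classVec, star_uniformOn_dotProduct_of_disjoint]
    rw [Finset.disjoint_left]
    intro s hs hs'
    exact hij (Fin.ext ((mem_pairClass.1 hs).symm.trans (mem_pairClass.1 hs')))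

theorem uniformVec_eq (h1 : (2 : ℝ) ≤ M) (h2 : (M : ℝ) + 2 ≤ N)
    {x y : Fin N} (hxy : x ≠ y) :
    uniformVec N M =
      ∑ j : Fin 3, (flatVec N M j : ℂ) • classVec M x y j := by
  funext s
  rw [uniformVec, uniformOn_univ_eq_sum hxy h1 h2, Finset.sum_apply]
  rfl

theorem johnsonLaplacian_uniformVec (h1 : (2 : ℝ) ≤ M) (h2 : (M : ℝ) + 2 ≤ N) :
    johnsonLaplacian (uniformVec N M) = 0 := by
  have hN : 2 ≤ N := by
    have : (2 : ℝ) ≤ N := by linarith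
    exact_mod_cast this
  have hxy : (⟨0, by omega⟩ : Fin N) ≠ ⟨1, by omega⟩ := by simp
  have hX : reducedLaplacian N M *ᵥ flatVec N M = 0 := by
    rw [reducedLaplacian_mulVec (by linarith) (by linarith) (by linarith),
      flatVec_dot_self (by linarith) (by linarith) (by linarith), dotProduct_comm,
      flatVec_dot_topVec]
    simp
  rw [uniformVec_eq h1 h2 hxy, johnsonLaplacian_classVec hxy, hX]
  simp

variable [NeZero m]

theorem embed_sub_smul (f : Fin N → Fin m) (c : ℂ) (φ χ : Subsets N M → ℂ) :
    embed f (φ - c • χ) = embed f φ - c • embed f χ := by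
  simp only [embed, Finset.smul_sum, ← Finset.sum_sub_distrib, smul_smul, ← sub_smul]
  rfl

/-- The uniform vector is harmonic, so its defect has norm zero. -/
theorem shift_embed_uniformVec (h1 : (2 : ℝ) ≤ M) (h2 : (M : ℝ) + 2 ≤ N) (f : Fin N → Fin m) :
    shift M f (embed f (uniformVec N M)) = embed f (uniformVec N M) := by
  have hMN : M < N := by
    have : (M : ℝ) < N := by linarith
    exact_mod_cast this
  have h := norm_sq_defect hMN f (uniformVec N M)
  rw [johnsonLaplacian_uniformVec h1 h2, smul_zero, dotProduct_zero, Complex.zero_re, mul_zero, sq_eq_zero_iff, norm_eq_zero,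
    defect, sub_eq_zero] at h
  exact h.symm

/-- ζ is the defect of the lifted potential, so that its projection to the embedded subsets is a -
αs. The pair is arbitrary and need not be the only collision of f, which lets one argument cover
functions with many collisions. -/
theorem exists_reversed_vector (h1 : (2 : ℝ) ≤ M) (h2 : (M : ℝ) + 2 ≤ N)
    [NeZero N] (f : Fin N → Fin m) {x y : Fin N} (hxy : x ≠ y) :
    ∃ ζ : Hil (Base N m), shift M f ζ = -ζ ∧
      (∀ γ, coin M γ (ζ - (embed f (classVec M x y 2) -
          (flatVec N M 2 : ℂ) • embed f (uniformVec N M))) =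
        -(ζ - (embed f (classVec M x y 2) -
          (flatVec N M 2 : ℂ) • embed f (uniformVec N M)))) ∧
      ‖ζ‖ ^ 2 ≤ M + 1 := by
  have hMN : M < N := by
    have : (M : ℝ) < N := by linarith
    exact_mod_cast this
  obtain ⟨c, hc0, hc1, hc2⟩ := exists_potential (n := N) (M := M) (by linarith)
    (by linarith) (by linarith)
  set κ : ℝ := 2 / (((N : ℝ) - M) * (M + 1)) with hκ
  have hNM : (0 : ℝ) < (N : ℝ) - M := by linarith
  have hκ0 : 0 < κ := by positivity
  have hκC : (κ : ℂ) = 2 / (((N : ℂ) - M) * (M + 1)) := by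
    rw [hκ]; push_cast; rfl
  -- The factor κ⁻¹ cancels the scale of the compressed Laplacian.
  set φ : Subsets N M → ℂ := ∑ j : Fin 3, ((κ⁻¹ * c j : ℝ) : ℂ) • classVec M x y j with hφ
  have hL : (2 / (((N : ℂ) - M) * (M + 1))) • johnsonLaplacian φ =
      classVec M x y 2 - (flatVec N M 2 : ℂ) • uniformVec N M := by
    have : (fun j => κ⁻¹ * c j) = κ⁻¹ • c := rfl
    rw [hφ, johnsonLaplacian_classVec hxy, this, Matrix.mulVec_smul, hc1, ← hκC,
      uniformVec_eq h1 h2 hxy, Finset.smul_sum, Finset.smul_sum]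
    have e : classVec M x y 2 = ∑ i : Fin 3, (if i = 2 then (1 : ℂ) else 0) • classVec M x y i := by
      simp
    rw [e, ← Finset.sum_sub_distrib]
    refine Finset.sum_congr rfl fun i _ => ?_
    rw [smul_smul, smul_smul, ← sub_smul]
    congr 1
    have hk : (κ : ℂ) ≠ 0 := by exact_mod_cast hκ0.ne'
    simp only [Pi.smul_apply, Pi.sub_apply, Pi.single_apply, smul_eq_mul]
    push_cast
    rw [mul_inv_cancel_left₀ hk]
    split_ifs <;> push_cast <;> rfl
  refine ⟨defect f φ, shift_defect f φ, fun γ => ?_, ?_⟩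
  · rw [← embed_sub_smul, ← hL]
    exact coin_defect_sub_embed γ hMN f φ
  · rw [norm_sq_defect hMN, hL]
    have hd : ∀ i : Fin 3, star φ ⬝ᵥ classVec M x y i = ((κ⁻¹ * c i : ℝ) : ℂ) := fun i => by
      rw [hφ, star_sum, sum_dotProduct]
      simp only [star_smul, smul_dotProduct, star_classVec_dotProduct h1 h2 hxy]
      simp
    rw [dotProduct_sub, dotProduct_smul, uniformVec_eq h1 h2 hxy, dotProduct_sum]
    simp only [dotProduct_smul, hd, smul_eq_mul]
    have h0 : ∑ j : Fin 3, (flatVec N M j : ℂ) * ((κ⁻¹ * c j : ℝ) : ℂ) = 0 := by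
      have : ∑ j : Fin 3, flatVec N M j * (κ⁻¹ * c j) = κ⁻¹ * (flatVec N M ⬝ᵥ c) := by
        rw [dotProduct, Finset.mul_sum]
        exact Finset.sum_congr rfl fun j _ => by ring
      exact_mod_cast this.trans (by rw [hc0, mul_zero])
    have h22 := hd 2
    rw [Fin.val_two] at h22
    rw [h0, mul_zero, sub_zero, h22, Complex.ofReal_re]
    have hyy : c 2 * N ≤ 1 := by
      have h : c 2 ^ 2 ≤ c ⬝ᵥ c := by
        simp only [dotProduct, Fin.sum_univ_three]
        nlinarith [mul_self_nonneg (c 0), mul_self_nonneg (c 1)]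
      refine le_of_abs_le ?_
      rw [← sq_le_one_iff_abs_le_one, mul_pow]
      nlinarith [sq_nonneg (N : ℝ)]
    -- As the potential is orthogonal to s, only its A₂ coordinate survives in the norm; c₂ ≤ 1/N
    -- then gives at most M + 1.
    have e : 2 * (κ⁻¹ * c 2) = ((N : ℝ) - M) * (M + 1) * c 2 := by
      rw [hκ, inv_div]; ring
    rw [e]
    have hM0 : (0 : ℝ) ≤ M + 1 := by linarith
    rcases le_total 0 (c 2) with h | h
    · nlinarith [mul_nonneg hM0 (mul_nonneg h (show (0 : ℝ) ≤ M by linarith))]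
    · nlinarith [mul_nonneg hM0 (mul_nonneg hNM.le (neg_nonneg.2 h))]

end classes

end EDWalk

namespace EDWalk

set_option linter.unnecessarySeqFocus false

/-! ### Powers of a product of two reflections -/

section rotation

variable {E : Type*} [NormedAddCommGroup E] [InnerProductSpace ℂ E]

theorem norm_ofReal_smul (r : ℝ) (v : E) : ‖(r : ℂ) • v‖ = |r| * ‖v‖ := by
  rw [norm_smul, Complex.norm_real, Real.norm_eq_abs]

theorem pow_succ_apply' (U : E ≃ₗᵢ[ℂ] E) (k : ℕ) (v : E) : (U ^ (k + 1)) v = U ((U ^ k) v) := by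
  rw [pow_succ']; rfl

/-- If `s = w - U w`, then the sums of the powers of `U` applied to `s` are bounded. -/
theorem norm_sum_pow_le (U : E ≃ₗᵢ[ℂ] E) {s w : E} (h : w - U w = s) (K : ℕ) :
    ‖∑ x ∈ Finset.range K, (U ^ x) s‖ ≤ 2 * ‖w‖ := by
  have e : ∑ x ∈ Finset.range K, (U ^ x) s = w - (U ^ K) w := by
    induction K with
    | zero => simp
    | succ K ih =>
      have : (U ^ K) (U w) = (U ^ (K + 1)) w := by rw [pow_succ]; rfl
      rw [Finset.sum_range_succ, ih, ← h, map_sub, this]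
      abel
  rw [e, two_mul]
  refine (norm_sub_le _ _).trans_eq ?_
  rw [LinearIsometryEquiv.norm_map]

/-- The unknown vector R s enters R ζ with coefficient -α, and the summand s/2 is chosen to cancel
it. What remains is R w = -ζ/(2α) - s/2, and S changes the sign of the first term only. -/
theorem sub_mul_eq_of_reversed {S R : E ≃ₗᵢ[ℂ] E} {s a ζ : E} {α : ℝ} (hα : α ≠ 0)
    (hs : S s = s) (hζ : S ζ = -ζ) (ha : R a = -a)
    (hR : R (ζ - (a - (α : ℂ) • s)) = -(ζ - (a - (α : ℂ) • s))) :
    ((1 / (2 * α) : ℝ) : ℂ) • ζ + (1 / 2 : ℂ) • s -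
      (S * R) (((1 / (2 * α) : ℝ) : ℂ) • ζ + (1 / 2 : ℂ) • s) = s := by
  have hα' : (α : ℂ) ≠ 0 := by exact_mod_cast hα
  have h1 : R ζ = -ζ - (α : ℂ) • s - (α : ℂ) • R s := by
    rw [map_sub, map_sub, map_smul, ha] at hR
    have : R ζ = -(ζ - (a - (α : ℂ) • s)) + (-a - (α : ℂ) • R s) := by
      rw [← hR]; abel
    rw [this]
    abel
  change _ - S (R _) = s
  rw [map_add, map_smul, map_smul, h1]
  have h2 : ((1 / (2 * α) : ℝ) : ℂ) • (-ζ - (α : ℂ) • s - (α : ℂ) • R s) + (1 / 2 : ℂ) • R s =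
      -((1 / (2 * α) : ℝ) : ℂ) • ζ - (1 / 2 : ℂ) • s := by
    push_cast
    match_scalars <;> field_simp <;> ring
  rw [h2, map_sub, map_smul, map_smul, hs, hζ]
  module

theorem abs_one_sub_cos_le (x : ℝ) : |1 - Real.cos x| ≤ x ^ 2 / 2 := by
  rw [abs_of_nonneg (by linarith [Real.cos_le_one x])]
  linarith [Real.one_sub_sq_div_two_le_cos (x := x)]

theorem abs_sin_sub_le {x : ℝ} (h0 : 0 ≤ x) (h1 : x ≤ 1) : |Real.sin x - x| ≤ x ^ 2 := by
  rcases h0.eq_or_lt with rfl | h0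
  · simp
  · rw [abs_sub_comm, abs_of_nonneg (by linarith [Real.sin_le h0.le])]
    have := Real.sin_gt_sub_cube h0
    nlinarith [mul_pos h0 h0]

theorem abs_mul_add_mul_le {x y p q r : ℝ} (hx : |x| ≤ 1) (hy : |y| ≤ 1) (hp : |p| ≤ r / 2)
    (hq : |q| ≤ r) : |x * p + y * q| ≤ 3 / 2 * r := by
  refine (abs_add_le _ _).trans ?_
  rw [abs_mul, abs_mul]
  have h1 := mul_le_mul hx hp (abs_nonneg _) zero_le_one
  have h2 := mul_le_mul hy hq (abs_nonneg _) zero_le_one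
  linarith

/-- Compare one step with an exact rotation by β = αD of the pair (s, b + z). The errors per step,
in units of φ², are 3/2 and 3 from replacing cos β and sin β, 2 from βz, and 1/2 and 2 from e1 and
e2: nine in all. They add up because `U` is an isometry. -/
theorem norm_pow_sub_le_of_step {U : E ≃ₗᵢ[ℂ] E} {s b z e1 e2 : E} {α D φ Z : ℝ}
    (hα0 : 0 ≤ α) (hD0 : 0 ≤ D) (hD1 : D ≤ φ) (hφ0 : 0 ≤ φ) (hφ1 : φ ≤ 1) (hα1 : α ≤ 1)
    (ns : ‖s‖ = 1) (nw : ‖b + z‖ ≤ 2) (nz : ‖z‖ ≤ φ * Z / 2) (hαZ : α * Z ≤ 4)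
    (he1 : U s = s - ((α * D : ℝ) : ℂ) • b + e1) (ne1 : ‖e1‖ ≤ φ ^ 2 / 2)
    (he2 : U (b + z) = b + z + ((α * D : ℝ) : ℂ) • s + e2) (ne2 : ‖e2‖ ≤ 2 * φ ^ 2) (k : ℕ) :
    ‖(U ^ k) s - ((Real.cos (k * (α * D)) : ℂ) • s -
      (Real.sin (k * (α * D)) : ℂ) • (b + z))‖ ≤ 9 * k * φ ^ 2 := by
  set β := α * D with hβ
  have hβ0 : 0 ≤ β := by positivity
  have hβφ : β ≤ φ := by
    calc α * D ≤ 1 * φ := by gcongr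
      _ = φ := one_mul _
  have b2 : β ^ 2 ≤ φ ^ 2 := by gcongr
  have t1 : |1 - Real.cos β| ≤ φ ^ 2 / 2 := (abs_one_sub_cos_le β).trans (by linarith)
  have t2 : |Real.sin β - β| ≤ φ ^ 2 := (abs_sin_sub_le hβ0 (hβφ.trans hφ1)).trans b2
  have hφ2 := sq_nonneg φ
  clear_value β
  induction k with
  | zero => simp
  | succ k ih =>
    rw [pow_succ_apply']
    have hc : Real.cos ((k + 1 : ℕ) * β) =
        Real.cos (k * β) * Real.cos β - Real.sin (k * β) * Real.sin β := by
      rw [← Real.cos_add]; push_cast; ring_nf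
    have hsn : Real.sin ((k + 1 : ℕ) * β) =
        Real.sin (k * β) * Real.cos β + Real.cos (k * β) * Real.sin β := by
      rw [← Real.sin_add]; push_cast; ring_nf
    rw [hc, hsn]
    have c1 : |Real.cos (k * β)| ≤ 1 := Real.abs_cos_le_one _
    have d1 : |Real.sin (k * β)| ≤ 1 := Real.abs_sin_le_one _
    generalize Real.cos (k * β) = c at *
    generalize Real.sin (k * β) = d at *
    generalize (U ^ k) s = v at *
    generalize Real.cos β = cb at *
    generalize Real.sin β = sb at *
    have e : U v - (((c * cb - d * sb : ℝ) : ℂ) • s - ((d * cb + c * sb : ℝ) : ℂ) • (b + z)) =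
        U (v - ((c : ℂ) • s - (d : ℂ) • (b + z))) +
        ((((c * (1 - cb) + d * (sb - β) : ℝ) : ℂ) • s +
          ((-d * (1 - cb) + c * (sb - β) : ℝ) : ℂ) • (b + z) +
          ((c * β : ℝ) : ℂ) • z) + ((c : ℂ) • e1 + ((-d : ℝ) : ℂ) • e2)) := by
      rw [map_sub U v, map_sub, map_smul, map_smul, he1, he2]
      push_cast
      module
    have f1 : ‖((c * (1 - cb) + d * (sb - β) : ℝ) : ℂ) • s‖ ≤ 3 / 2 * φ ^ 2 := by
      rw [norm_ofReal_smul, ns, mul_one]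
      exact abs_mul_add_mul_le c1 d1 t1 t2
    have f2 : ‖((-d * (1 - cb) + c * (sb - β) : ℝ) : ℂ) • (b + z)‖ ≤ 3 / 2 * φ ^ 2 * 2 := by
      rw [norm_ofReal_smul]
      exact mul_le_mul (abs_mul_add_mul_le (by rwa [abs_neg]) c1 t1 t2) nw (norm_nonneg _) (by positivity)
    have f3 : ‖((c * β : ℝ) : ℂ) • z‖ ≤ 2 * φ ^ 2 := by
      rw [norm_ofReal_smul, abs_mul, abs_of_nonneg hβ0]
      have g1 : |c| * β ≤ α * φ := by
        calc |c| * β ≤ 1 * β := by gcongr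
          _ ≤ α * φ := by rw [one_mul, hβ]; gcongr
      calc |c| * β * ‖z‖ ≤ α * φ * (φ * Z / 2) := by gcongr
        _ = φ ^ 2 * (α * Z) / 2 := by ring
        _ ≤ φ ^ 2 * 4 / 2 := by gcongr
        _ = _ := by ring
    have f4 : ‖(c : ℂ) • e1‖ ≤ 1 * (φ ^ 2 / 2) := by
      rw [norm_ofReal_smul]
      exact mul_le_mul c1 ne1 (norm_nonneg _) zero_le_one
    have f5 : ‖((-d : ℝ) : ℂ) • e2‖ ≤ 1 * (2 * φ ^ 2) := by
      rw [norm_ofReal_smul, abs_neg]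
      exact mul_le_mul d1 ne2 (norm_nonneg _) zero_le_one
    rw [e]
    refine (norm_add_le _ _).trans ?_
    rw [LinearIsometryEquiv.norm_map]
    refine (add_le_add ih ((norm_add_le _ _).trans (add_le_add (norm_add₃_le.trans
      (add_le_add (add_le_add f1 f2) f3)) ((norm_add_le _ _).trans (add_le_add f4 f5))))).trans
      (le_of_eq ?_)
    push_cast
    ring

/-- Approximate rotation in the plane of `s` and `b`. -/
theorem norm_pow_sub_rotation_le {S R : E ≃ₗᵢ[ℂ] E} {s a b ζ : E} {α φ Z : ℝ}
    (hα0 : 0 ≤ α) (hα1 : α ≤ 1) (hφ0 : 0 ≤ φ) (hφ1 : φ ≤ 1)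
    (ns : ‖s‖ = 1) (na : ‖a‖ = 1) (nb : ‖b‖ = 1) (hZ : ‖ζ‖ ≤ Z) (hαZ : α * Z ≤ 4) (hφZ : φ * Z ≤ 2)
    (hs : S s = s) (hb : S b = -b) (hζ : S ζ = -ζ)
    (hRa : R a = (Real.cos φ : ℂ) • a + (Real.sin φ : ℂ) • b)
    (hRb : R b = (Real.sin φ : ℂ) • a - (Real.cos φ : ℂ) • b)
    (hRs : R (s - (α : ℂ) • a) = s - (α : ℂ) • a)
    (hR : R (ζ - (a - (α : ℂ) • s)) = -(ζ - (a - (α : ℂ) • s))) (k : ℕ) :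
    ‖((S * R) ^ k) s - ((Real.cos (k * (α * Real.sin φ)) : ℂ) • s -
      (Real.sin (k * (α * Real.sin φ)) : ℂ) • b)‖ ≤ 9 * k * φ ^ 2 + φ * Z := by
  set C := Real.cos φ with hC
  set D := Real.sin φ with hD
  have hD0 : 0 ≤ D := Real.sin_nonneg_of_nonneg_of_le_pi hφ0 (by linarith [Real.pi_gt_three])
  have hD1 : D ≤ φ := Real.sin_le hφ0
  have hC1 : |1 - C| ≤ φ ^ 2 / 2 := abs_one_sub_cos_le φ
  have hφ2 : φ ^ 2 ≤ φ := by nlinarith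
  set β := α * D with hβ
  have hβ0 : 0 ≤ β := by positivity
  have hβφ : β ≤ φ := by nlinarith
  have hZ0 : 0 ≤ Z := (norm_nonneg _).trans hZ
  have hRs' : R s = s - (α : ℂ) • a + (α : ℂ) • R a := by
    rw [map_sub, map_smul] at hRs
    rw [← hRs]; abel
  -- One step moves b by sin φ times a, up to sign, an error of first order. The multiple of ζ is
  -- chosen so that `R` cancels this a-component to second order and leaves the motion βs along s.
  set z : E := ((-(D / 2) : ℝ) : ℂ) • ζ with hz
  have nz : ‖z‖ ≤ φ * Z / 2 := by
    rw [hz, norm_ofReal_smul, abs_neg, abs_of_nonneg (by positivity)]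
    calc D / 2 * ‖ζ‖ ≤ φ / 2 * Z := by gcongr
      _ = _ := by ring
  set w := b + z with hw
  have nw : ‖w‖ ≤ 2 := (norm_add_le _ _).trans (by rw [nb]; linarith)
  obtain ⟨e1, he1, ne1⟩ : ∃ e1 : E, (S * R) s = s - (β : ℂ) • b + e1 ∧ ‖e1‖ ≤ φ ^ 2 / 2 := by
    refine ⟨((-(α * (1 - C)) : ℝ) : ℂ) • S a, ?_, ?_⟩
    · change S (R s) = _
      rw [hRs', hRa, map_add, map_sub, map_smul, map_smul, map_add, map_smul, map_smul, hs, hb, hβ]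
      push_cast
      module
    · rw [norm_ofReal_smul, abs_neg, abs_mul, LinearIsometryEquiv.norm_map, na, mul_one,
        abs_of_nonneg hα0]
      nlinarith [abs_nonneg (1 - C)]
  obtain ⟨e2, he2, ne2⟩ : ∃ e2 : E, (S * R) w = w + (β : ℂ) • s + e2 ∧ ‖e2‖ ≤ 2 * φ ^ 2 := by
    -- Everything left over carries a factor 1 - cos φ or sin² φ.
    set r : E := ((1 - C : ℝ) : ℂ) • b + ((D / 2 * (1 - α ^ 2) * (1 - C) : ℝ) : ℂ) • a +
      ((-(D / 2 * (1 - α ^ 2) * D) : ℝ) : ℂ) • b with hr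
    have hRζ : R ζ = -ζ + a - (α : ℂ) • s + R a - (α : ℂ) • R s := by
      rw [map_sub, map_sub, map_smul] at hR
      have : R ζ = -(ζ - (a - (α : ℂ) • s)) + (R a - (α : ℂ) • R s) := by rw [← hR]; abel
      rw [this]; abel
    have hRw : R w = -w + (β : ℂ) • s + r := by
      rw [hw, map_add, hz, map_smul, hRζ, hRb, hRs', hRa, hr, hβ]
      push_cast
      match_scalars <;> ring
    refine ⟨S r, ?_, ?_⟩
    · change S (R w) = _
      rw [hRw, map_add, map_add, map_neg, map_smul, hs, hw, map_add, hb, hz, map_smul, hζ]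
      module
    · rw [LinearIsometryEquiv.norm_map, hr]
      refine (norm_add₃_le).trans ?_
      have ha2 : |1 - α ^ 2| ≤ 1 := by
        rw [abs_le]; constructor <;> nlinarith
      rw [norm_ofReal_smul, norm_ofReal_smul, norm_ofReal_smul, na, nb, mul_one, mul_one, mul_one,
        abs_neg, abs_mul, abs_mul, abs_mul, abs_mul, abs_of_nonneg hD0,
        abs_of_nonneg (show 0 ≤ D / 2 by positivity)]
      have h1 : D / 2 * |1 - α ^ 2| * |1 - C| ≤ 1 / 2 * 1 * (φ ^ 2 / 2) := by
        gcongr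
        linarith
      have h2 : D / 2 * |1 - α ^ 2| * D ≤ φ / 2 * 1 * φ := by gcongr
      nlinarith
  have main := norm_pow_sub_le_of_step (U := S * R) hα0 hD0 hD1 hφ0 hφ1 hα1 ns nw nz hαZ he1 ne1 (hw ▸ he2) ne2
  have e : ((S * R) ^ k) s - ((Real.cos (k * β) : ℂ) • s - (Real.sin (k * β) : ℂ) • b) =
      (((S * R) ^ k) s - ((Real.cos (k * β) : ℂ) • s - (Real.sin (k * β) : ℂ) • w)) -
        (Real.sin (k * β) : ℂ) • z := by
    rw [hw]; module
  rw [e]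
  refine (norm_sub_le _ _).trans (add_le_add (main k) ?_)
  rw [norm_ofReal_smul]
  have h1 := Real.abs_sin_le_one (k * β)
  have : 0 ≤ φ * Z := by positivity
  nlinarith [norm_nonneg z]

end rotation

end EDWalk

namespace EDWalk

set_option linter.unusedSectionVars false

/-! ### Loading the values of `f` -/

section load

variable {N m M : ℕ} [NeZero N] [NeZero m]

/-- The permutation that adds the second register to the stored value at the index in the first
register. -/
def addPerm : Equiv.Perm (Base N m) where
  toFun p := (p.1, p.2.1, (Function.update p.2.2.1 p.1 ((p.2.2.1 p.1).map (· + p.2.1)), p.2.2.2))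
  invFun p := (p.1, p.2.1, (Function.update p.2.2.1 p.1 ((p.2.2.1 p.1).map (· - p.2.1)), p.2.2.2))
  left_inv p := by
    simp [Function.comp_def]
  right_inv p := by
    simp [Function.comp_def]

/-- The permutation that adds `f(l)` to the stored value at the index `l` in the first register. -/
def addQueryPerm (f : Fin N → Fin m) : Equiv.Perm (Base N m) :=
  (oraclePerm f)⁻¹ * (addPerm * oraclePerm f)

theorem addQueryPerm_apply (f : Fin N → Fin m) (l : Fin N) (g : Label N m) (p : Bool) :
    addQueryPerm f (l, 0, (g, p)) = (l, 0, (Function.update g l ((g l).map (· + f l)), p)) := by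
  change (l, (0 + f l) - f l, (Function.update g l ((g l).map (· + (0 + f l))), p)) = _
  rw [zero_add, sub_self]

/-- The element of a finite set with a given position. -/
def nthElem (T : Finset (Fin N)) (j : ℕ) : Fin N := (T.sort (· ≤ ·)).getD j 0

/-- The permutation that exchanges the index `0` and the `j`-th element of the domain in the first
register. -/
def movePerm (j : ℕ) : Equiv.Perm (Base N m) :=
  Function.Involutive.toPerm
    (fun p => (Equiv.swap 0 (nthElem p.2.2.1.supp j) p.1, p.2.1, p.2.2))
    fun p => by simp

theorem movePerm_apply (j : ℕ) (l : Fin N) (b : Fin m) (g : Label N m) (p : Bool) :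
    movePerm j (l, b, (g, p)) = (Equiv.swap 0 (nthElem g.supp j) l, b, (g, p)) := rfl

/-- The permutation that adds the value of `f` at the `j`-th element of the domain. -/
def loadStep (f : Fin N → Fin m) (j : ℕ) : Equiv.Perm (Base N m) :=
  movePerm j * (addQueryPerm f * movePerm j)

theorem supp_update_map (g : Label N m) (l : Fin N) (h : Fin m → Fin m) :
    Label.supp (Function.update g l ((g l).map h)) = g.supp := by
  ext x
  by_cases hx : x = l
  · subst hx; simp [Label.supp]
  · simp [Label.supp, hx]

/-- Only a stored value changes, not the domain, so the second move finds the same j-th element and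
returns the first register to 0. -/
theorem loadStep_apply (f : Fin N → Fin m) (j : ℕ) (g : Label N m) (p : Bool) :
    loadStep f j (0, 0, (g, p)) = (0, 0, (Function.update g (nthElem g.supp j)
      ((g (nthElem g.supp j)).map (· + f (nthElem g.supp j))), p)) := by
  rw [loadStep, Equiv.Perm.mul_apply, Equiv.Perm.mul_apply, movePerm_apply j 0 0 g p, addQueryPerm_apply, movePerm_apply, supp_update_map, Equiv.swap_apply_left,
    Equiv.swap_apply_right]

/-- The partial function on `T` that agrees with `f` at the first `j` elements and vanishes at the
others. -/
def partialLoad (f : Fin N → Fin m) (T : Finset (Fin N)) (j : ℕ) : Label N m := fun x =>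
  if x ∈ T then some (if x ∈ (T.sort (· ≤ ·)).take j then f x else 0) else none

theorem supp_partialLoad (f : Fin N → Fin m) (T : Finset (Fin N)) (j : ℕ) :
    (partialLoad f T j).supp = T := by
  ext x
  by_cases h : x ∈ T <;> simp [Label.supp, partialLoad, h]

/-- The partial function on `T` with value `0`. -/
def zeroLabel (T : Finset (Fin N)) : Label N m := fun x => if x ∈ T then some 0 else none

theorem zeroLabel_injective : Function.Injective (zeroLabel : Finset (Fin N) → Label N m) :=
  restrict_injective fun _ => 0

theorem partialLoad_zero (f : Fin N → Fin m) (T : Finset (Fin N)) :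
    partialLoad f T 0 = zeroLabel T := by
  funext x
  simp [partialLoad, zeroLabel]

theorem partialLoad_card (f : Fin N → Fin m) (T : Finset (Fin N)) :
    partialLoad f T T.card = restrict f T := by
  funext x
  by_cases h : x ∈ T
  · have : (T.sort (· ≤ ·)).take T.card = T.sort (· ≤ ·) :=
      List.take_of_length_le (Finset.length_sort _).le
    simp [partialLoad, restrict, h, this]
  · simp [partialLoad, restrict, h]

theorem loadStep_partialLoad (f : Fin N → Fin m) (T : Finset (Fin N)) {j : ℕ} (hj : j < T.card)
    (p : Bool) : loadStep f j (0, 0, (partialLoad f T j, p)) = (0, 0, (partialLoad f T (j + 1), p)) := by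
  have hj' : j < (T.sort (· ≤ ·)).length := by rwa [Finset.length_sort]
  have hl : nthElem T j = (T.sort (· ≤ ·))[j] := by
    rw [nthElem, List.getD_eq_getElem _ _ hj']
  have hT : nthElem T j ∈ T := by
    rw [hl, ← Finset.mem_sort (· ≤ ·)]
    exact List.getElem_mem hj'
  have hn : nthElem T j ∉ (T.sort (· ≤ ·)).take j := by
    rw [hl]
    intro h
    obtain ⟨i, hi, h⟩ := List.getElem_of_mem h
    rw [List.length_take] at hi
    rw [List.getElem_take] at h
    have := (List.Nodup.getElem_inj_iff (Finset.sort_nodup T (· ≤ ·))).1 h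
    omega
  rw [loadStep_apply, supp_partialLoad]
  congr 3
  funext x
  by_cases hx : x = nthElem T j
  · subst hx
    rw [Function.update_self, partialLoad, partialLoad, if_pos hT, if_pos hT, if_neg hn, if_pos]
    · simp
    · rw [List.take_add_one, List.mem_append, List.getElem?_eq_getElem hj', hl]
      simp
  · rw [Function.update_of_ne hx, partialLoad, partialLoad]
    have : x ∈ (T.sort (· ≤ ·)).take (j + 1) ↔ x ∈ (T.sort (· ≤ ·)).take j := by
      rw [List.take_add_one, List.mem_append, List.getElem?_eq_getElem hj', ← hl]
      simp [hx]
    simp only [this]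

/-- The permutation that adds the values of `f` at the first `k` elements of the domain. -/
def loadPerm (f : Fin N → Fin m) : ℕ → Equiv.Perm (Base N m)
  | 0 => 1
  | k + 1 => loadStep f k * loadPerm f k

theorem loadPerm_apply (f : Fin N → Fin m) (T : Finset (Fin N)) (p : Bool) :
    loadPerm f T.card (0, 0, (zeroLabel T, p)) = (0, 0, (restrict f T, p)) := by
  have : ∀ k ≤ T.card, loadPerm f k (0, 0, (zeroLabel T, p)) = (0, 0, (partialLoad f T k, p)) := by
    intro k
    induction k with
    | zero => intro _; rw [partialLoad_zero]; rfl
    | succ k ih =>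
      intro hk
      change loadStep f k (loadPerm f k _) = _
      rw [ih (by omega), loadStep_partialLoad f T (by omega)]
  rw [this _ le_rfl, partialLoad_card]

theorem loadPerm_circuit (k : ℕ) : Circuit (2 * k) fun f : Fin N → Fin m => permGate (loadPerm f k) := by
  induction k with
  | zero =>
    have : permGate (1 : Equiv.Perm (Base N m)) = 1 := by ext; rfl
    simpa [loadPerm, this] using Circuit.gate (N := N) (m := m) (W := Label N m × Bool) 1
  | succ k ih =>
    have h := ((Circuit.gate (permGate (movePerm (N := N) (m := m) k))).mul
      ((Circuit.query_conj (permGate addPerm)).mul (Circuit.gate (permGate (movePerm k))))).mul ih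
    refine (h.of_eq (by ring)).congr fun f => ?_
    rw [← permGate_mul, ← permGate_mul, ← permGate_mul, ← permGate_mul, ← permGate_mul]
    rfl

end load

/-! ### Preparation of the uniform state and the final change of basis. -/

section prepare

variable {N m M : ℕ} [NeZero N] [NeZero m]

theorem exists_gate_of_norm_eq_one {I : Type*} [Fintype I] {u v : Hil I} (hu : ‖u‖ = 1)
    (hv : ‖v‖ = 1) : ∃ V : Gate I, V u = v := by
  have h : ∀ {w : Hil I}, ‖w‖ = 1 → Orthonormal ℂ fun _ : Unit => w := fun {w} hw =>
    ⟨fun _ => hw, fun i j hij => absurd (Subsingleton.elim i j) hij⟩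
  obtain ⟨V, hV⟩ := exists_gate_of_orthonormal (h hu) (h hv)
  exact ⟨V, hV ()⟩

theorem norm_sum_smul_ket {I ι : Type*} [Fintype I] [DecidableEq I] [Fintype ι] {e : ι → I}
    (he : Function.Injective e) (c : ι → ℂ) : ‖∑ i, c i • (ket (e i) : Hil I)‖ ^ 2 = normSq c := by
  have h : Orthonormal ℂ fun i => (ket (e i) : Hil I) := orthonormal_ket.comp e he
  rw [← inner_self_eq_norm_sq (𝕜 := ℂ), h.inner_sum]
  simp only [normSq, RCLike.re_eq_complex_re, Complex.re_sum]
  refine Finset.sum_congr rfl fun i _ => ?_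
  rw [mul_comm, Complex.mul_conj, Complex.ofReal_re, Complex.normSq_eq_norm_sq]

theorem normSq_uniformVec (h : M ≤ N) : normSq (uniformVec N M) = 1 :=
  normSq_uniformOn (by rw [Finset.card_univ]; exact card_subsets_pos h)

/-- The basis state in which the algorithm starts. -/
def startIdx : Base N m := (0, 0, (zeroLabel ∅, false))

/-- A uniform superposition of subsets with zero values is prepared without queries, the M values
are loaded with two queries each, and a fixed gate spreads the first register over the indices
outside the subset. -/
theorem exists_start_circuit (h : M < N) :
    ∃ A : (Fin N → Fin m) → Gate (Base N m), Circuit (2 * M) A ∧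
      ∀ f, A f (ket startIdx) = embed f (uniformVec N M) := by
  have hinj : Function.Injective fun s : Subsets N M =>
      ((0, 0, (zeroLabel s.1, false)) : Base N m) := fun s t hst => by
    simp only [Prod.mk.injEq, and_true, true_and] at hst
    exact Subtype.ext (zeroLabel_injective hst)
  obtain ⟨V, hV⟩ := exists_gate_of_norm_eq_one (norm_ket (startIdx : Base N m))
    (v := ∑ s : Subsets N M, uniformVec N M s • ket (0, 0, (zeroLabel s.1, false))) (by
      rw [← sq_eq_sq₀ (norm_nonneg _) zero_le_one, norm_sum_smul_ket hinj, normSq_uniformVec h.le,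
        one_pow])
  have hinj2 : Function.Injective fun g : Labels N m M => ((0, 0, (g.1, false)) : Base N m) :=
    fun g g' hg => by
      simp only [Prod.mk.injEq, and_true, true_and] at hg
      exact Subtype.ext hg
  obtain ⟨X, hX⟩ := exists_gate_of_orthonormal
    ((orthonormal_ket (I := Base N m)).comp _ hinj2) (orthonormal_outerStar (m := m) h)
  refine ⟨fun f => X * (permGate (loadPerm f M) * V),
    ((Circuit.gate X).mul ((loadPerm_circuit M).mul (Circuit.gate V))).of_eq (by ring),
    fun f => ?_⟩
  change X (permGate (loadPerm f M) (V (ket startIdx))) = _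
  rw [hV, map_sum, map_sum, embed]
  refine Finset.sum_congr rfl fun s _ => ?_
  have hl := loadPerm_apply f s.1 false
  rw [s.2] at hl
  rw [map_smul, map_smul, permGate_ket, hl]
  exact congrArg _ (hX ⟨restrict f s.1, by rw [supp_restrict, s.2]⟩)

/-- A final gate that moves the amplitudes back to basis states, with phases. -/
theorem exists_final_gate (h : M < N) {ω₀ ω₁ : ℂ} (h₀ : ‖ω₀‖ = 1) (h₁ : ‖ω₁‖ = 1) :
    ∃ V : Gate (Base N m), ∀ g : Label N m, g.supp.card = M →
      V (outerStar g) = ω₀ • ket (0, 0, (g, false)) ∧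
      V (pendState g) = ω₁ • ket (0, 0, (g, true)) := by
  have o1 : Orthonormal ℂ (Sum.elim (fun g : Labels N m M => outerStar g.1)
      (fun g : Labels N m M => pendState g.1)) := by
    classical
    rw [orthonormal_iff_ite]
    rintro (g | g) (g' | g')
    · have := orthonormal_iff_ite.1 (orthonormal_outerStar (m := m) h) g g'
      simpa using this
    · simpa using inner_outerStar_pendState g.1 g'.1
    · simpa using inner_pendState_outerStar g.1 g'.1
    · simp [inner_pendState, Subtype.ext_iff]
  have n₀ : ω₀ * (starRingEnd ℂ) ω₀ = 1 := by
    rw [Complex.mul_conj', h₀]; simp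
  have n₁ : ω₁ * (starRingEnd ℂ) ω₁ = 1 := by
    rw [Complex.mul_conj', h₁]; simp
  have o2 : Orthonormal ℂ (Sum.elim
      (fun g : Labels N m M => ω₀ • (ket (0, 0, (g.1, false)) : Hil (Base N m)))
      (fun g : Labels N m M => ω₁ • (ket (0, 0, (g.1, true)) : Hil (Base N m)))) := by
    classical
    rw [orthonormal_iff_ite]
    rintro (g | g) (g' | g') <;>
      simp only [Sum.elim_inl, Sum.elim_inr, inner_smul_left, inner_smul_right, inner_ket_left,
        ket_apply, Prod.mk.injEq, true_and, and_true, Sum.inl.injEq, Sum.inr.injEq, Subtype.ext_iff,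
        reduceCtorEq, and_false, if_false, mul_zero]
    · split_ifs
      · rw [mul_one]; exact n₀
      · simp
    · split_ifs
      · rw [mul_one]; exact n₁
      · simp
  obtain ⟨V, hV⟩ := exists_gate_of_orthonormal o1 o2
  exact ⟨V, fun g hg => ⟨hV (Sum.inl ⟨g, hg⟩), hV (Sum.inr ⟨g, hg⟩)⟩⟩

end prepare

end EDWalk

namespace EDWalk

set_option linter.unusedSectionVars false

/-! ### Averaging the powers of the walk operator -/

section average

variable {N m M : ℕ} [NeZero N] [NeZero m]

/-- A step of the walk of the query algorithm. -/
noncomputable def walkStep (M : ℕ) (γ : ℝ) (f : Fin N → Fin m) : Gate (Base N m) :=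
  shift M f * coin M γ

theorem walkStep_apply (γ : ℝ) (f : Fin N → Fin m) (v : Hil (Base N m)) :
    walkStep M γ f v = shift M f (coin M γ v) := rfl

theorem walkStep_circuit (γ : ℝ) : Circuit 4 fun f : Fin N → Fin m => walkStep M γ f :=
  (shift_circuit.mul (Circuit.gate (coin M γ))).of_eq (by norm_num)

instance {Y : Type} [DecidableEq Y] : DecidableEq (Fin N × Fin m × ((Label N m × Bool) × Y)) :=
  instDecidableEqProd

variable {K : ℕ}

/-- The registers with an additional control register in front. -/
abbrev controlEquiv (N m K : ℕ) : Fin N × Fin m × ((Label N m × Bool) × Fin K) ≃ Fin K × Base N m :=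
  Circuit.spectatorEquiv N m (Label N m × Bool) (Fin K)

/-- Only the reflections are controlled. The index toggles always run and cancel when the reflection
between them is absent, so no controlled query is needed. -/
theorem controlled_walkStep_circuit (γ : ℝ) (c : Fin K → Prop) [DecidablePred c] :
    Circuit 4 fun f : Fin N → Fin m =>
      blockGate (controlEquiv N m K) fun x => if c x then walkStep M γ f else 1 := by
  have hθ := (indexToggle_circuit (N := N) (m := m)).spectator (Y := Fin K)
  have h := hθ.mul ((Circuit.gate (blockGate (controlEquiv N m K) fun x => if c x then
    familyReflection (fun g : Labels N m (M + 1) => starState g.1.supp g.1) else 1)).mul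
      (hθ.mul (Circuit.gate (blockGate (controlEquiv N m K) fun x =>
        if c x then coin M γ else 1))))
  refine (h.of_eq (by norm_num)).congr fun f => ?_
  rw [← blockGate_mul, ← blockGate_mul, ← blockGate_mul]
  congr 1
  funext x
  split_ifs
  · simp only [walkStep, shift, mul_assoc]
  · rw [one_mul, mul_one]
    exact LinearIsometryEquiv.ext fun v => indexToggle_mul_self f v

/-- The controlled powers of the walk step, up to the power `j`. -/
noncomputable def controlledPow (M K : ℕ) (γ : ℝ) (f : Fin N → Fin m) :
    ℕ → Gate (Fin N × Fin m × ((Label N m × Bool) × Fin K))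
  | 0 => 1
  | j + 1 => (blockGate (controlEquiv N m K) fun x => if j < x.1 then walkStep M γ f else 1) *
      controlledPow M K γ f j

theorem controlledPow_circuit (γ : ℝ) (j : ℕ) :
    Circuit (4 * j) fun f : Fin N → Fin m => controlledPow M K γ f j := by
  induction j with
  | zero => exact Circuit.gate 1
  | succ j ih =>
    exact ((controlled_walkStep_circuit γ fun x : Fin K => j < x.1).mul ih).of_eq (by ring)

theorem slice_controlledPow (γ : ℝ) (f : Fin N → Fin m) (j : ℕ) (x : Fin K)
    (v : Hil (Fin N × Fin m × ((Label N m × Bool) × Fin K))) :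
    slice (controlEquiv N m K) x (controlledPow M K γ f j v) =
      (walkStep M γ f ^ min x.1 j) (slice (controlEquiv N m K) x v) := by
  induction j with
  | zero => simp [controlledPow]
  | succ j ih =>
    rw [controlledPow]
    change slice (controlEquiv N m K) x (blockGate (controlEquiv N m K)
      (fun x => if j < x.1 then walkStep M γ f else 1) (controlledPow M K γ f j v)) = _
    rw [slice_blockGate, ih]
    split_ifs with h
    · rw [min_eq_right h.le, min_eq_right h, pow_succ_apply']
    · rw [min_eq_left (not_lt.1 h), min_eq_left (by omega)]
      rfl

variable [NeZero K]

/-- Some gate of the control register maps `|0⟩` to the uniform superposition. -/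
theorem exists_uniform_gate (K : ℕ) [NeZero K] : ∃ V : Gate (Fin K),
    (∀ x, V (ket 0) x = ((1 / √(K : ℝ) : ℝ) : ℂ)) ∧
    ∀ v, V⁻¹ v 0 = ((1 / √(K : ℝ) : ℝ) : ℂ) * ∑ x, v x := by
  have hK : (0 : ℝ) < K := by exact_mod_cast Nat.pos_of_ne_zero (NeZero.ne K)
  obtain ⟨V, hV⟩ := exists_gate_of_norm_eq_one (norm_ket (0 : Fin K))
    (v := WithLp.toLp 2 fun _ => ((1 / √(K : ℝ) : ℝ) : ℂ)) (by
      rw [← sq_eq_sq₀ (norm_nonneg _) zero_le_one, EuclideanSpace.norm_sq_eq]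
      simp only [Complex.norm_real, Real.norm_eq_abs, sq_abs, div_pow, one_pow,
        Real.sq_sqrt hK.le, Finset.sum_const, Finset.card_univ, Fintype.card_fin, nsmul_eq_mul]
      field_simp)
  refine ⟨V, fun x => by rw [hV], fun v => ?_⟩
  have h : inner ℂ (V (ket 0)) v = inner ℂ (ket 0) (V⁻¹ v) := by
    conv_lhs => rw [← LinearIsometryEquiv.apply_symm_apply V v]
    exact V.inner_map_map _ _
  rw [inner_ket_left] at h
  rw [← h, hV, PiLp.inner_apply, Finset.mul_sum]
  refine Finset.sum_congr rfl fun x _ => ?_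
  simp only [RCLike.inner_apply, Complex.conj_ofReal, mul_comm]

/-- A uniform control register selects the power of the walk. Undoing its preparation and reading
off the component at 0 collects the branches with equal weights; the two factors 1/√K give the mean.
-/
theorem exists_average_circuit {q : ℕ} {A : (Fin N → Fin m) → Gate (Base N m)} (hA : Circuit q A)
    (start : Base N m) (γ : ℝ) :
    ∃ B : (Fin N → Fin m) → Gate (Fin N × Fin m × ((Label N m × Bool) × Fin K)),
      Circuit (q + 4 * K) B ∧ ∀ f,
        slice (controlEquiv N m K) 0 (B f (ket ((controlEquiv N m K).symm (0, start)))) =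
          (1 / (K : ℂ)) • ∑ x ∈ Finset.range K, (walkStep M γ f ^ x) (A f (ket start)) := by
  obtain ⟨V, hV, hV'⟩ := exists_uniform_gate K
  have hK : (0 : ℝ) < K := by exact_mod_cast Nat.pos_of_ne_zero (NeZero.ne K)
  let e := controlEquiv N m K
  let e' := e.trans (Equiv.prodComm _ _)
  refine ⟨fun f => blockGate e' (fun _ => V⁻¹) * (controlledPow M K γ f K *
    (blockGate e' (fun _ => V) * blockGate e (fun _ => A f))),
    ((Circuit.gate _).mul ((controlledPow_circuit γ K).mul
      ((Circuit.gate _).mul hA.spectator))).of_eq (by ring), fun f => ?_⟩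
  change slice e 0 (blockGate e' (fun _ => V⁻¹) (controlledPow M K γ f K
    (blockGate e' (fun _ => V) (blockGate e (fun _ => A f) (ket (e.symm (0, start))))))) = _
  set u := A f (ket start) with hu
  set v0 := blockGate e (fun _ => A f) (ket (e.symm (0, start))) with hv0
  have h0 : ∀ x, slice e x v0 = if x = 0 then u else 0 := by
    intro x
    have : slice e x (ket (e.symm (0, start))) = if x = 0 then ket start else 0 := by
      ext b
      rw [slice_apply, ket_apply]
      simp only [EmbeddingLike.apply_eq_iff_eq, Prod.mk.injEq]
      by_cases hx : x = 0 <;> simp [hx, ket_apply]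
    rw [hv0, slice_blockGate, this]
    split_ifs
    · rfl
    · rw [map_zero]
  have hflip : ∀ (v : Hil (Fin N × Fin m × ((Label N m × Bool) × Fin K))) (x : Fin K) (b : Base N m),
      slice e x v b = slice e' b v x := fun v x b => rfl
  have h1 : ∀ x, slice e x (blockGate e' (fun _ => V) v0) = ((1 / √(K : ℝ) : ℝ) : ℂ) • u := by
    intro x
    ext b
    have : slice e' b v0 = u b • ket 0 := by
      ext y
      rw [← hflip, h0]
      by_cases hy : y = 0 <;> simp [hy, ket_apply]
    rw [hflip, slice_blockGate, this, map_smul, PiLp.smul_apply, hV, PiLp.smul_apply, smul_eq_mul,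
      smul_eq_mul, mul_comm]
  have h2 : ∀ x : Fin K, slice e x (controlledPow M K γ f K (blockGate e' (fun _ => V) v0)) =
      ((1 / √(K : ℝ) : ℝ) : ℂ) • (walkStep M γ f ^ x.1) u := fun x => by
    rw [slice_controlledPow, h1, map_smul, min_eq_left x.2.le]
  ext b
  rw [hflip, slice_blockGate, hV']
  simp only [← hflip, h2]
  rw [Finset.sum_range fun x => (walkStep M γ f ^ x) u]
  simp only [PiLp.smul_apply, WithLp.ofLp_sum, Finset.sum_apply, smul_eq_mul, ← Finset.mul_sum]
  rw [← mul_assoc, ← Complex.ofReal_mul, div_mul_div_comm, Real.mul_self_sqrt hK.le]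
  push_cast
  ring

end average

/-! ### Element distinctness -/

section distinctness

variable {N m : ℕ} [NeZero N] [NeZero m]

theorem mem_of_pairCount_eq_two {x y : Fin N} {s : Finset (Fin N)} (h : pairCount x y s = 2) :
    x ∈ s ∧ y ∈ s := by
  unfold pairCount at h
  by_cases hx : x ∈ s <;> by_cases hy : y ∈ s <;> simp_all

theorem collides_of_classVec_ne_zero {M : ℕ} {f : Fin N → Fin m} {x y : Fin N} (hxy : x ≠ y)
    (hf : f x = f y) {s : Subsets N M} (h : classVec M x y 2 s ≠ 0) :
    (restrict f s.1).Collides := by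
  rw [classVec, uniformOn_apply] at h
  have hs : s ∈ pairClass M x y 2 := by
    by_contra hn
    exact h (if_neg hn)
  obtain ⟨hx, hy⟩ := mem_of_pairCount_eq_two (mem_pairClass.1 hs)
  exact (collides_restrict f s.1).2 ⟨x, hx, y, hy, hxy, hf⟩

theorem not_collides_of_injective {f : Fin N → Fin m} (hf : Function.Injective f)
    (s : Finset (Fin N)) : ¬ (restrict f s).Collides := by
  rw [collides_restrict]
  rintro ⟨x, _, y, _, hxy, h⟩
  exact hxy (hf h)

theorem norm_embed_uniformVec {M : ℕ} (h : M < N) (f : Fin N → Fin m) :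
    ‖embed f (uniformVec N M)‖ = 1 := by
  have h1 := inner_self_eq_norm_sq (𝕜 := ℂ) (embed f (uniformVec N M))
  rw [inner_embed_embed h, star_dotProduct_self, normSq_uniformVec h.le] at h1
  rw [← sq_eq_sq₀ (norm_nonneg _) zero_le_one, ← h1]
  simp

/-- The sum telescopes to w - U^K w with w = ζ/(2α) + s/2, and ‖w‖ is of order ‖ζ‖/α, that is
N^{1/3} · N^{1/3}. -/
theorem norm_average_le {f : Fin N → Fin m} (hN : 1000 ≤ N) {x y : Fin N} (hxy : x ≠ y)
    (hf : f x = f y) (K : ℕ) :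
    ‖∑ j ∈ Finset.range K, (walkStep (subsetSize N) (Real.pi / 2) f ^ j)
      (embed f (uniformVec N (subsetSize N)))‖ ≤ 6 * (N : ℝ) ^ (2 / 3 : ℝ) := by
  obtain ⟨h1, h2, h3⟩ := real_bounds (N := N) (by omega)
  obtain ⟨-, h5⟩ := subsetSize_bounds N
  have hMN : subsetSize N < N := by
    have : (subsetSize N : ℝ) < N := by linarith
    exact_mod_cast this
  obtain ⟨ζ, hζ, hR, hn⟩ := exists_reversed_vector h1 h2 f hxy
  obtain ⟨ha1, ha2⟩ := flatVec_two_mul_bounds hN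
  have h23 := rpow_third_sq N
  have hc3 := rpow_third_cube N
  have hN' : (1000 : ℝ) ≤ N := by exact_mod_cast hN
  set T := (N : ℝ) ^ (1 / 3 : ℝ) with hT
  set α := flatVec N (subsetSize N) 2 with hα
  have hT0 : 0 < T := by positivity
  have h10 : 10 ≤ T := by
    refine le_of_pow_le_pow_left₀ (n := 3) (by norm_num) hT0.le ?_
    rw [hc3]; linarith
  have hα0 : 0 < α := by
    by_contra! h
    nlinarith
  -- At γ = π/2 the coin reverses every colliding subset. Only collision of this one pair is used,
  -- so the other collisions of f do not matter.
  have ha : coin (subsetSize N) (Real.pi / 2) (embed f (classVec (subsetSize N) x y 2)) =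
      -embed f (classVec (subsetSize N) x y 2) := by
    rw [coin_embed_of_marked _ hMN f fun s hs => collides_of_classVec_ne_zero hxy hf hs,
      mul_div_cancel₀ _ (two_ne_zero), Real.cos_pi, Real.sin_pi]
    simp
  have key := sub_mul_eq_of_reversed hα0.ne' (shift_embed_uniformVec h1 h2 f) hζ ha
    (hR (Real.pi / 2))
  refine (norm_sum_pow_le (walkStep (subsetSize N) (Real.pi / 2) f) key K).trans ?_
  have hζn : ‖ζ‖ ≤ 2 * T := by
    refine le_of_pow_le_pow_left₀ (n := 2) (by norm_num) (by positivity) (hn.trans ?_)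
    rw [← h23] at h5
    nlinarith
  have hαi : 1 / (2 * α) ≤ T := by
    rw [div_le_iff₀ (by positivity)]
    linarith
  have hw := norm_add_le (((1 / (2 * α) : ℝ) : ℂ) • ζ)
    ((1 / 2 : ℂ) • embed f (uniformVec N (subsetSize N)))
  rw [norm_ofReal_smul, abs_of_nonneg (by positivity), norm_smul, norm_embed_uniformVec hMN] at hw
  have h6 : 1 / (2 * α) * ‖ζ‖ ≤ T * (2 * T) := by gcongr
  have h7 : ‖(1 / 2 : ℂ)‖ = 1 / 2 := by simp
  rw [h7] at hw
  rw [← h23]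
  nlinarith

theorem walkStep_of_injective {f : Fin N → Fin m} (hN : 5 ≤ N) (hf : Function.Injective f) (γ : ℝ) :
    walkStep (subsetSize N) γ f (embed f (uniformVec N (subsetSize N))) =
      embed f (uniformVec N (subsetSize N)) := by
  obtain ⟨h1, h2, h3⟩ := real_bounds hN
  have hMN : subsetSize N < N := by
    have : (subsetSize N : ℝ) < N := by linarith
    exact_mod_cast this
  rw [walkStep_apply, coin_embed_of_unmarked γ hMN f fun s _ => not_collides_of_injective hf s.1,
    shift_embed_uniformVec h1 h2]

theorem walkStep_pow_of_injective {f : Fin N → Fin m} (hN : 5 ≤ N) (hf : Function.Injective f)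
    (γ : ℝ) (k : ℕ) :
    (walkStep (subsetSize N) γ f ^ k) (embed f (uniformVec N (subsetSize N))) =
      embed f (uniformVec N (subsetSize N)) := by
  induction k with
  | zero => rfl
  | succ k ih => rw [pow_succ_apply', ih, walkStep_of_injective hN hf]

/-- Accept when the control register is not 0; the probability is 1 minus the squared norm of the
average. With K ≥ 12N^{2/3} a collision makes the average at most 1/2 and acceptance at least 3/4.
Without one the walk fixes s, and acceptance has probability 0. -/
theorem exists_algorithm_distinctness_large (hN : 1000 ≤ N) :
    ∃ Q : QueryAlgorithm N m, (Q.queries : ℝ) ≤ 2000 * (N : ℝ) ^ (2 / 3 : ℝ) ∧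
        ∃ E : Finset Q.Idx, ∀ f : Fin N → Fin m,
          ((∃ x y, x ≠ y ∧ f x = f y) → 2 / 3 ≤ Q.prob f E) ∧
          ((¬ ∃ x y, x ≠ y ∧ f x = f y) → Q.prob f E ≤ 1 / 3) := by
  obtain ⟨h1, h2, h3⟩ := real_bounds (N := N) (by omega)
  obtain ⟨-, h5⟩ := subsetSize_bounds N
  have hMN : subsetSize N < N := by
    have : (subsetSize N : ℝ) < N := by linarith
    exact_mod_cast this
  set R := (N : ℝ) ^ (2 / 3 : ℝ) with hR
  have hR1 : 1 ≤ R := Real.one_le_rpow (by linarith) (by norm_num)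
  obtain ⟨A, hA, hAs⟩ := exists_start_circuit (N := N) (m := m) hMN
  set K := ⌈12 * R⌉₊ with hK
  have hKR : 12 * R ≤ K := Nat.le_ceil _
  have hKR' : (K : ℝ) ≤ 12 * R + 1 := (Nat.ceil_lt_add_one (by positivity)).le
  have hK0 : (0 : ℝ) < K := by linarith
  have : NeZero K := ⟨by exact_mod_cast hK0.ne'⟩
  obtain ⟨B, hB, hBs⟩ := exists_average_circuit (M := subsetSize N) (K := K) hA startIdx
    (Real.pi / 2)
  obtain ⟨gate, hg⟩ := hB.exists_algorithm ((controlEquiv N m K).symm (0, startIdx))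
  refine ⟨⟨(Label N m × Bool) × Fin K, 2 * subsetSize N + 4 * K, gate,
    (controlEquiv N m K).symm (0, startIdx)⟩, ?_, Finset.univ.filter fun p => p.2.2.2 ≠ 0, ?_⟩
  · push_cast
    linarith
  · intro f
    set v := B f (ket ((controlEquiv N m K).symm (0, startIdx))) with hv
    have hp : QueryAlgorithm.prob ⟨(Label N m × Bool) × Fin K, 2 * subsetSize N + 4 * K, gate,
        (controlEquiv N m K).symm (0, startIdx)⟩ f (Finset.univ.filter fun p => p.2.2.2 ≠ 0) =
        1 - ‖slice (controlEquiv N m K) 0 v‖ ^ 2 := by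
      have hn : ‖v‖ ^ 2 = 1 := by rw [hv, LinearIsometryEquiv.norm_map, norm_ket, one_pow]
      have h0 : ∑ p ∈ Finset.univ.filter (fun p : Fin N × Fin m × ((Label N m × Bool) × Fin K) =>
          p.2.2.2 = 0), ‖v p‖ ^ 2 = ‖slice (controlEquiv N m K) 0 v‖ ^ 2 := by
        rw [Finset.sum_filter, ← (controlEquiv N m K).symm.sum_comp, Fintype.sum_prod_type,
          Finset.sum_eq_single 0, EuclideanSpace.norm_sq_eq]
        · refine Finset.sum_congr rfl fun b _ => ?_
          exact if_pos rfl
        · intro x _ hx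
          exact Finset.sum_eq_zero fun b _ => if_neg hx
        · exact fun h => absurd (Finset.mem_univ _) h
      rw [QueryAlgorithm.prob, ← hn, ← h0, EuclideanSpace.norm_sq_eq, eq_sub_iff_add_eq, add_comm,
        ← Finset.sum_filter_add_sum_filter_not Finset.univ fun p => p.2.2.2 = 0]
      congr 1
      refine Finset.sum_congr rfl fun p _ => ?_
      rw [QueryAlgorithm.final, hg]
    rw [hp, hBs, hAs]
    constructor
    · rintro ⟨x, y, hxy, hf⟩
      have h := norm_average_le hN hxy hf K
      rw [← hR] at h
      have h6 : ‖(1 / (K : ℂ)) • ∑ j ∈ Finset.range K, (walkStep (subsetSize N) (Real.pi / 2) f ^ j)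
          (embed f (uniformVec N (subsetSize N)))‖ ≤ 1 / 2 := by
        rw [norm_smul, norm_div, norm_one, Complex.norm_natCast, one_div, inv_mul_le_iff₀ hK0]
        linarith
      have h7 := pow_le_pow_left₀ (norm_nonneg _) h6 2
      linarith
    · intro hf
      have hinj : Function.Injective f := fun x y hxy => by
        by_contra hne
        exact hf ⟨x, y, hne, hxy⟩
      simp only [walkStep_pow_of_injective (show 5 ≤ N by omega) hinj]
      rw [Finset.sum_const, Finset.card_range, ← Nat.cast_smul_eq_nsmul ℂ, smul_smul,
        one_div_mul_cancel (by exact_mod_cast hK0.ne'), one_smul, norm_embed_uniformVec hMN]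
      norm_num

theorem restrict_univ_collides (f : Fin N → Fin m) :
    (restrict f Finset.univ).Collides ↔ ∃ x y, x ≠ y ∧ f x = f y := by
  rw [collides_restrict]
  simp

/-- Read all of f with 2N queries and inspect the table; 2N < 2000 accounts for the constant. -/
theorem exists_algorithm_distinctness_small (hN : N < 1000) :
    ∃ Q : QueryAlgorithm N m, (Q.queries : ℝ) ≤ 2000 * (N : ℝ) ^ (2 / 3 : ℝ) ∧
        ∃ E : Finset Q.Idx, ∀ f : Fin N → Fin m,
          ((∃ x y, x ≠ y ∧ f x = f y) → 2 / 3 ≤ Q.prob f E) ∧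
          ((¬ ∃ x y, x ≠ y ∧ f x = f y) → Q.prob f E ≤ 1 / 3) := by
  classical
  obtain ⟨gate, hg⟩ := (loadPerm_circuit (N := N) (m := m) N).exists_algorithm
    (0, 0, (zeroLabel Finset.univ, false))
  refine ⟨⟨Label N m × Bool, 2 * N, gate, (0, 0, (zeroLabel Finset.univ, false))⟩, ?_,
    Finset.univ.filter fun p => p.2.2.1.Collides, fun f => ?_⟩
  · have h1 : (1 : ℝ) ≤ N := by exact_mod_cast Nat.one_le_iff_ne_zero.2 (NeZero.ne N)
    have h2 : 1 ≤ (N : ℝ) ^ (2 / 3 : ℝ) := Real.one_le_rpow h1 (by norm_num)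
    have h3 : (N : ℝ) < 1000 := by exact_mod_cast hN
    push_cast
    linarith
  · have hl := loadPerm_apply f Finset.univ false
    rw [Finset.card_univ, Fintype.card_fin] at hl
    have hp : QueryAlgorithm.prob ⟨Label N m × Bool, 2 * N, gate,
        (0, 0, (zeroLabel Finset.univ, false))⟩ f (Finset.univ.filter fun p => p.2.2.1.Collides) =
        if ∃ x y, x ≠ y ∧ f x = f y then 1 else 0 := by
      have : ∀ p, ‖QueryAlgorithm.final ⟨Label N m × Bool, 2 * N, gate,
          (0, 0, (zeroLabel Finset.univ, false))⟩ f p‖ ^ 2 =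
          if p = (0, 0, (restrict f Finset.univ, false)) then 1 else 0 := fun p => by
        rw [QueryAlgorithm.final, hg, permGate_ket, hl, ket_apply]
        split_ifs <;> simp
      simp only [QueryAlgorithm.prob, this]
      rw [Finset.sum_ite_eq']
      simp only [Finset.mem_filter, Finset.mem_univ, true_and, restrict_univ_collides]
    rw [hp]
    constructor
    · intro h; rw [if_pos h]; norm_num
    · intro h; rw [if_neg h]; norm_num

end distinctness

theorem element_distinctness : ∃ C > (0 : ℝ), ∀ N : ℕ, 1 ≤ N → ∀ m : ℕ, 1 ≤ m →
      ∃ Q : QueryAlgorithm N m, (Q.queries : ℝ) ≤ C * (N : ℝ) ^ (2 / 3 : ℝ) ∧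
        ∃ E : Finset Q.Idx, ∀ f : Fin N → Fin m,
          ((∃ x y, x ≠ y ∧ f x = f y) → 2 / 3 ≤ Q.prob f E) ∧
          ((¬ ∃ x y, x ≠ y ∧ f x = f y) → Q.prob f E ≤ 1 / 3) := by
  refine ⟨2000, by norm_num, fun N hN m hm => ?_⟩
  have : NeZero N := ⟨by omega⟩
  have : NeZero m := ⟨by omega⟩
  rcases lt_or_ge N 1000 with h | h
  · exact exists_algorithm_distinctness_small h
  · exact exists_algorithm_distinctness_large h

end EDWalk

namespace EDWalk

set_option linter.unusedSectionVars false

/-! ### Fidelity of encoded states -/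

section fidelity

variable {N m : ℕ}

theorem vertexLabel_injective (f : Fin N → Fin m) : Function.Injective (vertexLabel f) := by
  rintro (s | s) (t | t) h
  · rw [vertexLabel_inl, vertexLabel_inl, Prod.mk.injEq] at h
    rw [Subtype.ext (restrict_injective f h.2)]
  · rw [vertexLabel_inl, vertexLabel_inr, Prod.mk.injEq] at h
    exact absurd h.1 (by simp)
  · rw [vertexLabel_inl, vertexLabel_inr, Prod.mk.injEq] at h
    exact absurd h.1 (by simp)
  · rw [vertexLabel_inr, vertexLabel_inr, Prod.mk.injEq] at h
    rw [Subtype.ext (Subtype.ext (restrict_injective f h.2))]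

theorem norm_sum_star_mul_le {I ι : Type*} [Fintype I] [Fintype ι] {e : ι → I}
    (he : Function.Injective e) {ψ : ι → ℂ} (hψ : normSq ψ = 1) (x : Hil I) :
    ‖∑ v, star (ψ v) * x (e v)‖ ≤ ‖x‖ := by
  have h1 : ‖∑ v, star (ψ v) * x (e v)‖ ≤ ∑ v, ‖ψ v‖ * ‖x (e v)‖ := by
    refine (norm_sum_le _ _).trans_eq (Finset.sum_congr rfl fun v _ => ?_)
    rw [norm_mul, norm_star]
  have h2 := Finset.sum_mul_sq_le_sq_mul_sq Finset.univ (fun v => ‖ψ v‖) (fun v => ‖x (e v)‖)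
  have h3 : ∑ v, ‖ψ v‖ ^ 2 = 1 := hψ
  have h4 : ∑ v, ‖x (e v)‖ ^ 2 ≤ ‖x‖ ^ 2 := by
    rw [EuclideanSpace.norm_sq_eq]
    have := Finset.sum_map Finset.univ ⟨e, he⟩ fun i => ‖x i‖ ^ 2
    simp only [Function.Embedding.coeFn_mk] at this
    rw [← this]
    exact Finset.sum_le_univ_sum_of_nonneg fun i => sq_nonneg _
  refine h1.trans (le_of_pow_le_pow_left₀ (n := 2) (by norm_num) (norm_nonneg _) ?_)
  rw [h3, one_mul] at h2
  exact h2.trans h4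

/-- Fidelity with a unit vector changes by at most the distance between the states, so an
approximation of the final state suffices. -/
theorem sub_le_norm_sum_star_mul {I ι : Type*} [Fintype I] [Fintype ι] {e : ι → I}
    (he : Function.Injective e) {ψ : ι → ℂ} (hψ : normSq ψ = 1) (x y : Hil I) :
    ‖∑ v, star (ψ v) * y (e v)‖ - ‖x - y‖ ≤ ‖∑ v, star (ψ v) * x (e v)‖ := by
  have h := norm_sum_star_mul_le he hψ (x - y)
  have e1 : ∑ v, star (ψ v) * y (e v) = ∑ v, star (ψ v) * x (e v) -
      ∑ v, star (ψ v) * (x - y) (e v) := by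
    rw [← Finset.sum_sub_distrib]
    refine Finset.sum_congr rfl fun v _ => ?_
    rw [PiLp.sub_apply]
    ring
  rw [e1]
  have := norm_sub_le (∑ v, star (ψ v) * x (e v)) (∑ v, star (ψ v) * (x - y) (e v))
  linarith

theorem walkHamiltonian_isHermitian (f : Fin N → Fin m) : (walkHamiltonian f).IsHermitian := by
  refine Matrix.IsHermitian.fromBlocks ?_ ?_ ?_
  · ext s t
    have h1 : (johnsonGraph N (subsetSize N)).adjMatrix ℂ s t =
        (johnsonGraph N (subsetSize N)).adjMatrix ℂ t s :=
      (johnsonGraph N (subsetSize N)).isSymm_adjMatrix.apply t s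
    have h2 : star ((johnsonGraph N (subsetSize N)).adjMatrix ℂ t s) =
        (johnsonGraph N (subsetSize N)).adjMatrix ℂ t s := by
      rw [SimpleGraph.adjMatrix_apply]
      split_ifs <;> simp
    rw [Matrix.conjTranspose_apply, Matrix.smul_apply, Matrix.smul_apply, Matrix.sub_apply,
      Matrix.sub_apply, Matrix.smul_apply, Matrix.smul_apply, h1, star_smul, star_sub, h2,
      Matrix.one_apply, Matrix.one_apply]
    by_cases h : s = t
    · simp [h]
    · simp [h, Ne.symm h]
  · ext b s
    simp only [Matrix.conjTranspose_apply, Matrix.of_apply]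
    split_ifs <;> simp
  · exact Matrix.isHermitian_zero

theorem normSq_walkState [NeZero N] (f : Fin N → Fin m) (t : ℝ) : normSq (walkState f t) = 1 := by
  rw [walkState, normSq_mulVec_of_isometry (evolution_isometry (walkHamiltonian_isHermitian f) t)]
  refine normSq_uniformOn ?_
  obtain ⟨s⟩ := Fintype.card_pos_iff.1 (card_subsets_pos (subsetSize_le N))
  exact Finset.card_pos.2 ⟨Sum.inl s, by simp [originalVertices]⟩

theorem evolution_mulVec_of_eq_zero {ι : Type*} [Fintype ι] [DecidableEq ι] {X : Matrix ι ι ℂ}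
    {u : ι → ℂ} (h : X *ᵥ u = 0) (t : ℝ) : evolution X t *ᵥ u = u := by
  have h1 : ((-(Complex.I * (t : ℂ))) • X) * Matrix.replicateCol (Fin 1) u =
      Matrix.replicateCol (Fin 1) u * (0 : Matrix (Fin 1) (Fin 1) ℂ) := by
    rw [Matrix.mul_zero, Matrix.smul_mul, ← Matrix.replicateCol_mulVec, h]
    ext
    simp
  have h2 := exp_mul_of_intertwine h1
  rw [NormedSpace.exp_zero, Matrix.mul_one, ← Matrix.replicateCol_mulVec] at h2
  funext i
  exact congrFun (congrFun h2 i) 0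

/-- Without marked subsets there are no pendant vertices, and the uniform vector lies in the kernel
of the Johnson Laplacian. -/
theorem walkState_of_injective (hN : 5 ≤ N) {f : Fin N → Fin m} (hf : Function.Injective f) (t : ℝ) :
    walkState f t = uniformOn (originalVertices f) := by
  obtain ⟨h1, h2, h3⟩ := real_bounds hN
  refine evolution_mulVec_of_eq_zero ?_ t
  have hm : ∀ s, ¬ Marked f s := by
    rintro s ⟨x, _, y, _, hxy, h⟩
    exact hxy (hf h)
  funext v
  rcases v with s | b
  · rw [Matrix.mulVec, dotProduct, Fintype.sum_sum_type]
    have hb : ∑ b : {s : Subsets N (subsetSize N) // Marked f s},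
        walkHamiltonian f (Sum.inl s) (Sum.inr b) * uniformOn (originalVertices f) (Sum.inr b) = 0 :=
      Finset.sum_eq_zero fun b _ => absurd b.2 (hm b.1)
    rw [hb, add_zero]
    simp only [uniformOn_originalVertices_inl]
    refine (sum_johnson_block s _ _).trans ?_
    have hL := congrFun (johnsonLaplacian_uniformVec h1 h2) s
    rw [johnsonLaplacian, Pi.zero_apply, uniformVec, sub_eq_zero] at hL
    rw [hL, sub_self, mul_zero]
    rfl
  · exact absurd b.2 (hm b.1)

theorem star_originalVertices_dotProduct_walkState (hN : 5 ≤ N) {f : Fin N → Fin m} {x y : Fin N}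
    (h : UniqueCollision f x y) (t : ℝ) :
    star (uniformOn (originalVertices f)) ⬝ᵥ walkState f t =
      toC (startVec N) ⬝ᵥ reducedState N t := by
  rw [uniformOn_originalVertices hN h, walkState_eq hN h, star_mulVec_dotProduct,
    Matrix.mulVec_mulVec, reducedBasis_isometry hN h, Matrix.one_mulVec]
  congr 1
  funext i
  simp [toC]

end fidelity

/-! ### Simulation of the continuous-time walk by queries -/

section simulate

variable {N m : ℕ} [NeZero N] [NeZero m]

theorem norm_embed_classVec {M : ℕ} (h1 : (2 : ℝ) ≤ M) (h2 : (M : ℝ) + 2 ≤ N) (f : Fin N → Fin m)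
    {x y : Fin N} (hxy : x ≠ y) : ‖embed f (classVec M x y 2)‖ = 1 := by
  have hMN : M < N := by
    have : (M : ℝ) < N := by linarith
    exact_mod_cast this
  have h := inner_self_eq_norm_sq (𝕜 := ℂ) (embed f (classVec M x y 2))
  have h3 := star_classVec_dotProduct h1 h2 hxy 2 2
  rw [Fin.val_two] at h3
  rw [inner_embed_embed hMN, h3] at h
  rw [← sq_eq_sq₀ (norm_nonneg _) zero_le_one, ← h]
  simp

theorem norm_embedPend_classVec {M : ℕ} (h1 : (2 : ℝ) ≤ M) (h2 : (M : ℝ) + 2 ≤ N)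
    (f : Fin N → Fin m) {x y : Fin N} (hxy : x ≠ y) : ‖embedPend f (classVec M x y 2)‖ = 1 := by
  have hinj : Function.Injective fun s : Subsets N M =>
      ((0, 0, (restrict f s.1, true)) : Base N m) := fun s t hst => by
    simp only [Prod.mk.injEq, and_true, true_and] at hst
    exact Subtype.ext (restrict_injective f hst)
  have h3 := star_classVec_dotProduct h1 h2 hxy 2 2
  rw [Fin.val_two, star_dotProduct_self, if_pos rfl] at h3
  rw [← sq_eq_sq₀ (norm_nonneg _) zero_le_one, one_pow]
  refine (norm_sum_smul_ket hinj _).trans ?_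
  exact_mod_cast h3

/-- Removing αa from s erases the amplitude on all subsets containing the pair. Uniqueness of the
collision makes these the only colliding ones, so the coin fixes the rest. -/
theorem coin_embed_sub {M : ℕ} (γ : ℝ) (h1 : (2 : ℝ) ≤ M) (h2 : (M : ℝ) + 2 ≤ N)
    {f : Fin N → Fin m} {x y : Fin N} (h : UniqueCollision f x y) :
    coin M γ (embed f (uniformVec N M) - (flatVec N M 2 : ℂ) • embed f (classVec M x y 2)) =
      embed f (uniformVec N M) - (flatVec N M 2 : ℂ) • embed f (classVec M x y 2) := by
  have hMN : M < N := by
    have : (M : ℝ) < N := by linarith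
    exact_mod_cast this
  rw [← embed_sub_smul]
  refine coin_embed_of_unmarked γ hMN f fun s hs hc => hs ?_
  obtain ⟨a, ha, b, hb, hab, hf⟩ := (collides_restrict f s.1).1 hc
  have hxs : x ∈ s.1 ∧ y ∈ s.1 := by
    rcases h.2.2 a b hab hf with ⟨rfl, rfl⟩ | ⟨rfl, rfl⟩
    · exact ⟨ha, hb⟩
    · exact ⟨hb, ha⟩
  have hp : pairCount x y s.1 = 2 := by
    rw [pairCount, Finset.inter_eq_right.2, Finset.card_pair h.1]
    intro z hz
    rcases Finset.mem_insert.1 hz with rfl | hz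
    · exact hxs.1
    · rw [Finset.mem_singleton.1 hz]; exact hxs.2
  rw [Pi.sub_apply, Pi.smul_apply, smul_eq_mul, uniformVec, uniformOn_univ_eq_sum h.1 h1 h2,
    Fin.sum_univ_three]
  have h0 : ∀ j ≠ 2, classVec M x y j s = 0 := fun j hj => by
    rw [classVec, uniformOn_apply, if_neg]
    rw [mem_pairClass, hp]
    exact hj.symm
  rw [Fin.val_zero, Fin.val_one, Fin.val_two, h0 0 (by norm_num), h0 1 (by norm_num)]
  ring

/-- The parameters of the rotation: `k` steps with coin angle `φ / 2` rotate by `ϑ`. -/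
theorem exists_rotation_params (hN : 1000 ≤ N) {D ϑ : ℝ} (hD : 1000 ≤ D) (h0 : 0 ≤ ϑ)
    (h1 : ϑ ≤ Real.pi / 2) : ∃ (k : ℕ) (φ : ℝ), 0 ≤ φ ∧ φ ≤ 1 ∧
      k * (flatVec N (subsetSize N) 2 * Real.sin φ) = ϑ ∧ (k : ℝ) ≤ (D + 1) * (N : ℝ) ^ (2 / 3 : ℝ) ∧
      φ * (2 * (N : ℝ) ^ (1 / 3 : ℝ)) ≤ 2 ∧
      9 * k * φ ^ 2 + φ * (2 * (N : ℝ) ^ (1 / 3 : ℝ)) ≤ 460 / D := by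
  obtain ⟨ha1, -⟩ := flatVec_two_mul_bounds hN
  have h23 := rpow_third_sq N
  have hc3 := rpow_third_cube N
  have hN' : (1000 : ℝ) ≤ N := by exact_mod_cast hN
  set T := (N : ℝ) ^ (1 / 3 : ℝ) with hT
  set α := flatVec N (subsetSize N) 2 with hα
  have hT0 : 0 < T := by positivity
  have h10 : 10 ≤ T := by
    refine le_of_pow_le_pow_left₀ (n := 3) (by norm_num) hT0.le ?_
    rw [hc3]; linarith
  have hα0 : 0 < α := by
    by_contra! h
    nlinarith
  have hDT : 1 ≤ D * T ^ 2 := by nlinarith [mul_pos hT0 hT0]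
  -- Taking k ≈ DT² and φ ≤ 5/(DT) makes kφ² and φT both O(1/D): many small steps reach the fixed
  -- angle ϑ with arbitrarily small error.
  set k := ⌈D * T ^ 2⌉₊ with hk
  have hk1 : D * T ^ 2 ≤ k := Nat.le_ceil _
  have hk2 : (k : ℝ) ≤ D * T ^ 2 + 1 := (Nat.ceil_lt_add_one (by positivity)).le
  have hk0 : (0 : ℝ) < k := by linarith
  have hD0 : 0 < D := by linarith
  have hπ : Real.pi ^ 2 ≤ 10 := by nlinarith [Real.pi_lt_d2, Real.pi_pos]
  -- The required value of sin φ for which k steps rotate by exactly ϑ.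
  set q := ϑ / (k * α) with hq
  have hq0 : 0 ≤ q := by positivity
  have hqb : q ≤ Real.pi / (D * T) := by
    rw [hq, div_le_div_iff₀ (by positivity) (by positivity)]
    calc ϑ * (D * T) ≤ Real.pi / 2 * (D * T) := by gcongr
      _ = Real.pi * (D * T * (1 / 2)) := by ring
      _ ≤ Real.pi * (D * T * (α * T)) := by gcongr
      _ = Real.pi * (D * T ^ 2 * α) := by ring
      _ ≤ Real.pi * (k * α) := by gcongr
  have hq1 : q ≤ 1 := by
    refine hqb.trans ?_
    rw [div_le_one (by positivity)]
    nlinarith [Real.pi_lt_d2]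
  set φ := Real.arcsin q with hφ
  have hφ0 : 0 ≤ φ := Real.arcsin_nonneg.2 hq0
  have hsin : Real.sin φ = q := Real.sin_arcsin (by linarith) hq1
  have hφq : φ * (D * T) ≤ 5 := by
    have h := Real.mul_le_sin hφ0 (Real.arcsin_le_pi_div_two q)
    rw [hsin] at h
    have h2 : 2 * φ ≤ q * Real.pi := by
      rw [div_mul_eq_mul_div, div_le_iff₀ Real.pi_pos] at h
      exact h
    rw [le_div_iff₀ (by positivity)] at hqb
    nlinarith [mul_le_mul_of_nonneg_left hqb Real.pi_pos.le, mul_le_mul_of_nonneg_right h2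
      (show 0 ≤ D * T by positivity)]
  have hφT : φ * (2 * T) ≤ 10 / D := by
    rw [le_div_iff₀ hD0]
    linarith
  refine ⟨k, φ, hφ0, ?_, ?_, ?_, ?_, ?_⟩
  · nlinarith [mul_le_mul hD h10 (by norm_num) (by linarith)]
  · rw [hsin, hq]
    field_simp
  · rw [← h23]
    nlinarith
  · refine hφT.trans ?_
    rw [div_le_iff₀ hD0]
    linarith
  · have h5 : 9 * k * φ ^ 2 ≤ 450 / D := by
      rw [le_div_iff₀ hD0]
      calc 9 * k * φ ^ 2 * D ≤ 9 * (2 * (D * T ^ 2)) * φ ^ 2 * D := by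
            gcongr
            linarith
        _ = 18 * (φ * (D * T)) ^ 2 := by ring
        _ ≤ 18 * 5 ^ 2 := by gcongr
        _ = 450 := by norm_num
    calc _ ≤ 450 / D + 10 / D := add_le_add h5 hφT
      _ = _ := by rw [← add_div]; norm_num

theorem exists_phase (y : ℂ) : ∃ ω : ℂ, ‖ω‖ = 1 ∧ ω * star y = (‖y‖ : ℂ) := by
  by_cases h : y = 0
  · exact ⟨1, by simp, by simp [h]⟩
  · have h0 : (‖y‖ : ℂ) ≠ 0 := by simpa using h
    refine ⟨y / ‖y‖, by simp [h], ?_⟩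
    rw [div_mul_eq_mul_div, RCLike.star_def, Complex.mul_conj', sq, mul_div_cancel_right₀ _ h0]

/-- The encoding of the data of a vertex as a basis state. -/
def encode (N m : ℕ) [NeZero N] [NeZero m] : Bool × Label N m ↪ Base N m where
  toFun v := (0, 0, (v.2, v.1))
  inj' v w h := by
    simp only [Prod.mk.injEq, true_and] at h
    exact Prod.ext h.2 h.1

theorem encode_apply (v : Bool × Label N m) : encode N m v = (0, 0, (v.2, v.1)) := rfl

theorem walkStep_rotation (hN : 1000 ≤ N) {f : Fin N → Fin m} {x y : Fin N}
    (h : UniqueCollision f x y) {k : ℕ} {φ : ℝ} (hφ0 : 0 ≤ φ) (hφ1 : φ ≤ 1)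
    (hφT : φ * (2 * (N : ℝ) ^ (1 / 3 : ℝ)) ≤ 2) :
    ‖(walkStep (subsetSize N) (φ / 2) f ^ k) (embed f (uniformVec N (subsetSize N))) -
      ((Real.cos (k * (flatVec N (subsetSize N) 2 * Real.sin φ)) : ℂ) •
          embed f (uniformVec N (subsetSize N)) -
        (Real.sin (k * (flatVec N (subsetSize N) 2 * Real.sin φ)) : ℂ) •
          embedPend f (classVec (subsetSize N) x y 2))‖ ≤
      9 * k * φ ^ 2 + φ * (2 * (N : ℝ) ^ (1 / 3 : ℝ)) := by
  obtain ⟨h1, h2, h3⟩ := real_bounds (N := N) (by omega)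
  obtain ⟨-, h5⟩ := subsetSize_bounds N
  have hMN : subsetSize N < N := by
    have : (subsetSize N : ℝ) < N := by linarith
    exact_mod_cast this
  obtain ⟨ζ, hζ, hR, hn⟩ := exists_reversed_vector h1 h2 f h.1
  obtain ⟨ha1, ha2⟩ := flatVec_two_mul_bounds hN
  have h23 := rpow_third_sq N
  have hc3 := rpow_third_cube N
  have hN' : (1000 : ℝ) ≤ N := by exact_mod_cast hN
  have hc : ∀ s, classVec (subsetSize N) x y 2 s ≠ 0 → (restrict f s.1).Collides := fun s hs =>
    collides_of_classVec_ne_zero h.1 h.2.1 hs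
  have e2 : 2 * (φ / 2) = φ := mul_div_cancel₀ _ two_ne_zero
  have hRa := coin_embed_of_marked (φ / 2) hMN f hc
  have hRb := coin_embedPend_of_marked (φ / 2) hMN f hc
  rw [e2] at hRa hRb
  have hT0 : 0 < (N : ℝ) ^ (1 / 3 : ℝ) := by positivity
  have h10 : 10 ≤ (N : ℝ) ^ (1 / 3 : ℝ) := by
    refine le_of_pow_le_pow_left₀ (n := 3) (by norm_num) hT0.le ?_
    rw [hc3]; linarith
  have hα0 : 0 < flatVec N (subsetSize N) 2 := flatVec_pos h1 h2 2
  have hζn : ‖ζ‖ ≤ 2 * (N : ℝ) ^ (1 / 3 : ℝ) := by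
    refine le_of_pow_le_pow_left₀ (n := 2) (by norm_num) (by positivity) (hn.trans ?_)
    rw [← h23] at h5
    nlinarith
  exact norm_pow_sub_rotation_le hα0.le (by nlinarith) hφ0 hφ1 (norm_embed_uniformVec hMN f)
    (norm_embed_classVec h1 h2 f h.1) (norm_embedPend_classVec h1 h2 f h.1) hζn
    (by linarith) hφT (shift_embed_uniformVec h1 h2 f) (shift_embedPend f _) hζ hRa hRb
    (coin_embed_sub _ h1 h2 h) (hR _) k

theorem final_embed_apply {M : ℕ} {V : Gate (Base N m)} {ω₀ ω₁ : ℂ}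
    (hV : ∀ g : Label N m, g.supp.card = M → V (outerStar g) = ω₀ • ket (0, 0, (g, false)) ∧
      V (pendState g) = ω₁ • ket (0, 0, (g, true)))
    (f : Fin N → Fin m) (φ : Subsets N M → ℂ) (s : Subsets N M) :
    (V (embed f φ) (encode N m (false, restrict f s.1)) = ω₀ * φ s ∧
      V (embed f φ) (encode N m (true, restrict f s.1)) = 0) ∧
    (V (embedPend f φ) (encode N m (true, restrict f s.1)) = ω₁ * φ s ∧
      V (embedPend f φ) (encode N m (false, restrict f s.1)) = 0) := by
  have e1 : V (embed f φ) = ∑ t : Subsets N M, φ t • ω₀ • ket (0, 0, (restrict f t.1, false)) := by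
    simp only [embed, map_sum, map_smul]
    refine Finset.sum_congr rfl fun t _ => ?_
    rw [(hV (restrict f t.1) (by rw [supp_restrict, t.2])).1]
  have e2 : V (embedPend f φ) =
      ∑ t : Subsets N M, φ t • ω₁ • ket (0, 0, (restrict f t.1, true)) := by
    simp only [embedPend, map_sum, map_smul]
    refine Finset.sum_congr rfl fun t _ => ?_
    rw [(hV (restrict f t.1) (by rw [supp_restrict, t.2])).2]
  have hi : ∀ t : Subsets N M, restrict f s.1 = restrict f t.1 ↔ s = t := fun t =>
    ⟨fun h => Subtype.ext (restrict_injective f h), fun h => by rw [h]⟩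
  rw [e1, e2]
  simp [encode_apply, ket_apply, hi, mul_comm]

/-- The walk state is nearly y0 s + y1 |B₂⟩, with coefficients known from N and t. The algorithm
rotates s by the matching angle and attaches the phases at the end. The leakage from the plane and
the rotation error each cost δ/2. -/
theorem exists_algorithm_simulation_large (hN : 1000 ≤ N) {δ D : ℝ} (hD : 1000 ≤ D)
    (hδD : 460 / D ≤ δ / 2) (hδN : 9 / (N : ℝ) ^ (2 / 3 : ℝ) ≤ δ / 2) (t : ℝ) :
    ∃ Q : QueryAlgorithm N m, (Q.queries : ℝ) ≤ (4 * D + 8) * (N : ℝ) ^ (2 / 3 : ℝ) ∧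
        ∃ enc : Bool × (Fin N → Option (Fin m)) ↪ Q.Idx,
          ∀ f : Fin N → Fin m,
            (Function.Injective f ∨ ∃ x y, UniqueCollision f x y) →
            1 - δ ≤ ‖∑ v, star (walkState f t v) * Q.final f (enc (vertexLabel f v))‖ := by
  obtain ⟨h1, h2, h3⟩ := real_bounds (N := N) (by omega)
  obtain ⟨-, h5⟩ := subsetSize_bounds N
  have hMN : subsetSize N < N := by
    have : (subsetSize N : ℝ) < N := by linarith
    exact_mod_cast this
  have hR1 : 1 ≤ (N : ℝ) ^ (2 / 3 : ℝ) := Real.one_le_rpow (by linarith) (by norm_num)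
  have hD0 : 0 < D := by linarith
  have hδ0 : 0 ≤ δ := by
    have : 0 ≤ 460 / D := by positivity
    linarith
  set y0 := toC (startVec N) ⬝ᵥ reducedState N t with hy0
  set y1 := reducedState N t (Fin.last 3) with hy1
  have hspan := one_sub_le_reducedState hN t
  rw [← hy0, ← hy1] at hspan
  -- The argument of z is the rotation angle with the best overlap, and |z| is the overlap achieved:
  -- c‖y0‖ + d‖y1‖ = ‖z‖.
  let z : ℂ := ⟨‖y0‖, ‖y1‖⟩
  have hz : ‖z‖ ^ 2 = ‖y0‖ ^ 2 + ‖y1‖ ^ 2 := by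
    rw [Complex.sq_norm, Complex.normSq_apply, sq, sq]
  have harg0 : 0 ≤ z.arg := Complex.arg_nonneg_iff.2 (norm_nonneg y1)
  have harg1 : z.arg ≤ Real.pi / 2 :=
    (le_abs_self _).trans (Complex.abs_arg_le_pi_div_two_iff.2 (norm_nonneg y0))
  obtain ⟨k, φ, hφ0, hφ1, hϑ, hk, hφT, herr⟩ := exists_rotation_params hN hD harg0 harg1
  obtain ⟨ω₀, hω₀, hω₀'⟩ := exists_phase y0
  obtain ⟨ω₁, hω₁, hω₁'⟩ := exists_phase y1
  obtain ⟨A, hA, hAs⟩ := exists_start_circuit (N := N) (m := m) hMN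
  -- The minus sign compensates the rotation, which produces cos · s - sin · b.
  obtain ⟨V, hV⟩ := exists_final_gate (N := N) (m := m) hMN (ω₁ := -ω₁) hω₀ (by rwa [norm_neg])
  have hcirc := (Circuit.gate V).mul (((walkStep_circuit (N := N) (m := m) (M := subsetSize N)
    (φ / 2)).pow k).mul hA)
  obtain ⟨gate, hg⟩ := hcirc.exists_algorithm startIdx
  refine ⟨⟨Label N m × Bool, 2 * subsetSize N + k * 4 + 0, gate, startIdx⟩, ?_, encode N m,
    fun f hf => ?_⟩
  · push_cast
    linarith
  · have hfin : QueryAlgorithm.final ⟨Label N m × Bool, 2 * subsetSize N + k * 4 + 0, gate, startIdx⟩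
        f = (V ((walkStep (subsetSize N) (φ / 2) f ^ k)
          (embed f (uniformVec N (subsetSize N))))).ofLp := by
      rw [QueryAlgorithm.final, hg]
      change (V ((walkStep (subsetSize N) (φ / 2) f ^ k) (A f (ket startIdx)))).ofLp = _
      rw [hAs]
    rw [hfin]
    have hinj : Function.Injective fun v : WalkVertex f => encode N m (vertexLabel f v) :=
      (encode N m).injective.comp (vertexLabel_injective f)
    rcases hf with hf | ⟨x, y, hf⟩
    · rw [walkStep_pow_of_injective (show 5 ≤ N by omega) hf,
        walkState_of_injective (show 5 ≤ N by omega) hf]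
      have hv : ∀ v, V (embed f (uniformVec N (subsetSize N))) (encode N m (vertexLabel f v)) =
          ω₀ * uniformOn (originalVertices f) v := by
        rintro (s | b)
        · rw [vertexLabel_inl, (final_embed_apply hV f _ s).1.1, uniformOn_originalVertices_inl]
          rfl
        · rw [vertexLabel_inr, (final_embed_apply hV f _ b.1).1.2, uniformOn_originalVertices_inr,
            mul_zero]
      have hsum : ∑ v, star (uniformOn (originalVertices f) v) *
          V (embed f (uniformVec N (subsetSize N))) (encode N m (vertexLabel f v)) =
          ω₀ * (star (uniformOn (originalVertices f)) ⬝ᵥ uniformOn (originalVertices f)) := by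
        rw [dotProduct, Finset.mul_sum]
        refine Finset.sum_congr rfl fun v _ => ?_
        rw [hv, Pi.star_apply]
        ring
      have hn := normSq_walkState f 0
      rw [walkState_of_injective (show 5 ≤ N by omega) hf] at hn
      rw [hsum, star_dotProduct_self, hn, norm_mul, hω₀]
      simpa using hδ0
    · have hrot := walkStep_rotation hN hf (k := k) hφ0 hφ1 hφT
      rw [hϑ] at hrot
      set c := Real.cos z.arg with hcdef
      set d := Real.sin z.arg with hddef
      have hlow := sub_le_norm_sum_star_mul hinj (normSq_walkState f t)
        (V ((walkStep (subsetSize N) (φ / 2) f ^ k) (embed f (uniformVec N (subsetSize N)))))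
        (V ((c : ℂ) • embed f (uniformVec N (subsetSize N)) -
          (d : ℂ) • embedPend f (classVec (subsetSize N) x y 2)))
      rw [← map_sub, LinearIsometryEquiv.norm_map] at hlow
      have hv : ∀ v, V ((c : ℂ) • embed f (uniformVec N (subsetSize N)) -
          (d : ℂ) • embedPend f (classVec (subsetSize N) x y 2)) (encode N m (vertexLabel f v)) =
          c * ω₀ * uniformOn (originalVertices f) v + d * ω₁ * uniformOn (pendantVertices f) v := by
        have hp : ∀ v, uniformOn (pendantVertices f) v = reducedBasis f x y v (Fin.last 3) :=
          fun v => rfl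
        rintro (s | b)
        · rw [vertexLabel_inl, map_sub, map_smul, map_smul, PiLp.sub_apply, PiLp.smul_apply,
            PiLp.smul_apply, (final_embed_apply hV f _ s).1.1, (final_embed_apply hV f _ s).2.2,
            uniformOn_originalVertices_inl, hp, reducedBasis_inl_last, smul_zero, sub_zero, mul_zero,
            add_zero, smul_eq_mul, mul_assoc]
          rfl
        · rw [vertexLabel_inr, map_sub, map_smul, map_smul, PiLp.sub_apply, PiLp.smul_apply,
            PiLp.smul_apply, (final_embed_apply hV f _ b.1).1.2, (final_embed_apply hV f _ b.1).2.1,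
            uniformOn_originalVertices_inr, hp, reducedBasis_inr_last hf, smul_eq_mul, smul_eq_mul]
          ring
      have hconj : ∀ u : WalkVertex f → ℂ, ∑ v, star (walkState f t v) * u v =
          star (star u ⬝ᵥ walkState f t) := fun u => by
        rw [dotProduct, star_sum]
        refine Finset.sum_congr rfl fun v _ => ?_
        rw [star_mul', Pi.star_apply, star_star]
        ring
      have hsum : ∑ v, star (walkState f t v) * V ((c : ℂ) • embed f (uniformVec N (subsetSize N)) -
          (d : ℂ) • embedPend f (classVec (subsetSize N) x y 2)) (encode N m (vertexLabel f v)) =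
          ((c * ‖y0‖ + d * ‖y1‖ : ℝ) : ℂ) := by
        simp only [hv, mul_add, Finset.sum_add_distrib]
        have e : ∀ (r : ℂ) (u : WalkVertex f → ℂ), ∑ v, star (walkState f t v) * (r * u v) =
            r * ∑ v, star (walkState f t v) * u v := fun r u => by
          rw [Finset.mul_sum]
          exact Finset.sum_congr rfl fun v _ => by ring
        rw [e, e, hconj, hconj, star_originalVertices_dotProduct_walkState (by omega) hf,
          star_pendantVertices_dotProduct_walkState (by omega) hf, ← hy0, ← hy1, mul_assoc, mul_assoc,
          hω₀', hω₁']
        push_cast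
        ring
      have hr : c * ‖y0‖ + d * ‖y1‖ = ‖z‖ := by
        have e0 : ‖y0‖ = ‖z‖ * c := (Complex.norm_mul_cos_arg z).symm
        have e1 : ‖y1‖ = ‖z‖ * d := (Complex.norm_mul_sin_arg z).symm
        rw [e0, e1]
        have := Real.cos_sq_add_sin_sq z.arg
        rw [← hcdef, ← hddef] at this
        linear_combination ‖z‖ * this
      rw [hsum, hr, Complex.norm_real, Real.norm_of_nonneg (norm_nonneg z)] at hlow
      refine le_trans ?_ hlow
      -- For numbers in [0, 1) the square is no larger, so the bound on ‖z‖² passes to ‖z‖.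
      have hz1 : 1 - δ / 2 ≤ ‖z‖ := by
        by_contra! hlt
        have : ‖z‖ ^ 2 < 1 - δ / 2 := by nlinarith [norm_nonneg z]
        linarith
      linarith

end simulate

end EDWalk

namespace EDWalk

set_option linter.unusedSectionVars false

/-! ### Simulation for boundedly many indices, and for all -/

theorem blockGate_permGate_ket {I α β : Type*} [Fintype I] [DecidableEq I] [Fintype α]
    [DecidableEq α] [Fintype β] [DecidableEq β] (e : I ≃ α × β) (σ : Equiv.Perm β) (a : α) (b : β) :
    blockGate e (fun _ => permGate σ) (ket (e.symm (a, b))) = ket (e.symm (a, σ b)) := by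
  have h : ∀ (b : β) (a' : α), slice e a' (ket (e.symm (a, b))) = if a' = a then ket b else 0 := by
    intro b a'
    ext b'
    rw [slice_apply, ket_apply]
    simp only [EmbeddingLike.apply_eq_iff_eq, Prod.mk.injEq]
    by_cases ha : a' = a <;> simp [ha, ket_apply]
  refine slice_ext e fun a' => ?_
  rw [slice_blockGate, h, h]
  split_ifs
  · rw [permGate_ket]
  · rw [map_zero]

section small

variable {N m : ℕ} [NeZero N] [NeZero m]

/-- All values of `f` can be read with `N` queries and then erased again, so that the walk can be
simulated exactly. -/
theorem exists_algorithm_simulation_exact (t : ℝ) :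
    ∃ Q : QueryAlgorithm N m, Q.queries = 4 * N ∧
        ∃ enc : Bool × (Fin N → Option (Fin m)) ↪ Q.Idx, ∀ f : Fin N → Fin m,
          ‖∑ v, star (walkState f t v) * Q.final f (enc (vertexLabel f v))‖ = 1 := by
  let e := Circuit.spectatorEquiv N m (Label N m × Bool) (Bool × Label N m)
  let b0 : Base N m := (0, 0, (zeroLabel Finset.univ, false))
  let b1 : (Fin N → Fin m) → Base N m := fun f => (0, 0, (restrict f Finset.univ, false))
  let y0 : Bool × Label N m := (false, fun _ => none)
  have hb1 : Function.Injective b1 := fun f g h => by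
    simp only [b1, Prod.mk.injEq, and_true, true_and] at h
    funext x
    simpa [restrict] using congrFun h x
  have hload : ∀ f : Fin N → Fin m, loadPerm f N b0 = b1 f := fun f => by
    have := loadPerm_apply f Finset.univ false
    rwa [Finset.card_univ, Fintype.card_fin] at this
  let w : (Fin N → Fin m) → Hil (Fin N × Fin m × ((Label N m × Bool) × (Bool × Label N m))) :=
    fun f => ∑ v, walkState f t v • ket (e.symm (vertexLabel f v, b1 f))
  have o1 : Orthonormal ℂ fun f : Fin N → Fin m =>
      (ket (e.symm (y0, b1 f)) : Hil (Fin N × Fin m × ((Label N m × Bool) × (Bool × Label N m)))) :=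
    orthonormal_ket.comp _ fun f g h => hb1 (Prod.mk.inj (e.symm.injective h)).2
  -- The register holding the full table of f separates different f, so a single gate independent of
  -- f can map each table to its own walk state.
  have o2 : Orthonormal ℂ w := by
    refine ⟨fun f => ?_, fun f g hfg => ?_⟩
    · have hi : Function.Injective fun v => e.symm (vertexLabel f v, b1 f) := fun v v' h =>
        vertexLabel_injective f (Prod.mk.inj (e.symm.injective h)).1
      rw [← sq_eq_sq₀ (norm_nonneg _) zero_le_one, norm_sum_smul_ket hi, normSq_walkState, one_pow]
    · have hne : ∀ a a', e.symm (a, b1 f) ≠ e.symm (a', b1 g) := fun a a' h =>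
        hfg (hb1 (Prod.mk.inj (e.symm.injective h)).2)
      simp only [w, sum_inner, inner_sum, inner_smul_left, inner_smul_right, inner_ket_left,
        ket_apply, if_neg (hne _ _), mul_zero, Finset.sum_const_zero]
  obtain ⟨V, hV⟩ := exists_gate_of_orthonormal o1 o2
  have hc := (loadPerm_circuit (N := N) (m := m) N).spectator (Y := Bool × Label N m)
  have hcirc := (hc.inv).mul ((Circuit.gate V).mul hc)
  obtain ⟨gate, hg⟩ := hcirc.exists_algorithm (e.symm (y0, b0))
  refine ⟨⟨(Label N m × Bool) × (Bool × Label N m), 2 * N + 0 + 2 * N, gate, e.symm (y0, b0)⟩,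
    by ring, ⟨fun a => e.symm (a, b0), fun a a' h => (Prod.mk.inj (e.symm.injective h)).1⟩,
    fun f => ?_⟩
  -- The table is erased by running the loading backwards, which leaves an encoding independent of
  -- f.
  have hback : ∀ a, (blockGate e fun _ => permGate (loadPerm f N))⁻¹ (ket (e.symm (a, b1 f))) =
      ket (e.symm (a, b0)) := fun a => by
    rw [← hload, ← blockGate_permGate_ket]
    exact LinearIsometryEquiv.symm_apply_apply _ _
  have hfin : QueryAlgorithm.final ⟨(Label N m × Bool) × (Bool × Label N m), 2 * N + 0 + 2 * N,
      gate, e.symm (y0, b0)⟩ f =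
      (∑ v, walkState f t v • (ket (e.symm (vertexLabel f v, b0)) :
        Hil (Fin N × Fin m × ((Label N m × Bool) × (Bool × Label N m))))).ofLp := by
    rw [QueryAlgorithm.final, hg]
    change ((blockGate e fun _ => permGate (loadPerm f N))⁻¹
      (V (blockGate e (fun _ => permGate (loadPerm f N)) (ket (e.symm (y0, b0)))))).ofLp = _
    rw [blockGate_permGate_ket, hload, hV]
    simp only [w, map_sum, map_smul, hback]
  have hv : ∀ v, (∑ v, walkState f t v • (ket (e.symm (vertexLabel f v, b0)) :
        Hil (Fin N × Fin m × ((Label N m × Bool) × (Bool × Label N m))))).ofLp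
          (e.symm (vertexLabel f v, b0)) = walkState f t v := fun v => by
    have hi : ∀ v', e.symm (vertexLabel f v, b0) = e.symm (vertexLabel f v', b0) ↔ v = v' := fun v' =>
      ⟨fun h => vertexLabel_injective f (Prod.mk.inj (e.symm.injective h)).1, fun h => by rw [h]⟩
    simp only [WithLp.ofLp_sum, WithLp.ofLp_smul, Finset.sum_apply, Pi.smul_apply, smul_eq_mul,
      ket_apply, hi, mul_ite, mul_one, mul_zero, Finset.sum_ite_eq, Finset.mem_univ, if_true]
  rw [hfin]
  refine (congrArg norm (Finset.sum_congr rfl fun v _ => congrArg (_ * ·) (hv v))).trans ?_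
  refine (congrArg norm (star_dotProduct_self (walkState f t))).trans ?_
  rw [normSq_walkState]
  simp

end small

/-- The continuous-time walk is simulated for time `O(N^{1/3})` with `O(N^{2/3})` queries. -/
theorem walk_simulation : ∀ τ > (0 : ℝ), ∀ δ > (0 : ℝ), ∃ C > (0 : ℝ), ∀ N : ℕ, 1 ≤ N →
    ∀ m : ℕ, 1 ≤ m → ∀ t : ℝ, 0 ≤ t → t ≤ τ * (N : ℝ) ^ (1 / 3 : ℝ) →
      ∃ Q : QueryAlgorithm N m, (Q.queries : ℝ) ≤ C * (N : ℝ) ^ (2 / 3 : ℝ) ∧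
        ∃ enc : Bool × (Fin N → Option (Fin m)) ↪ Q.Idx,
          ∀ f : Fin N → Fin m,
            (Function.Injective f ∨ ∃ x y, UniqueCollision f x y) →
            1 - δ ≤ ‖∑ v, star (walkState f t v) * Q.final f (enc (vertexLabel f v))‖ := by
  intro τ _ δ hδ
  have hlim : Tendsto (fun N : ℕ => (N : ℝ) ^ (2 / 3 : ℝ)) atTop atTop :=
    (tendsto_rpow_atTop (by norm_num)).comp tendsto_natCast_atTop_atTop
  obtain ⟨N₀, hN₀⟩ := eventually_atTop.1
    ((hlim.eventually_ge_atTop (18 / δ)).and (eventually_ge_atTop 1000))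
  have hD1 : 1000 ≤ 1000 + 920 / δ := le_add_of_nonneg_right (by positivity)
  -- D = 1000 + 920/δ makes 460/D ≤ δ/2, and N^{2/3} ≥ 18/δ makes the leakage at most δ/2. The
  -- summand 4N₀ pays for the exact simulation below N₀.
  refine ⟨4 * (1000 + 920 / δ) + 8 + 4 * N₀, by positivity, fun N hN m hm t _ _ => ?_⟩
  have : NeZero N := ⟨by omega⟩
  have : NeZero m := ⟨by omega⟩
  have hR : 1 ≤ (N : ℝ) ^ (2 / 3 : ℝ) := Real.one_le_rpow (by exact_mod_cast hN) (by norm_num)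
  rcases le_or_gt N₀ N with h | h
  · obtain ⟨h1, h2⟩ := hN₀ N h
    obtain ⟨Q, hQ, enc, henc⟩ := exists_algorithm_simulation_large (N := N) (m := m) h2 (δ := δ) hD1
      (by
        rw [div_le_div_iff₀ (by positivity) two_pos, mul_add, mul_div_cancel₀ _ hδ.ne']
        linarith)
      (by
        rw [div_le_iff₀ hδ] at h1
        rw [div_le_div_iff₀ (by positivity) two_pos]
        linarith) t
    refine ⟨Q, hQ.trans ?_, enc, henc⟩
    exact mul_le_mul_of_nonneg_right (le_add_of_nonneg_right (by positivity)) (by positivity)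
  · obtain ⟨Q, hQ, enc, henc⟩ := exists_algorithm_simulation_exact (N := N) (m := m) t
    refine ⟨Q, ?_, enc, fun f _ => by rw [henc]; linarith⟩
    rw [hQ]
    push_cast
    have hlt : (N : ℝ) ≤ N₀ := by exact_mod_cast h.le
    have : 0 ≤ 920 / δ := by positivity
    nlinarith [mul_le_mul hlt hR zero_le_one (Nat.cast_nonneg N₀)]

end EDWalk

theorem mainTheorem5 :
    -- the Hamiltonian in the basis `|A₀⟩, |A₁⟩, |A₂⟩, |B₂⟩`
    (∀ (N m : ℕ) (f : Fin N → Fin m) (x y : Fin N), EDWalk.UniqueCollision f x y →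
      EDWalk.walkHamiltonian f * EDWalk.reducedBasis f x y =
        EDWalk.reducedBasis f x y * EDWalk.reducedHamiltonian N) ∧
    -- the norm of `abs(H)`
    ((fun N : ℕ => EDWalk.absNorm (EDWalk.reducedHamiltonian N) - 2 * (N : ℝ) ^ (1 / 3 : ℝ))
      =O[atTop] fun N : ℕ => (N : ℝ) ^ (-(1 / 3) : ℝ)) ∧
    -- constant overlap with `|B₂⟩` in time `O(N^{1/3})`
    (∃ c > (0 : ℝ), ∃ C > (0 : ℝ), ∃ N₀ : ℕ, ∀ N : ℕ, N₀ ≤ N →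
      ∃ t : ℝ, 0 ≤ t ∧ t ≤ C * (N : ℝ) ^ (1 / 3 : ℝ) ∧
        ∀ (m : ℕ) (f : Fin N → Fin m) (x y : Fin N), EDWalk.UniqueCollision f x y →
          c ≤ ‖star (EDWalk.uniformOn (EDWalk.pendantVertices f)) ⬝ᵥ EDWalk.walkState f t‖) ∧
    -- simulation of `exp(-iHt)` by `O(‖abs(H)‖ t / √δ)` steps of the discrete-time walk
    (∃ C > (0 : ℝ), ∀ N : ℕ, 5 ≤ N → ∃ d : Fin 4 → ℝ,
      EDWalk.IsPrincipal (-EDWalk.reducedHamiltonian N) d ∧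
      ∀ t : ℝ, 0 ≤ t → ∀ δ : ℝ, 0 < δ → δ ≤ 1 → ∃ K : ℕ, 1 ≤ K ∧
        (EDWalk.simulationSteps K : ℝ) ≤
          C * (EDWalk.absNorm (EDWalk.reducedHamiltonian N) * t / √δ) ∧
        ∀ ψ : Fin 4 → ℂ, ∑ j, ‖ψ j‖ ^ 2 = 1 →
          1 - δ ≤ ‖star (EDWalk.evolution (EDWalk.reducedHamiltonian N) t *ᵥ ψ) ⬝ᵥ
            (EDWalk.simulation (-EDWalk.reducedHamiltonian N) d K (-t) *ᵥ ψ)‖) ∧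
    -- simulation of the walk for time `O(N^{1/3})` by `O(N^{2/3})` queries
    (∀ τ > (0 : ℝ), ∀ δ > (0 : ℝ), ∃ C > (0 : ℝ), ∀ N : ℕ, 1 ≤ N → ∀ m : ℕ, 1 ≤ m → ∀ t : ℝ, 0 ≤ t →
      t ≤ τ * (N : ℝ) ^ (1 / 3 : ℝ) →
      ∃ Q : EDWalk.QueryAlgorithm N m, (Q.queries : ℝ) ≤ C * (N : ℝ) ^ (2 / 3 : ℝ) ∧
        ∃ enc : Bool × (Fin N → Option (Fin m)) ↪ Q.Idx,
          ∀ f : Fin N → Fin m,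
            (Function.Injective f ∨ ∃ x y, EDWalk.UniqueCollision f x y) →
            1 - δ ≤ ‖∑ v, star (EDWalk.walkState f t v) *
              Q.final f (enc (EDWalk.vertexLabel f v))‖) ∧
    -- element distinctness with `O(N^{2/3})` queries and bounded error
    (∃ C > (0 : ℝ), ∀ N : ℕ, 1 ≤ N → ∀ m : ℕ, 1 ≤ m →
      ∃ Q : EDWalk.QueryAlgorithm N m, (Q.queries : ℝ) ≤ C * (N : ℝ) ^ (2 / 3 : ℝ) ∧
        ∃ E : Finset Q.Idx, ∀ f : Fin N → Fin m,
          ((∃ x y, x ≠ y ∧ f x = f y) → 2 / 3 ≤ Q.prob f E) ∧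
          ((¬ ∃ x y, x ≠ y ∧ f x = f y) → Q.prob f E ≤ 1 / 3)) := by
  exact ⟨fun N m f x y h => EDWalk.walkHamiltonian_mul_reducedBasis f x y h,
    EDWalk.absNorm_isBigO, EDWalk.constant_overlap, EDWalk.discrete_simulation,
    EDWalk.walk_simulation, EDWalk.element_distinctness⟩
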